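/- Let $E$ be the $2\times 2$ identity matrix and $$I=\begin{pmatrix}\sqrt{-1}&0\\0&-\sqrt{-1}\end{pmatrix},\quad J=\begin{pmatrix}0&\sqrt{-1}\\ \sqrt{-1}&0\end{pmatrix},\quad K=IJ=\begin{pmatrix}0&-1\\1&0\end{pmatrix},$$ and let $Q_8=\{\pm E,\pm I,\pm J,\pm K\}$. Identify $V=\mathbb{C}^4$ with the space of complex $2\times2$ matrices so that the standard basis $e_1,e_2,e_3,e_4$ corresponds to $E,I,J,K$. Let $N\subset SL(4,\mathbb{C})$ be the (imprimitive) group of order $64$ generated by the maps $a\mapsto paq^{-1}$, $p,q\in Q_8$, and by the scalar $\sqrt{-1}$. Let $W_1,\dots,W_6\subset\bigwedge^2V$ be the lines spanned, in this order, by $$e_1\wedge e_2\pm e_3\wedge e_4,\qquad e_1\wedge e_3\pm e_2\wedge e_4,\qquad e_1\wedge e_4\pm e_2\wedge e_3 .$$ Let $\mathcal S_3=\{x_1+\dots+x_6=x_1^3+\dots+x_6^3=0\}\subset\mathbb{P}^5$ be the Segre cubic, a cubic hypersurface in the hyperplane $\mathbb{P}^4=\{\sum x_i=0\}$, on which $\mathfrak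 S_6$ acts in the standard way by permuting the coordinates. **Theorem.** Let $G\subset SL(4,\mathbb{C})$ be a finite subgroup that contains $N$ as a normal subgroup. Then $G$ permutes the lines $W_1,\dots,W_6$, and this induces an injective homomorphism $\pi\colon G/N\hookrightarrow\mathfrak S_6$, given by $gW_i=W_{\pi(gN)(i)}$. The group $\mathfrak S_6$ has an outer (that is, non-inner) automorphism, and for every outer automorphism $\lambda$ of $\mathfrak S_6$ the quotient $\mathbb{P}^3/G$ is birationally isomorphic over $\mathbb{C}$ to the quotient $\mathcal S_3/(G/N)$, where $G/N$ acts on $\mathcal S_3$ through $\lambda\circ\pi\colon G/N\to\mathfrak S_6$ and the standard action of $\mathfrak S_6$. -/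

import Mathlib

open AlgebraicGeometry CategoryTheory MvPolynomial

attribute [local instance] MvPolynomial.gradedAlgebra

namespace SegreQuotient

/-! ## Quotients of projective schemes by finite groups -/

section Generic

variable {A : Type} [CommRing A] [Algebra ℂ A]

/-- The group of degree-preserving `ℂ`-algebra automorphisms of `A = ⨁ 𝒜 i`. -/
def gradedAut (𝒜 : ℕ → Submodule ℂ A) : Subgroup (A ≃ₐ[ℂ] A) where
  carrier := {e | ∀ i a, e a ∈ 𝒜 i ↔ a ∈ 𝒜 i}
  one_mem' := fun _ _ => Iff.rfl
  mul_mem' := fun {e f} he hf i a => (he i (f a)).trans (hf i a)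
  inv_mem' := fun {e} he i a => by
    have h := he i (e.symm a)
    rw [AlgEquiv.apply_symm_apply] at h
    exact h.symm

variable {𝒜 : ℕ → Submodule ℂ A} {Γ : Type} [Group Γ]

/-- The ring of invariants `A ^ Γ` of a group `Γ` acting on `A` by graded automorphisms. -/
def invariants (ρ : Γ →* gradedAut 𝒜) : Subalgebra ℂ A where
  carrier := {a | ∀ γ, (ρ γ : A ≃ₐ[ℂ] A) a = a}
  mul_mem' := fun {a b} ha hb γ => by rw [map_mul, ha γ, hb γ]
  add_mem' := fun {a b} ha hb γ => by rw [map_add, ha γ, hb γ]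
  algebraMap_mem' := fun r γ => (ρ γ : A ≃ₐ[ℂ] A).commutes r

/-- The grading `(A ^ Γ)_i = A ^ Γ ∩ A_i` of the ring of invariants. -/
def invariantsGrading (ρ : Γ →* gradedAut 𝒜) (i : ℕ) : Submodule ℂ (invariants ρ) :=
  (𝒜 i).comap (invariants ρ).val.toLinearMap

theorem decompose_mem_invariants [GradedAlgebra 𝒜] (ρ : Γ →* gradedAut 𝒜) {a : A}
    (ha : a ∈ invariants ρ) (i : ℕ) : (DirectSum.decompose 𝒜 a i : A) ∈ invariants ρ := by
  classical
  intro γ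
  have key : ∀ b : A, (ρ γ : A ≃ₐ[ℂ] A) (DirectSum.decompose 𝒜 b i : A) =
      (DirectSum.decompose 𝒜 ((ρ γ : A ≃ₐ[ℂ] A) b) i : A) := by
    intro b
    induction b using DirectSum.Decomposition.inductionOn 𝒜 with
    | zero => simp
    | @homogeneous j m =>
      have hm : (ρ γ : A ≃ₐ[ℂ] A) (m : A) ∈ 𝒜 j := ((ρ γ).2 j m).2 m.2
      by_cases h : j = i
      · subst h
        rw [DirectSum.decompose_of_mem_same 𝒜 m.2, DirectSum.decompose_of_mem_same 𝒜 hm]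
      · rw [DirectSum.decompose_of_mem_ne 𝒜 m.2 h, DirectSum.decompose_of_mem_ne 𝒜 hm h, map_zero]
    | add b c hb hc => simp [DirectSum.decompose_add, hb, hc]
  rw [key a, ha γ]

noncomputable instance invariantsGradedAlgebra [GradedAlgebra 𝒜] (ρ : Γ →* gradedAut 𝒜) :
    GradedAlgebra (invariantsGrading ρ) where
  one_mem := (SetLike.GradedOne.one_mem : (1 : A) ∈ 𝒜 0)
  mul_mem := fun _ _ _ _ ha hb => SetLike.GradedMul.mul_mem (A := 𝒜) ha hb
  toDecomposition := by
    classical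
    refine DirectSum.IsInternal.chooseDecomposition _
      (DirectSum.isInternal_submodule_of_iSupIndep_of_iSup_eq_top ?_ ?_)
    · have h := (DirectSum.Decomposition.isInternal 𝒜).submodule_iSupIndep
      rw [iSupIndep_iff_finsetSum_eq_zero_imp_eq_zero] at h ⊢
      intro s v hv hs i hi
      refine Subtype.ext (h s (fun i => (v i : A)) (fun i hi => hv i hi) ?_ i hi)
      have := congrArg (invariants ρ).val hs
      simpa using this
    · rw [eq_top_iff]
      rintro ⟨a, ha⟩ -
      have : (⟨a, ha⟩ : invariants ρ) = ∑ i ∈ (DirectSum.decompose 𝒜 a).support,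
          ⟨(DirectSum.decompose 𝒜 a i : A), decompose_mem_invariants ρ ha i⟩ := by
        refine Subtype.ext ?_
        simpa using (DirectSum.sum_support_decompose 𝒜 a).symm
      rw [this]
      exact Submodule.sum_mem _ fun i _ => Submodule.mem_iSup_of_mem i
        (show (DirectSum.decompose 𝒜 a i : A) ∈ 𝒜 i from SetLike.coe_mem _)

variable (𝒜) in
/-- The structure morphism of the `ℂ`-scheme `Proj A`. -/
noncomputable def projToSpec [GradedAlgebra 𝒜] : Proj 𝒜 ⟶ Spec (CommRingCat.of ℂ) :=
  Proj.toSpecZero 𝒜 ≫ Spec.map (CommRingCat.ofHom (algebraMap ℂ (𝒜 0)))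

/-- The quotient of `Proj A` by a finite group `Γ` acting on `A` by graded automorphisms:
`(Proj A) / Γ = Proj (A ^ Γ)`. -/
noncomputable def projQuotient [GradedAlgebra 𝒜] (ρ : Γ →* gradedAut 𝒜) : Scheme.{0} :=
  Proj (invariantsGrading ρ)

/-- The structure morphism of the `ℂ`-scheme `(Proj A) / Γ`. -/
noncomputable def projQuotientToSpec [GradedAlgebra 𝒜] (ρ : Γ →* gradedAut 𝒜) :
    projQuotient ρ ⟶ Spec (CommRingCat.of ℂ) :=
  projToSpec (invariantsGrading ρ)

/-- The grading of the quotient of a graded algebra by a homogeneous ideal. -/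
def quotientGrading [GradedAlgebra 𝒜] (I : HomogeneousIdeal 𝒜) (i : ℕ) :
    Submodule ℂ (A ⧸ I.toIdeal) :=
  (𝒜 i).map (Ideal.Quotient.mkₐ ℂ I.toIdeal).toLinearMap

noncomputable instance quotientGradedAlgebra [GradedAlgebra 𝒜] (I : HomogeneousIdeal 𝒜) :
    GradedAlgebra (quotientGrading I) where
  one_mem := ⟨1, SetLike.GradedOne.one_mem, map_one (Ideal.Quotient.mkₐ ℂ I.toIdeal)⟩
  mul_mem := by
    rintro i j _ _ ⟨a, ha, rfl⟩ ⟨b, hb, rfl⟩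
    exact ⟨a * b, SetLike.GradedMul.mul_mem ha hb, map_mul (Ideal.Quotient.mkₐ ℂ I.toIdeal) a b⟩
  toDecomposition := by
    classical
    refine DirectSum.IsInternal.chooseDecomposition _
      (DirectSum.isInternal_submodule_of_iSupIndep_of_iSup_eq_top ?_ ?_)
    · rw [iSupIndep_iff_finsetSum_eq_zero_imp_eq_zero]
      intro s v hv hs i hi
      choose! a ha hav using hv
      have hav' : ∀ i ∈ s, Ideal.Quotient.mk I.toIdeal (a i) = v i := hav
      have hsum : ∑ i ∈ s, a i ∈ I.toIdeal := by
        rw [← Ideal.Quotient.eq_zero_iff_mem, map_sum, Finset.sum_congr rfl hav', hs]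
      have hcomp := I.isHomogeneous i hsum
      rw [DirectSum.decompose_sum, DFinsupp.finsetSum_apply, AddSubmonoidClass.coe_finsetSum,
        Finset.sum_eq_single i, DirectSum.decompose_of_mem_same 𝒜 (ha i hi)] at hcomp
      · rw [← hav' i hi, Ideal.Quotient.eq_zero_iff_mem]
        exact hcomp
      · intro j hj hji
        exact DirectSum.decompose_of_mem_ne 𝒜 (ha j hj) hji
      · exact fun h => absurd hi h
    · have h := (DirectSum.Decomposition.isInternal 𝒜).submodule_iSup_eq_top
      have h2 : ⨆ i, quotientGrading I i =
          (⨆ i, 𝒜 i).map (Ideal.Quotient.mkₐ ℂ I.toIdeal).toLinearMap :=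
        (Submodule.map_iSup _ _).symm
      rw [h2, h, Submodule.map_top, LinearMap.range_eq_top]
      exact Ideal.Quotient.mk_surjective

end Generic

/-! ## The action of `SL(4, ℂ)` on `ℙ³` -/

/-- The special linear group `SL(4, ℂ)`. -/
abbrev SL4 : Type := Matrix.SpecialLinearGroup (Fin 4) ℂ

/-- The linear substitution `f ↦ f ∘ g⁻¹` on polynomial functions on `ℂ⁴`. -/
noncomputable def substEquiv (g : SL4) :
    MvPolynomial (Fin 4) ℂ ≃ₐ[ℂ] MvPolynomial (Fin 4) ℂ :=
  AlgEquiv.ofAlgHom (bind₁ (g⁻¹ : SL4).1.toMvPolynomial) (bind₁ g.1.toMvPolynomial)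
    (by
      ext i : 1
      rw [AlgHom.comp_apply, bind₁_X_right, ← Matrix.toMvPolynomial_mul,
        ← Matrix.SpecialLinearGroup.coe_mul, mul_inv_cancel, Matrix.SpecialLinearGroup.coe_one,
        Matrix.toMvPolynomial_one, AlgHom.id_apply])
    (by
      ext i : 1
      rw [AlgHom.comp_apply, bind₁_X_right, ← Matrix.toMvPolynomial_mul,
        ← Matrix.SpecialLinearGroup.coe_mul, inv_mul_cancel, Matrix.SpecialLinearGroup.coe_one,
        Matrix.toMvPolynomial_one, AlgHom.id_apply])

theorem substEquiv_apply (g : SL4) (f : MvPolynomial (Fin 4) ℂ) :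
    substEquiv g f = bind₁ (g⁻¹ : SL4).1.toMvPolynomial f := rfl

theorem substEquiv_mul (g h : SL4) : substEquiv (g * h) = substEquiv g * substEquiv h := by
  refine AlgEquiv.ext fun f => ?_
  rw [AlgEquiv.mul_apply, substEquiv_apply, substEquiv_apply, substEquiv_apply, bind₁_bind₁,
    mul_inv_rev]
  congr 2
  funext i
  rw [Matrix.SpecialLinearGroup.coe_mul, Matrix.toMvPolynomial_mul]

theorem substEquiv_homogeneous (g : SL4) (i : ℕ) (f : MvPolynomial (Fin 4) ℂ)
    (hf : f ∈ homogeneousSubmodule (Fin 4) ℂ i) :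
    substEquiv g f ∈ homogeneousSubmodule (Fin 4) ℂ i := by
  rw [mem_homogeneousSubmodule] at hf ⊢
  have h := IsHomogeneous.aeval hf (g⁻¹ : SL4).1.toMvPolynomial
    (fun j => Matrix.toMvPolynomial_isHomogeneous _ j)
  rw [one_mul] at h
  exact h

/-- The action of `SL(4, ℂ)` on the homogeneous coordinate ring `ℂ[x₀, x₁, x₂, x₃]` of `ℙ³`,
`(g • f)(v) = f(g⁻¹ v)`. -/
noncomputable def linearAction : SL4 →* gradedAut (homogeneousSubmodule (Fin 4) ℂ) :=
  MonoidHom.mk' (fun g => ⟨substEquiv g, fun i f => ⟨fun h => by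
      have h2 := substEquiv_homogeneous g⁻¹ i _ h
      rwa [← AlgEquiv.mul_apply, ← substEquiv_mul, inv_mul_cancel,
        show substEquiv 1 = 1 from by
          have h1 := substEquiv_mul 1 1
          rw [mul_one] at h1
          exact (left_eq_mul.mp h1)] at h2,
    substEquiv_homogeneous g i f⟩⟩)
    (fun g h => Subtype.ext (substEquiv_mul g h))

/-- The structure morphism `ℙ³ / G ⟶ Spec ℂ` of the quotient of `ℙ³ = Proj ℂ[x₀, x₁, x₂, x₃]`
by a subgroup `G` of `SL(4, ℂ)`. -/
noncomputable def projectiveSpaceQuotient (G : Subgroup SL4) :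
    projQuotient (linearAction.comp G.subtype) ⟶ Spec (CommRingCat.of ℂ) :=
  projQuotientToSpec (linearAction.comp G.subtype)

/-! ## The imprimitive group of order 64 -/

/-- The element `I` of the quaternion group. -/
noncomputable def quatI : Matrix (Fin 2) (Fin 2) ℂ := !![Complex.I, 0; 0, -Complex.I]

/-- The element `J` of the quaternion group. -/
noncomputable def quatJ : Matrix (Fin 2) (Fin 2) ℂ := !![0, Complex.I; Complex.I, 0]

/-- The element `K = I J` of the quaternion group. -/
noncomputable def quatK : Matrix (Fin 2) (Fin 2) ℂ := !![0, -1; 1, 0]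

/-- The quaternion group `Q₈ = {±E, ±I, ±J, ±K}`. -/
def Q8 : Set (Matrix (Fin 2) (Fin 2) ℂ) :=
  {1, -1, quatI, -quatI, quatJ, -quatJ, quatK, -quatK}

/-- The identification of `ℂ⁴` with the space of `2 × 2` matrices that sends the standard basis
`e₁, e₂, e₃, e₄` to `E, I, J, K`. -/
noncomputable def quat (v : Fin 4 → ℂ) : Matrix (Fin 2) (Fin 2) ℂ :=
  v 0 • 1 + v 1 • quatI + v 2 • quatJ + v 3 • quatK

/-- The group `N` of order 64, generated by the maps `a ↦ p a q` of the space of `2 × 2` matrices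
with `p, q ∈ Q₈` (as `Q₈` is closed under inverses, these are the maps `a ↦ p a q⁻¹`) and by the
scalar `√-1`. -/
noncomputable def N : Subgroup SL4 :=
  Subgroup.closure
    ({g | ∃ p ∈ Q8, ∃ q ∈ Q8, ∀ v, quat (g.1.mulVec v) = p * quat v * q} ∪
      {g | g.1 = Complex.I • (1 : Matrix (Fin 4) (Fin 4) ℂ)})

/-! ## The six lines in `⋀² ℂ⁴` -/

/-- The vector `e_i ∧ e_j` of `⋀² ℂ⁴`. -/
noncomputable def wedge (i j : Fin 4) : ⋀[ℂ]^2 (Fin 4 → ℂ) :=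
  exteriorPower.ιMulti ℂ 2 ![Pi.single i 1, Pi.single j 1]

/-- The vectors `w₁₂⁺, w₁₂⁻, w₁₃⁺, w₁₃⁻, w₁₄⁺, w₁₄⁻`, in this order. -/
noncomputable def w : Fin 6 → ⋀[ℂ]^2 (Fin 4 → ℂ) :=
  ![wedge 0 1 + wedge 2 3, wedge 0 1 - wedge 2 3,
    wedge 0 2 + wedge 1 3, wedge 0 2 - wedge 1 3,
    wedge 0 3 + wedge 1 2, wedge 0 3 - wedge 1 2]

/-- The six lines `W_i` in `⋀² ℂ⁴`. -/
noncomputable def W (i : Fin 6) : Submodule ℂ (⋀[ℂ]^2 (Fin 4 → ℂ)) := Submodule.span ℂ {w i}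

/-- The action of `g ∈ SL(4, ℂ)` on `⋀² ℂ⁴`. -/
noncomputable def wedgeAction (g : SL4) :
    ⋀[ℂ]^2 (Fin 4 → ℂ) →ₗ[ℂ] ⋀[ℂ]^2 (Fin 4 → ℂ) :=
  exteriorPower.map 2 (Matrix.mulVecLin g.1)

/-! ## The Segre cubic -/

/-- The homogeneous ideal `(∑ x_i, ∑ x_i ^ 3)` of `ℂ[x₁, …, x₆]`. -/
noncomputable def segreIdeal : HomogeneousIdeal (homogeneousSubmodule (Fin 6) ℂ) :=
  ⟨Ideal.span {∑ i, X i, ∑ i, X i ^ 3}, Ideal.homogeneous_span _ _ (by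
    rintro f (rfl | rfl)
    · exact ⟨1, IsHomogeneous.sum _ _ _ fun i _ => isHomogeneous_X ℂ i⟩
    · exact ⟨3, IsHomogeneous.sum _ _ _ fun i _ => isHomogeneous_X_pow i 3⟩)⟩

/-- The homogeneous coordinate ring of the Segre cubic; the Segre cubic is its `Proj`. -/
abbrev SegreRing : Type := MvPolynomial (Fin 6) ℂ ⧸ segreIdeal.toIdeal

theorem segreIdeal_map (s : Equiv.Perm (Fin 6)) :
    segreIdeal.toIdeal = segreIdeal.toIdeal.map (renameEquiv ℂ s : _ →+* _) := by
  have h1 : renameEquiv ℂ s (∑ i, X i) = ∑ i, X i := by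
    rw [map_sum, ← Equiv.sum_comp s (fun i => (X i : MvPolynomial (Fin 6) ℂ))]
    exact Finset.sum_congr rfl fun i _ => rename_X _ _
  have h3 : renameEquiv ℂ s (∑ i, X i ^ 3) = ∑ i, X i ^ 3 := by
    rw [map_sum, ← Equiv.sum_comp s (fun i => (X i : MvPolynomial (Fin 6) ℂ) ^ 3)]
    exact Finset.sum_congr rfl fun i _ => by
      rw [map_pow]; exact congrArg (· ^ 3) (rename_X _ _)
  change Ideal.span _ = Ideal.map _ (Ideal.span _)
  rw [Ideal.map_span, Set.image_pair]
  exact congrArg Ideal.span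
    (congrArg₂ (fun a b : MvPolynomial (Fin 6) ℂ => ({a, b} : Set _)) h1.symm h3.symm)

/-- The automorphism `x_i ↦ x_{s i}` of the homogeneous coordinate ring of the Segre cubic. -/
noncomputable def permEquiv (s : Equiv.Perm (Fin 6)) : SegreRing ≃ₐ[ℂ] SegreRing :=
  Ideal.quotientEquivAlg _ _ (renameEquiv ℂ s) (segreIdeal_map s)

theorem permEquiv_mk (s : Equiv.Perm (Fin 6)) (f : MvPolynomial (Fin 6) ℂ) :
    permEquiv s (Ideal.Quotient.mk _ f) = Ideal.Quotient.mk _ (rename s f) := rfl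

theorem permEquiv_mul (s t : Equiv.Perm (Fin 6)) :
    permEquiv (s * t) = permEquiv s * permEquiv t := by
  refine AlgEquiv.ext fun f => ?_
  obtain ⟨f, rfl⟩ := Ideal.Quotient.mk_surjective f
  rw [AlgEquiv.mul_apply, permEquiv_mk, permEquiv_mk, permEquiv_mk, rename_rename]
  rfl

theorem permEquiv_homogeneous (s : Equiv.Perm (Fin 6)) (i : ℕ) (f : SegreRing)
    (hf : f ∈ quotientGrading segreIdeal i) : permEquiv s f ∈ quotientGrading segreIdeal i := by
  obtain ⟨f, hf, rfl⟩ := hf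
  exact ⟨rename s f, IsHomogeneous.rename_isHomogeneous hf, rfl⟩

/-- The standard action of `𝔖₆` on the Segre cubic by permutation of the coordinates. -/
noncomputable def permAction : Equiv.Perm (Fin 6) →* gradedAut (quotientGrading segreIdeal) :=
  MonoidHom.mk' (fun s => ⟨permEquiv s, fun i f => ⟨fun h => by
      have h2 := permEquiv_homogeneous s⁻¹ i _ h
      rwa [← AlgEquiv.mul_apply, ← permEquiv_mul, inv_mul_cancel,
        show permEquiv 1 = 1 from by
          have h1 := permEquiv_mul 1 1
          rw [mul_one] at h1
          exact (left_eq_mul.mp h1)] at h2,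
    permEquiv_homogeneous s i f⟩⟩)
    (fun s t => Subtype.ext (permEquiv_mul s t))

/-- The structure morphism `𝒮₃ / Γ ⟶ Spec ℂ` of the quotient of the Segre cubic `𝒮₃` by a group
`Γ` that acts through a homomorphism `φ : Γ → 𝔖₆`. -/
noncomputable def segreCubicQuotient {Γ : Type} [Group Γ] (φ : Γ →* Equiv.Perm (Fin 6)) :
    projQuotient (permAction.comp φ) ⟶ Spec (CommRingCat.of ℂ) :=
  projQuotientToSpec (permAction.comp φ)

/-- An automorphism of a group is outer if it is not a conjugation. -/
def IsOuter {H : Type} [Group H] (a : MulAut H) : Prop :=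
  a ∉ (MulAut.conj : H →* MulAut H).range

end SegreQuotient

namespace SegreQuotient

/-! ## A criterion for birationality of projective spectra -/

section ProjCriterion

/-! The group `N` acts on each line `W i` by a sign, and these six sign characters are distinct. An
element that normalizes `N` permutes its common eigenlines, hence the `W i`; conversely an element
of `SL(4, ℂ)` that fixes all six lines lies in `N` (`mem_N_of_permutes_one`). This gives `π` and its
injectivity. All permutations occur: if `n ∈ N` satisfies `n ^ 2 = -1`, then `(1 + n) / √2` is a
square root of `n`, and five such elements, `gen k`, induce the adjacent transpositions of the
lines.

The invariants of `N` are generated by six quartic forms `theta i` with power sums `p₁ = 0` and `4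
p₄ = p₂ ^ 2` (`mem_thetaAlgebra_of_invariant`), so `ℙ³ / N` maps to the Igusa quartic. Each `gen k`
permutes these forms, up to a common sign, by a product of three disjoint transpositions. Lines and
forms are therefore permuted in ways that differ by an outer automorphism of `𝔖₆`
(`exists_isOuter_actsOnTheta`). Any two outer automorphisms differ by a conjugation, which merely
renumbers the coordinates of the Segre cubic, so one of them suffices.

The Igusa quartic and the Segre cubic are projectively dual. Up to a factor, `segreForm` is the
gradient of `4 p₄ - p₂ ^ 2` projected to the hyperplane of sum zero; it satisfies the equations of
the Segre cubic. The inverse map is given by quadrics, because `segreForm t i ^ 2` is an affine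
function of `t i` with coefficients independent of `i` (`exists_segreForm_sq`). Multiplication by
`segreSlope` removes the sign ambiguity and yields an equivariant ring homomorphism `segreHom`,
which is injective since its image has transcendence degree four. After the invariant quintic `∑ x_i
^ 5` is inverted, it identifies the degree-zero parts of the two invariant rings, and
`birationalOver_of_injective` concludes. -/

theorem exists_awayMap {R S : Type} [CommRing R] [CommRing S] [Algebra ℂ R]
    [Algebra ℂ S] (φ : S →ₐ[ℂ] R) (hφ : Function.Injective φ) (h : S) :
    ∃ χ : Localization.Away h →+* Localization.Away (φ h), Function.Injective χ ∧
      ∀ (b : S) (i : ℕ), χ (Localization.mk b ⟨h ^ i, i, rfl⟩) =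
        Localization.mk (φ b) (⟨φ h ^ i, i, rfl⟩ : Submonoid.powers (φ h)) := by
  have key : ∀ (b : S) (i : ℕ), Localization.awayMap φ.toRingHom h (Localization.mk b ⟨h ^ i, i, rfl⟩) =
      Localization.mk (φ b) (⟨φ h ^ i, i, rfl⟩ : Submonoid.powers (φ h)) := by
    intro b i
    rw [Localization.mk_eq_mk', Localization.mk_eq_mk']
    refine (IsLocalization.map_mk' _ b (⟨h ^ i, i, rfl⟩ : Submonoid.powers h)).trans ?_
    congr 1
    exact Subtype.ext (map_pow φ h i)
  refine ⟨Localization.awayMap φ.toRingHom h, ?_, key⟩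
  rw [injective_iff_map_eq_zero]
  intro x hx
  obtain ⟨b, ⟨_, i, rfl⟩, rfl⟩ := IsLocalization.exists_mk'_eq (Submonoid.powers h) x
  rw [← Localization.mk_eq_mk'] at hx ⊢
  rw [key, Localization.mk_eq_mk', IsLocalization.mk'_eq_zero_iff] at hx
  obtain ⟨⟨_, j, rfl⟩, hj⟩ := hx
  rw [Localization.mk_eq_mk', IsLocalization.mk'_eq_zero_iff]
  refine ⟨⟨h ^ j, j, rfl⟩, hφ ?_⟩
  rw [map_mul, map_pow, map_zero]
  exact hj

variable {R S : Type} [CommRing R] [IsDomain R] [Algebra ℂ R] [CommRing S] [IsDomain S]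
  [Algebra ℂ S]

/-- In a domain the zero ideal is a point of `Proj` once the irrelevant ideal is non-zero, which `f`
guarantees. This point lies in `D(g)` for every `g ≠ 0`, so it meets every non-empty open set. -/
theorem dense_basicOpen (𝒜 : ℕ → Submodule ℂ R) [GradedAlgebra 𝒜] {f : R} {m : ℕ} (hm : 0 < m)
    (hf : f ∈ 𝒜 m) (hf0 : f ≠ 0) : Dense (Proj.basicOpen 𝒜 f : Set (Proj 𝒜)) := by
  let η : Proj 𝒜 := (⟨⊥, Ideal.isPrime_bot, fun h => hf0 (by
    have h1 : f ∈ HomogeneousIdeal.irrelevant 𝒜 := by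
      rw [HomogeneousIdeal.mem_irrelevant_iff, GradedRing.proj_apply,
        DirectSum.decompose_of_mem_ne 𝒜 hf hm.ne']
    exact (h h1 : f ∈ (⊥ : Ideal R)))⟩ : ProjectiveSpectrum 𝒜)
  have hη : ∀ g : R, g ≠ 0 → η ∈ Proj.basicOpen 𝒜 g := fun g hg h => hg h
  rw [dense_iff_inter_open]
  rintro U hU ⟨x, hx⟩
  obtain ⟨_, ⟨_, ⟨g, rfl⟩, rfl⟩, hxg, hgU⟩ :=
    (Proj.isBasis_basicOpen 𝒜).exists_subset_of_mem_open hx hU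
  refine ⟨η, hgU (hη g ?_), hη f hf0⟩
  rintro rfl
  rw [Proj.basicOpen_zero] at hxg
  exact hxg

/-- The charts `D(f)` and `D(h)` are dense affine open subschemes with coordinate rings the two
homogeneous localizations; `he` makes the isomorphism between them one over `ℂ`. -/
theorem birationalOver_of_away_equiv (𝒜 : ℕ → Submodule ℂ R) [GradedAlgebra 𝒜]
    (ℬ : ℕ → Submodule ℂ S) [GradedAlgebra ℬ] {f : R} {m : ℕ} (hm : 0 < m) (hf : f ∈ 𝒜 m)
    (hf0 : f ≠ 0) {h : S} {n : ℕ} (hn : 0 < n) (hh : h ∈ ℬ n) (hh0 : h ≠ 0)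
    (e : HomogeneousLocalization.Away ℬ h ≃+* HomogeneousLocalization.Away 𝒜 f)
    (he : ∀ c : ℂ, e (HomogeneousLocalization.fromZeroRingHom ℬ _ (algebraMap ℂ (ℬ 0) c)) =
      HomogeneousLocalization.fromZeroRingHom 𝒜 _ (algebraMap ℂ (𝒜 0) c)) :
    Scheme.BirationalOver (projToSpec 𝒜) (projToSpec ℬ) := by
  have hdA : IsDominant (Proj.awayι 𝒜 f hf hm) := ⟨by
    have := dense_basicOpen 𝒜 hm hf hf0
    rwa [← Proj.opensRange_awayι 𝒜 f hf hm] at this⟩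
  have hdB : IsDominant (Proj.awayι ℬ h hh hn) := ⟨by
    have := dense_basicOpen ℬ hn hh hh0
    rwa [← Proj.opensRange_awayι ℬ h hh hn] at this⟩
  let g : Spec (.of (HomogeneousLocalization.Away 𝒜 f)) ≅
      Spec (.of (HomogeneousLocalization.Away ℬ h)) :=
    Scheme.Spec.mapIso e.toCommRingCatIso.op
  have hA := Scheme.Hom.birationalOver (Proj.awayι 𝒜 f hf hm) (projToSpec 𝒜) _ rfl
  have hB := Scheme.Hom.birationalOver (g.hom ≫ Proj.awayι ℬ h hh hn) (projToSpec ℬ)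
    (Proj.awayι 𝒜 f hf hm ≫ projToSpec 𝒜) (by
      rw [projToSpec, projToSpec, Category.assoc, Proj.awayι_toSpecZero_assoc,
        Proj.awayι_toSpecZero_assoc, ← Spec.map_comp, ← Spec.map_comp]
      change Spec.map _ ≫ Spec.map _ = _
      rw [← Spec.map_comp]
      congr 1
      refine CommRingCat.hom_ext (RingHom.ext fun c => ?_)
      exact he c)
  exact hA.symm.trans hB

/-- The factor `k` allows maps given by forms of degree `k`. Elements of the chart `D(φ h)` are
fractions `a / φ h ^ n` with `a` of degree `n * (k * m)`, so `hsurj` says that each of them, after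
expansion by `φ h ^ l`, has a numerator in the image of `φ`. -/
theorem birationalOver_of_injective (𝒜 : ℕ → Submodule ℂ R) [GradedAlgebra 𝒜]
    (ℬ : ℕ → Submodule ℂ S) [GradedAlgebra ℬ] (φ : S →ₐ[ℂ] R) (hφ : Function.Injective φ)
    {k : ℕ} (hk : 0 < k) (hdeg : ∀ i, ∀ b ∈ ℬ i, φ b ∈ 𝒜 (k * i)) {h : S} {m : ℕ} (hm : 0 < m)
    (hh : h ∈ ℬ m) (hh0 : h ≠ 0)
    (hsurj : ∀ n, ∀ a ∈ 𝒜 (n * (k * m)), ∃ l, ∃ b ∈ ℬ ((n + l) * m), φ b = a * φ h ^ l) :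
    Scheme.BirationalOver (projToSpec 𝒜) (projToSpec ℬ) := by
  have hf : φ h ∈ 𝒜 (k * m) := hdeg m h hh
  have hf0 : φ h ≠ 0 := fun h0 => hh0 (hφ (by rw [h0, map_zero]))
  let vA : HomogeneousLocalization.Away 𝒜 (φ h) →+* Localization.Away (φ h) := algebraMap _ _
  have hvA : Function.Injective vA := HomogeneousLocalization.val_injective _
  let vB : HomogeneousLocalization.Away ℬ h →+* Localization.Away h := algebraMap _ _
  have hvB : Function.Injective vB := HomogeneousLocalization.val_injective _
  obtain ⟨χ, hχ, hχmk⟩ := exists_awayMap φ hφ h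
  -- Both homogeneous localizations embed into the full localization at `φ h`; it suffices that
  -- their images agree there.
  have hrange : (χ.comp vB).range = vA.range := by
    apply le_antisymm
    · rintro _ ⟨x, rfl⟩
      obtain ⟨n, b, hb, rfl⟩ := HomogeneousLocalization.Away.mk_surjective ℬ hh x
      have hb' : φ b ∈ 𝒜 (n • (k * m)) := by
        have := hdeg _ b hb
        rwa [smul_eq_mul, mul_left_comm] at this
      refine ⟨HomogeneousLocalization.Away.mk 𝒜 hf n (φ b) hb', ?_⟩
      · change (HomogeneousLocalization.Away.mk 𝒜 hf n (φ b) hb').val =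
          χ (HomogeneousLocalization.Away.mk ℬ hh n b hb).val
        rw [HomogeneousLocalization.Away.val_mk, HomogeneousLocalization.Away.val_mk]
        exact (hχmk b n).symm
    · rintro _ ⟨x, rfl⟩
      obtain ⟨n, a, ha, rfl⟩ := HomogeneousLocalization.Away.mk_surjective 𝒜 hf x
      obtain ⟨l, b, hb, hab⟩ := hsurj n a ha
      refine ⟨HomogeneousLocalization.Away.mk ℬ hh (n + l) b hb, ?_⟩
      change χ (HomogeneousLocalization.Away.mk ℬ hh (n + l) b hb).val =
        (HomogeneousLocalization.Away.mk 𝒜 hf n a ha).val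
      rw [HomogeneousLocalization.Away.val_mk, HomogeneousLocalization.Away.val_mk]
      refine (hχmk b (n + l)).trans ?_
      rw [hab, Localization.mk_eq_mk_iff, Localization.r_iff_exists]
      exact ⟨1, by simp only [OneMemClass.coe_one, one_mul]; ring⟩
  let eB := RingEquiv.ofBijective (χ.comp vB).rangeRestrict
    ⟨fun x y hxy => hvB (hχ (congrArg Subtype.val hxy)), (χ.comp vB).rangeRestrict_surjective⟩
  let eA := RingEquiv.ofBijective vA.rangeRestrict
    ⟨fun x y hxy => hvA (congrArg Subtype.val hxy), vA.rangeRestrict_surjective⟩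
  refine birationalOver_of_away_equiv 𝒜 ℬ (Nat.mul_pos hk hm) hf hf0 hm hh hh0
    ((eB.trans (RingEquiv.subringCongr hrange)).trans eA.symm) fun c => ?_
  rw [RingEquiv.trans_apply, RingEquiv.symm_apply_eq]
  refine Subtype.ext ?_
  change χ (Localization.mk (algebraMap ℂ S c) _) = Localization.mk (algebraMap ℂ R c) _
  have := hχmk (algebraMap ℂ S c) 0
  rw [AlgHom.commutes] at this
  convert this using 2 <;> simp

end ProjCriterion

/-! ## Outer automorphisms of the symmetric group of degree six -/

section OuterAutomorphisms

open Equiv Equiv.Perm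

theorem commute_swap {α : Type*} [DecidableEq α] {p q r s : α} (h1 : p ≠ r) (h2 : p ≠ s)
    (h3 : q ≠ r) (h4 : q ≠ s) : swap p q * swap r s = swap r s * swap p q := by
  ext x
  simp only [Perm.mul_apply, swap_apply_def]
  grind

theorem IsSwap.eq_swap_apply {α : Type*} [DecidableEq α] {τ : Perm α} (h : τ.IsSwap) {p : α}
    (hp : τ p ≠ p) : τ = swap p (τ p) := by
  obtain ⟨x, y, hxy, rfl⟩ := h
  by_cases hx : p = x
  · subst hx; rw [swap_apply_left]
  · by_cases hy : p = y
    · subst hy; rw [swap_apply_right, swap_comm]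
    · exact absurd (swap_apply_of_ne_of_ne hx hy) hp

/-- An automorphism of `𝔖₆` that preserves the set of transpositions is inner. -/
theorem mem_conj_range_of_isSwap (μ : MulAut (Perm (Fin 6)))
    (hμ : ∀ i j : Fin 6, i ≠ j → (μ (swap i j)).IsSwap) :
    μ ∈ (MulAut.conj : Perm (Fin 6) →* MulAut (Perm (Fin 6))).range := by
  have hnc : ∀ i j : Fin 6, i ≠ 0 → j ≠ 0 → i ≠ j →
      μ (swap 0 i) * μ (swap 0 j) ≠ μ (swap 0 j) * μ (swap 0 i) := by
    intro i j hi hj hij h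
    rw [← map_mul, ← map_mul] at h
    have := DFunLike.congr_fun (μ.injective h) 0
    simp only [Perm.mul_apply, swap_apply_left] at this
    rw [swap_apply_of_ne_of_ne hi hij, swap_apply_of_ne_of_ne hj hij.symm] at this
    exact hij this.symm
  -- Disjoint transpositions commute, so the images of `(0 1)` and `(0 2)` share a point `p`, which
  -- will be the image of `0`.
  obtain ⟨p, q, r, hpq, hpr, hqr, h1, h2⟩ : ∃ p q r : Fin 6, p ≠ q ∧ p ≠ r ∧ q ≠ r ∧
      μ (swap 0 1) = swap p q ∧ μ (swap 0 2) = swap p r := by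
    obtain ⟨p, q, hpq, h1⟩ := hμ 0 1 (by decide)
    obtain ⟨r, s, hrs, h2⟩ := hμ 0 2 (by decide)
    have h12 := hnc 1 2 (by decide) (by decide) (by decide)
    rw [h1, h2] at h12
    by_cases hpr : p = r
    · subst hpr
      exact ⟨p, q, s, hpq, hrs, fun h => h12 (by rw [h]), h1, h2⟩
    by_cases hps : p = s
    · subst hps
      exact ⟨p, q, r, hpq, hpr, fun h => h12 (by rw [h, swap_comm]), h1, by rw [h2, swap_comm]⟩
    by_cases hqr : q = r
    · subst hqr
      exact ⟨q, p, s, hpq.symm, hrs, hps, by rw [h1, swap_comm], h2⟩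
    by_cases hqs : q = s
    · subst hqs
      exact ⟨q, p, r, hpq.symm, hqr, hpr, by rw [h1, swap_comm], by rw [h2, swap_comm]⟩
    exact absurd (commute_swap hpr hps hqr hqs) h12
  -- An image that fixes `p` but commutes with neither `(p q)` nor `(p r)` must be `(q r)`. This is
  -- already the image of `(1 2)`, which contradicts injectivity.
  have hmove : ∀ k : Fin 6, k ≠ 0 → μ (swap 0 k) p ≠ p := by
    intro k hk
    by_cases hk1 : k = 1
    · subst hk1; rw [h1, swap_apply_left]; exact hpq.symm
    by_cases hk2 : k = 2
    · subst hk2; rw [h2, swap_apply_left]; exact hpr.symm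
    intro hp
    obtain ⟨x, y, hxy, hk'⟩ := hμ 0 k hk.symm
    have c1 := hnc k 1 hk (by decide) hk1
    have c2 := hnc k 2 hk (by decide) hk2
    rw [hk', h1] at c1
    rw [hk', h2] at c2
    rw [hk'] at hp
    have hxp : x ≠ p := by rintro rfl; rw [swap_apply_left] at hp; exact hxy hp.symm
    have hyp : y ≠ p := by rintro rfl; rw [swap_apply_right] at hp; exact hxy hp
    have e1 : x = q ∨ y = q := by
      by_contra! h; exact c1 (commute_swap hxp h.1 hyp h.2)
    have e2 : x = r ∨ y = r := by
      by_contra! h; exact c2 (commute_swap hxp h.1 hyp h.2)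
    have e3 : swap x y = swap q r := by
      rcases e1 with rfl | rfl <;> rcases e2 with rfl | rfl
      · exact absurd rfl hqr
      · rfl
      · exact swap_comm _ _
      · exact absurd rfl hqr
    have e4 : μ (swap 0 k) = μ (swap 1 2) := by
      rw [hk', e3, show (swap 1 2 : Perm (Fin 6)) = swap 0 1 * swap 0 2 * swap 0 1 by decide,
        map_mul, map_mul, h1, h2]
      ext x
      simp only [Perm.mul_apply, swap_apply_def]
      grind
    have e5 := DFunLike.congr_fun (μ.injective e4) 0
    rw [swap_apply_left, swap_apply_of_ne_of_ne (by decide) (by decide)] at e5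
    exact hk e5
  let f : Fin 6 → Fin 6 := fun k => μ (swap 0 k) p
  have hf0 : f 0 = p := by
    change μ (swap 0 0) p = p
    rw [swap_self]; exact DFunLike.congr_fun (map_one μ) p
  have hf : ∀ k, μ (swap 0 k) = swap (f 0) (f k) := by
    intro k
    rw [hf0]
    by_cases hk : k = 0
    · subst hk; rw [hf0, swap_self, swap_self]; exact map_one μ
    · exact IsSwap.eq_swap_apply (hμ 0 k (Ne.symm hk)) (hmove k hk)
  have hinj : Function.Injective f := by
    intro i j hij
    have h : μ (swap 0 i) = μ (swap 0 j) := by rw [hf, hf, hij]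
    have := DFunLike.congr_fun (μ.injective h) 0
    rwa [swap_apply_left, swap_apply_left] at this
  let σ : Perm (Fin 6) := Equiv.ofBijective f hinj.bijective_of_finite
  have hσ : ∀ k, σ k = f k := fun k => rfl
  refine ⟨σ, ?_⟩
  have key : ∀ k, MulAut.conj σ (swap 0 k) = μ (swap 0 k) := by
    intro k
    rw [hf, MulAut.conj_apply, ← hσ, ← hσ, Equiv.swap_apply_apply]
  have hall : (MulAut.conj σ).toMonoidHom = μ.toMonoidHom := by
    refine MonoidHom.eq_of_eqOn_dense (closure_isSwap (α := Fin 6)) ?_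
    rintro _ ⟨i, j, hij, rfl⟩
    change MulAut.conj σ (swap i j) = μ (swap i j)
    by_cases hi : i = 0
    · subst hi; exact key j
    by_cases hj : j = 0
    · subst hj; rw [swap_comm]; exact key i
    have : swap i j = swap 0 i * swap 0 j * swap 0 i := by
      ext x
      simp only [Perm.mul_apply, swap_apply_def]
      grind
    rw [this, map_mul, map_mul, map_mul, map_mul, key, key]
  exact MulEquiv.ext fun x => DFunLike.congr_fun hall x

theorem IsSwap.of_isConj {α : Type*} [Fintype α] [DecidableEq α] {σ τ : Perm α} (hσ : σ.IsSwap)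
    (h : IsConj σ τ) : τ.IsSwap := by
  rw [← card_support_eq_two, ← sum_cycleType] at hσ ⊢
  rwa [← isConj_iff_cycleType_eq.mp h]

theorem isSwap_map_of_isConj (μ : MulAut (Perm (Fin 6))) (h : (μ (swap 0 1)).IsSwap)
    (i j : Fin 6) (hij : i ≠ j) : (μ (swap i j)).IsSwap :=
  IsSwap.of_isConj h (μ.toMonoidHom.map_isConj (isConj_swap (by decide) hij))

/-- The image of a transposition is an involution, and it is odd because the sign is the only
surjection onto `±1`. It is thus a product of one or three disjoint transpositions, and a single one
would make the automorphism inner. -/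
theorem cycleType_of_isOuter {lam : MulAut (Perm (Fin 6))} (h : IsOuter lam) :
    (lam (swap 0 1)).cycleType = {2, 2, 2} := by
  set τ := lam (swap 0 1) with hτ
  have hns : ¬ τ.IsSwap := fun hs => h (mem_conj_range_of_isSwap lam (isSwap_map_of_isConj lam hs))
  have h2 : τ ^ 2 = 1 := by rw [hτ, ← map_pow, pow_two, swap_mul_self, map_one]
  have hsign : sign τ = -1 := by
    have hs : Function.Surjective ((sign : Perm (Fin 6) →* ℤˣ).comp lam.toMonoidHom) :=
      (sign_surjective (Fin 6)).comp lam.surjective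
    have := DFunLike.congr_fun (eq_sign_of_surjective_hom hs) (swap 0 1)
    rw [sign_swap (by decide)] at this
    exact this
  have := Fact.mk Nat.prime_two
  have hrep : τ.cycleType = Multiset.replicate (Multiset.card τ.cycleType) 2 :=
    cycleType_of_pow_prime_eq_one h2
  have hsum := sum_cycleType_le τ
  rw [sign_of_cycleType] at hsign
  generalize Multiset.card τ.cycleType = n at *
  rw [hrep] at hsum hsign
  simp only [Multiset.sum_replicate, smul_eq_mul, Fintype.card_fin]
    at hsum hsign
  have hn : n ≤ 3 := by omega
  interval_cases n
  · exact absurd hsign (by decide)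
  · refine absurd ?_ hns
    rw [← card_support_eq_two, ← sum_cycleType, hrep]; rfl
  · exact absurd hsign (by decide)
  · exact hrep

/-- Two outer automorphisms of `𝔖₆` differ by an inner automorphism. -/
theorem IsOuter.exists_eq_conj_mul {lam mu : MulAut (Perm (Fin 6))} (hl : IsOuter lam)
    (hm : IsOuter mu) : ∃ c : Perm (Fin 6), ∀ x, lam x = c * mu x * c⁻¹ := by
  have hc : IsConj (lam (swap 0 1)) (mu (swap 0 1)) :=
    isConj_iff_cycleType_eq.mpr (by rw [cycleType_of_isOuter hl, cycleType_of_isOuter hm])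
  -- Both automorphisms send transpositions to the class of type `(2, 2, 2)`, so `mu⁻¹ * lam`
  -- preserves transpositions and is conjugation by some `d`; then `lam` is `mu` followed by
  -- conjugation by `mu d`.
  have hc' : IsConj (swap 0 1) ((mu⁻¹ * lam) (swap 0 1)) := by
    have := ((mu⁻¹ : MulAut (Perm (Fin 6))).toMonoidHom.map_isConj hc).symm
    have e : (mu⁻¹ : MulAut (Perm (Fin 6))).toMonoidHom (mu (swap 0 1)) = swap 0 1 :=
      mu.symm_apply_apply _
    rwa [e] at this
  have hs : ((mu⁻¹ * lam) (swap 0 1)).IsSwap := IsSwap.of_isConj ⟨0, 1, by decide, rfl⟩ hc'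
  obtain ⟨d, hd⟩ := mem_conj_range_of_isSwap _ (isSwap_map_of_isConj _ hs)
  refine ⟨mu d, fun x => ?_⟩
  have := DFunLike.congr_fun hd x
  rw [MulAut.conj_apply, MulAut.mul_apply] at this
  have h2 := congrArg mu this
  rw [map_mul, map_mul, map_inv] at h2
  rw [h2]
  exact (mu.apply_symm_apply (lam x)).symm

end OuterAutomorphisms

/-! ### An explicit outer automorphism -/

section OuterAutomorphisms

open Equiv Equiv.Perm

/-- The transposition of `k` and `k + 1`. -/
def adjacentSwap (k : Fin 5) : Perm (Fin 6) := swap k.castSucc k.succ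

/-- Five products of three disjoint transpositions that satisfy the braid relations. -/
def synthemeSwap : Fin 5 → Perm (Fin 6) :=
  ![swap 0 1 * swap 2 3 * swap 4 5, swap 0 3 * swap 1 5 * swap 2 4,
    swap 0 2 * swap 1 3 * swap 4 5, swap 0 1 * swap 2 4 * swap 3 5,
    swap 0 3 * swap 1 2 * swap 4 5]

/-- Words in the adjacent transpositions that represent the `synthemeSwap`s. -/
def synthemeWord : Fin 5 → List (Fin 5) :=
  ![[0, 2, 4], [0, 1, 2, 1, 0, 1, 2, 3, 4, 3, 2, 1, 2, 3, 2], [0, 1, 0, 1, 2, 1, 4],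
    [0, 2, 3, 2, 3, 4, 3], [0, 1, 2, 1, 0, 1, 4]]

set_option maxRecDepth 20000 in
theorem prod_adjacentSwap_synthemeWord (k : Fin 5) :
    ((synthemeWord k).map adjacentSwap).prod = synthemeSwap k := by
  revert k; decide

set_option maxRecDepth 20000 in
theorem prod_synthemeSwap_synthemeWord (k : Fin 5) :
    ((synthemeWord k).map synthemeSwap).prod =
      MulAut.conj (swap 0 5 * swap 1 4 * swap 4 3 * swap 3 2) (adjacentSwap k) := by
  revert k; decide

theorem closure_adjacentSwap : Subgroup.closure (Set.range adjacentSwap) = ⊤ := by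
  have h := mclosure_swap_castSucc_succ 5
  rw [eq_top_iff]
  intro x _
  have hx : x ∈ Submonoid.closure (Set.range adjacentSwap) := by
    change x ∈ Submonoid.closure (Set.range fun i : Fin 5 => swap i.castSucc i.succ)
    rw [h]; trivial
  exact Subgroup.le_closure_toSubmonoid _ hx

/-- The homomorphism `f` is taken as given, since the action on the quartic forms supplies it; no
presentation of `𝔖₆` is needed. The two word identities show that `f ∘ f` is a conjugation, so `f`
is bijective, and it is not inner because a transposition goes to a product of three. -/
theorem exists_isOuter_of_map_adjacentSwap (f : Perm (Fin 6) →* Perm (Fin 6))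
    (hf : ∀ k, f (adjacentSwap k) = synthemeSwap k) :
    ∃ lam : MulAut (Perm (Fin 6)), (∀ x, lam x = f x) ∧ IsOuter lam := by
  have hff : f.comp f =
      (MulAut.conj (swap 0 5 * swap 1 4 * swap 4 3 * swap 3 2 : Perm (Fin 6))).toMonoidHom := by
    refine MonoidHom.eq_of_eqOn_dense closure_adjacentSwap ?_
    rintro _ ⟨k, rfl⟩
    change f (f (adjacentSwap k)) = MulAut.conj _ (adjacentSwap k)
    rw [hf, ← prod_adjacentSwap_synthemeWord, ← prod_synthemeSwap_synthemeWord, map_list_prod,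
      List.map_map]
    exact congrArg List.prod (List.map_congr_left fun i _ => hf i)
  have hinj : Function.Injective f := by
    have : Function.Injective (f.comp f) := by rw [hff]; exact MulEquiv.injective _
    exact Function.Injective.of_comp (f := f) this
  let lam : MulAut (Perm (Fin 6)) := MulEquiv.ofBijective f hinj.bijective_of_finite
  refine ⟨lam, fun x => rfl, ?_⟩
  rintro ⟨c, hc⟩
  have h1 : c * swap 0 1 * c⁻¹ = synthemeSwap 0 := by
    rw [← hf 0]
    exact DFunLike.congr_fun hc (swap 0 1)
  have h2 : (synthemeSwap 0).IsSwap :=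
    IsSwap.of_isConj (σ := swap 0 1) ⟨0, 1, by decide, rfl⟩ (isConj_iff.mpr ⟨c, h1⟩)
  rw [← card_support_eq_two] at h2
  exact absurd h2 (by decide)

end OuterAutomorphisms

/-! ## Generators of the group `N` -/

/-- The diagonal matrix `diag(1, 1, -1, -1)`. -/
def diagOne : SL4 := ⟨!![1,0,0,0; 0,1,0,0; 0,0,-1,0; 0,0,0,-1], by
  simp [Matrix.det_succ_row_zero, Fin.sum_univ_succ, Fin.succAbove]⟩

/-- The diagonal matrix `diag(1, -1, 1, -1)`. -/
def diagTwo : SL4 := ⟨!![1,0,0,0; 0,-1,0,0; 0,0,1,0; 0,0,0,-1], by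
  simp [Matrix.det_succ_row_zero, Fin.sum_univ_succ, Fin.succAbove]⟩

/-- The permutation matrix of `(0 1)(2 3)`. -/
def permOne : SL4 := ⟨!![0,1,0,0; 1,0,0,0; 0,0,0,1; 0,0,1,0], by
  simp [Matrix.det_succ_row_zero, Fin.sum_univ_succ, Fin.succAbove]⟩

/-- The permutation matrix of `(0 2)(1 3)`. -/
def permTwo : SL4 := ⟨!![0,0,1,0; 0,0,0,1; 1,0,0,0; 0,1,0,0], by
  simp [Matrix.det_succ_row_zero, Fin.sum_univ_succ, Fin.succAbove]⟩

/-- The scalar matrix `√-1`. -/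
noncomputable def scalarI : SL4 := ⟨Complex.I • (1 : Matrix (Fin 4) (Fin 4) ℂ), by
  simp [Complex.I_pow_four]⟩

/-- `g` acts on `2 × 2` matrices as `a ↦ p a q`. -/
def ActsAs (g : SL4) (p q : Matrix (Fin 2) (Fin 2) ℂ) : Prop :=
  ∀ v, quat (g.1.mulVec v) = p * quat v * q

theorem ActsAs.mul {g g' : SL4} {p q p' q' : Matrix (Fin 2) (Fin 2) ℂ} (h : ActsAs g p q)
    (h' : ActsAs g' p' q') : ActsAs (g * g') (p * p') (q' * q) := fun v => by
  rw [Matrix.SpecialLinearGroup.coe_mul, ← Matrix.mulVec_mulVec, h, h']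
  simp only [Matrix.mul_assoc]

theorem quat_eq (v : Fin 4 → ℂ) : quat v = !![v 0 + v 1 * Complex.I, v 2 * Complex.I - v 3;
    v 2 * Complex.I + v 3, v 0 - v 1 * Complex.I] := by
  ext i j
  fin_cases i <;> fin_cases j <;> simp [quat, quatI, quatJ, quatK] <;> ring

theorem quat_injective : Function.Injective quat := by
  intro v v' h
  rw [quat_eq, quat_eq] at h
  have h00 := congrFun (congrFun h 0) 0
  have h01 := congrFun (congrFun h 0) 1
  have h10 := congrFun (congrFun h 1) 0
  have h11 := congrFun (congrFun h 1) 1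
  simp at h00 h01 h10 h11
  funext i
  fin_cases i
  · change v 0 = v' 0
    linear_combination (h00 + h11) / 2
  · change v 1 = v' 1
    linear_combination (-Complex.I / 2) * (h00 - h11) + (v 1 - v' 1) * Complex.I_mul_I
  · change v 2 = v' 2
    linear_combination (-Complex.I / 2) * (h01 + h10) + (v 2 - v' 2) * Complex.I_mul_I
  · change v 3 = v' 3
    linear_combination (h10 - h01) / 2

theorem ActsAs.unique {g g' : SL4} {p q : Matrix (Fin 2) (Fin 2) ℂ} (h : ActsAs g p q)
    (h' : ActsAs g' p q) : g = g' := by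
  refine Subtype.ext (Matrix.mulVec_injective (funext fun v => quat_injective ?_))
  rw [h, h']

theorem quatI_mul_quatI : quatI * quatI = -1 := by
  ext i j; fin_cases i <;> fin_cases j <;> simp [quatI, Matrix.mul_apply]

theorem quatJ_mul_quatJ : quatJ * quatJ = -1 := by
  ext i j; fin_cases i <;> fin_cases j <;> simp [quatJ, Matrix.mul_apply]

theorem quatK_mul_quatK : quatK * quatK = -1 := by
  ext i j; fin_cases i <;> fin_cases j <;> simp [quatK, Matrix.mul_apply]

theorem quatI_mul_quatJ : quatI * quatJ = quatK := by
  ext i j; fin_cases i <;> fin_cases j <;> simp [quatI, quatJ, quatK, Matrix.mul_apply]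

theorem quatJ_mul_quatI : quatJ * quatI = -quatK := by
  ext i j; fin_cases i <;> fin_cases j <;> simp [quatI, quatJ, quatK, Matrix.mul_apply]

theorem quatI_mul_quatK : quatI * quatK = -quatJ := by
  rw [← quatI_mul_quatJ, ← Matrix.mul_assoc, quatI_mul_quatI, neg_one_mul]

theorem quatK_mul_quatI : quatK * quatI = quatJ := by
  rw [← quatI_mul_quatJ, Matrix.mul_assoc, quatJ_mul_quatI, Matrix.mul_neg, quatI_mul_quatK,
    neg_neg]

theorem actsAs_diagOne : ActsAs diagOne quatI (-quatI) := by
  intro v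
  rw [quat_eq, quat_eq]
  ext i j
  fin_cases i <;> fin_cases j <;>
    simp [diagOne, quatI, Matrix.mul_apply, Matrix.mulVec, dotProduct, Fin.sum_univ_four] <;>
    ring_nf <;> simp [Complex.I_sq] <;> ring

theorem actsAs_diagTwo : ActsAs diagTwo quatJ (-quatJ) := by
  intro v
  rw [quat_eq, quat_eq]
  ext i j
  fin_cases i <;> fin_cases j <;>
    simp [diagTwo, quatJ, Matrix.mul_apply, Matrix.mulVec, dotProduct, Fin.sum_univ_four] <;>
    ring_nf <;> simp [Complex.I_sq] <;> ring

theorem actsAs_permOne : ActsAs permOne quatK (-quatJ) := by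
  intro v
  rw [quat_eq, quat_eq]
  ext i j
  fin_cases i <;> fin_cases j <;>
    simp [permOne, quatJ, quatK, Matrix.mul_apply, Matrix.mulVec, dotProduct,
      Fin.sum_univ_four] <;>
    ring_nf <;> simp [Complex.I_sq] <;> ring

theorem actsAs_permTwo : ActsAs permTwo (-quatI) quatK := by
  intro v
  rw [quat_eq, quat_eq]
  ext i j
  fin_cases i <;> fin_cases j <;>
    simp [permTwo, quatI, quatK, Matrix.mul_apply, Matrix.mulVec, dotProduct,
      Fin.sum_univ_four] <;>
    ring_nf <;> simp [Complex.I_sq] <;> ring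

theorem mem_N_of_actsAs {g : SL4} {p q : Matrix (Fin 2) (Fin 2) ℂ} (hp : p ∈ Q8) (hq : q ∈ Q8)
    (h : ActsAs g p q) : g ∈ N :=
  Subgroup.subset_closure (Or.inl ⟨p, hp, q, hq, h⟩)

theorem diagOne_mem_N : diagOne ∈ N :=
  mem_N_of_actsAs (by simp [Q8]) (by simp [Q8]) actsAs_diagOne

theorem diagTwo_mem_N : diagTwo ∈ N :=
  mem_N_of_actsAs (by simp [Q8]) (by simp [Q8]) actsAs_diagTwo

theorem permOne_mem_N : permOne ∈ N :=
  mem_N_of_actsAs (by simp [Q8]) (by simp [Q8]) actsAs_permOne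

theorem permTwo_mem_N : permTwo ∈ N :=
  mem_N_of_actsAs (by simp [Q8]) (by simp [Q8]) actsAs_permTwo

theorem scalarI_mem_N : scalarI ∈ N := Subgroup.subset_closure (Or.inr rfl)

theorem quatJ_mul_quatK : quatJ * quatK = quatI := by
  rw [← quatI_mul_quatJ, ← Matrix.mul_assoc, quatJ_mul_quatI, neg_mul, ← quatI_mul_quatJ,
    Matrix.mul_assoc, quatJ_mul_quatJ, mul_neg_one, neg_neg]

theorem Q8_subset_of_mem {S : Set (Matrix (Fin 2) (Fin 2) ℂ)}
    (hmul : ∀ p ∈ S, ∀ q ∈ S, p * q ∈ S) (hI : -quatI ∈ S) (hK : -quatK ∈ S) : Q8 ⊆ S := by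
  have h1 : (-1 : Matrix (Fin 2) (Fin 2) ℂ) ∈ S := by
    simpa [quatI_mul_quatI] using hmul _ hI _ hI
  have h2 : quatI ∈ S := by simpa using hmul _ h1 _ hI
  have h3 : quatK ∈ S := by simpa using hmul _ h1 _ hK
  have h4 : quatJ ∈ S := by simpa [quatK_mul_quatI] using hmul _ h3 _ h2
  have h5 : -quatJ ∈ S := by simpa using hmul _ h1 _ h4
  have h6 : (1 : Matrix (Fin 2) (Fin 2) ℂ) ∈ S := by simpa using hmul _ h1 _ h1
  rintro p (rfl | rfl | rfl | rfl | rfl | rfl | rfl | rfl) <;> assumption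

/-- Products of the given matrices realise left and right multiplication by `-I` and by `-K`, and
these two quaternions generate `Q₈`. -/
theorem N_le_of_mem {H : Subgroup SL4} (h1 : diagOne ∈ H) (h2 : diagTwo ∈ H) (h3 : permOne ∈ H)
    (h4 : permTwo ∈ H) (h5 : scalarI ∈ H) : N ≤ H := by
  have aI : ActsAs (diagTwo * permOne) (-quatI) 1 := by
    have := actsAs_diagTwo.mul actsAs_permOne
    simp only [quatJ_mul_quatK, neg_mul_neg, quatJ_mul_quatJ] at this
    intro v
    rw [this, mul_neg_one, mul_one, neg_mul]
  have bK : ActsAs (diagTwo * permOne * permTwo) 1 (-quatK) := by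
    have := (actsAs_diagTwo.mul actsAs_permOne).mul actsAs_permTwo
    simpa only [quatJ_mul_quatK, neg_mul_neg, quatJ_mul_quatJ, mul_neg, quatI_mul_quatI, neg_neg,
      mul_one, neg_mul] using this
  have bI : ActsAs (diagTwo * permOne * diagOne) 1 (-quatI) := by
    have := aI.mul actsAs_diagOne
    simpa only [neg_mul, quatI_mul_quatI, neg_neg, mul_one] using this
  have aK : ActsAs (diagOne * diagTwo * (diagTwo * permOne * permTwo)) (-quatK) 1 := by
    have := (actsAs_diagOne.mul actsAs_diagTwo).mul bK
    simp only [quatI_mul_quatJ, neg_mul_neg, quatJ_mul_quatI, quatK_mul_quatK, mul_one] at this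
    intro v
    rw [this, mul_neg_one, mul_one, neg_mul]
  have hL : Q8 ⊆ {p | ∃ g ∈ H, ActsAs g p 1} := by
    refine Q8_subset_of_mem ?_ ⟨_, mul_mem h2 h3, aI⟩
      ⟨_, mul_mem (mul_mem h1 h2) (mul_mem (mul_mem h2 h3) h4), aK⟩
    rintro p ⟨g, hg, ha⟩ p' ⟨g', hg', ha'⟩
    exact ⟨g * g', mul_mem hg hg', by simpa using ha.mul ha'⟩
  have hR : Q8 ⊆ {q | ∃ g ∈ H, ActsAs g 1 q} := by
    refine Q8_subset_of_mem ?_ ⟨_, mul_mem (mul_mem h2 h3) h1, bI⟩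
      ⟨_, mul_mem (mul_mem h2 h3) h4, bK⟩
    rintro q ⟨g, hg, ha⟩ q' ⟨g', hg', ha'⟩
    exact ⟨g' * g, mul_mem hg' hg, by simpa using ha'.mul ha⟩
  refine (Subgroup.closure_le H).mpr ?_
  rintro g (⟨p, hp, q, hq, hg⟩ | hg)
  · obtain ⟨a, ha, ha'⟩ := hL hp
    obtain ⟨b, hb, hb'⟩ := hR hq
    have hab : ActsAs (a * b) p q := by simpa using ha'.mul hb'
    rw [show g = a * b from ActsAs.unique hg hab]
    exact mul_mem ha hb
  · rwa [show g = scalarI from Subtype.ext hg]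

/-! ## The action on the exterior square -/

/-- The Plücker coordinate `p_{kl}` on `⋀² ℂ⁴`. -/
noncomputable def plucker (k l : Fin 4) : ⋀[ℂ]^2 (Fin 4 → ℂ) →ₗ[ℂ] ℂ :=
  exteriorPower.alternatingMapLinearEquiv
    ((Matrix.detRowAlternating (R := ℂ) (n := Fin 2)).compLinearMap
      (LinearMap.funLeft ℂ ℂ ![k, l]))

theorem plucker_ιMulti (k l : Fin 4) (a b : Fin 4 → ℂ) :
    plucker k l (exteriorPower.ιMulti ℂ 2 ![a, b]) = a k * b l - a l * b k := by
  rw [plucker, exteriorPower.alternatingMapLinearEquiv_apply_ιMulti]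
  change Matrix.det (Matrix.of fun x => LinearMap.funLeft ℂ ℂ ![k, l] (![a, b] x)) = _
  rw [Matrix.det_fin_two]
  simp [LinearMap.funLeft_apply]

theorem plucker_wedgeAction (g : SL4) (k l i j : Fin 4) :
    plucker k l (wedgeAction g (wedge i j)) = g.1 k i * g.1 l j - g.1 l i * g.1 k j := by
  have : wedgeAction g (wedge i j) = exteriorPower.ιMulti ℂ 2 ![fun k => g.1 k i, fun k => g.1 k j] := by
    rw [wedgeAction, wedge, exteriorPower.map_apply_ιMulti]
    congr 1
    funext x
    fin_cases x <;> simp <;> rfl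
  rw [this, plucker_ιMulti]

theorem plucker_wedge (k l i j : Fin 4) : plucker k l (wedge i j) =
    (if k = i then 1 else 0) * (if l = j then 1 else 0) -
      (if l = i then 1 else 0) * (if k = j then 1 else 0) := by
  rw [wedge, plucker_ιMulti]
  simp [Pi.single_apply]

/-- The six Plücker coordinates. -/
noncomputable def pluckerVec : ⋀[ℂ]^2 (Fin 4 → ℂ) →ₗ[ℂ] Fin 6 → ℂ :=
  LinearMap.pi ![plucker 0 1, plucker 0 2, plucker 0 3, plucker 1 2, plucker 1 3, plucker 2 3]

theorem linearIndependent_w : LinearIndependent ℂ w := by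
  refine LinearIndependent.of_comp pluckerVec ?_
  rw [Fintype.linearIndependent_iff]
  intro c hc
  have h : ∀ i, (∑ j, c j • (pluckerVec ∘ w) j) i = 0 := fun i => congrFun hc i
  have h0 := h 0
  have h1 := h 1
  have h2 := h 2
  have h3 := h 3
  have h4 := h 4
  have h5 := h 5
  simp [Fin.sum_univ_six, pluckerVec, w, plucker_wedge] at h0 h1 h2 h3 h4 h5
  intro i
  fin_cases i <;> simp <;> grind

/-- The basis `w` of `⋀² ℂ⁴`. -/
noncomputable def wBasis : Module.Basis (Fin 6) ℂ (⋀[ℂ]^2 (Fin 4 → ℂ)) :=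
  basisOfLinearIndependentOfCardEqFinrank linearIndependent_w (by
    rw [exteriorPower.finrank_eq]; simp; rfl)

theorem wBasis_apply (i : Fin 6) : wBasis i = w i := by simp [wBasis]

theorem pluckerVec_injective : Function.Injective pluckerVec := by
  rw [← LinearMap.ker_eq_bot, LinearMap.ker_eq_bot']
  intro x hx
  rw [← wBasis.sum_repr x] at hx ⊢
  have h : ∀ i, pluckerVec (∑ j, wBasis.repr x j • wBasis j) i = 0 := fun i => congrFun hx i
  have h0 := h 0
  have h1 := h 1
  have h2 := h 2
  have h3 := h 3
  have h4 := h 4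
  have h5 := h 5
  simp [Fin.sum_univ_six, pluckerVec, wBasis_apply, w, plucker_wedge] at h0 h1 h2 h3 h4 h5
  refine Finset.sum_eq_zero fun i _ => ?_
  have : wBasis.repr x i = 0 := by fin_cases i <;> simp <;> grind
  rw [this, zero_smul]

theorem wedgeAction_one : wedgeAction 1 = LinearMap.id := by
  rw [wedgeAction, Matrix.SpecialLinearGroup.coe_one, Matrix.mulVecLin_one, exteriorPower.map_id]

theorem wedgeAction_mul (g h : SL4) : wedgeAction (g * h) = wedgeAction g ∘ₗ wedgeAction h := by
  rw [wedgeAction, wedgeAction, wedgeAction, Matrix.SpecialLinearGroup.coe_mul,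
    Matrix.mulVecLin_mul, exteriorPower.map_comp]

theorem wedgeAction_mul_apply (g h : SL4) (x : ⋀[ℂ]^2 (Fin 4 → ℂ)) :
    wedgeAction (g * h) x = wedgeAction g (wedgeAction h x) := by
  rw [wedgeAction_mul]; rfl

/-- `g` permutes the lines `W_i` according to `σ`. -/
def Permutes (g : SL4) (σ : Equiv.Perm (Fin 6)) : Prop :=
  ∀ i, (W i).map (wedgeAction g) = W (σ i)

theorem Permutes.mul {g h : SL4} {σ τ : Equiv.Perm (Fin 6)} (hg : Permutes g σ)
    (hh : Permutes h τ) : Permutes (g * h) (σ * τ) := fun i => by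
  rw [wedgeAction_mul, Submodule.map_comp, hh, hg, Equiv.Perm.mul_apply]

theorem Permutes.one : Permutes 1 1 := fun i => by
  rw [wedgeAction_one, Submodule.map_id, Equiv.Perm.one_apply]

theorem W_injective : Function.Injective W := by
  intro i j h
  have : w i ∈ W j := h ▸ Submodule.mem_span_singleton_self _
  obtain ⟨c, hc⟩ := Submodule.mem_span_singleton.mp this
  by_contra hij
  have h2 := congrArg (fun x => wBasis.repr x i) hc
  simp only [← wBasis_apply, map_smul, Module.Basis.repr_self] at h2
  simp [Ne.symm hij] at h2

theorem Permutes.unique {g : SL4} {σ τ : Equiv.Perm (Fin 6)} (hσ : Permutes g σ)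
    (hτ : Permutes g τ) : σ = τ :=
  Equiv.ext fun i => W_injective ((hσ i).symm.trans (hτ i))

theorem Permutes.inv {g : SL4} {σ : Equiv.Perm (Fin 6)} (h : Permutes g σ) :
    Permutes g⁻¹ σ⁻¹ := fun i => by
  have := h (σ⁻¹ i)
  rw [show σ (σ⁻¹ i) = i from σ.apply_symm_apply i] at this
  rw [← this, ← Submodule.map_comp, ← wedgeAction_mul, inv_mul_cancel, wedgeAction_one,
    Submodule.map_id]

theorem map_W_of_apply_w {g : SL4} {i j : Fin 6} {c : ℂ} (hc : c ≠ 0)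
    (h : wedgeAction g (w i) = c • w j) : (W i).map (wedgeAction g) = W j := by
  rw [W, Submodule.map_span, Set.image_singleton, h, W,
    Submodule.span_singleton_smul_eq hc.isUnit]

theorem exists_smul_of_map_W {g : SL4} {i j : Fin 6} (h : (W i).map (wedgeAction g) = W j) :
    ∃ c : ℂ, wedgeAction g (w i) = c • w j := by
  have : wedgeAction g (w i) ∈ W j :=
    h ▸ Submodule.mem_map_of_mem (Submodule.mem_span_singleton_self _)
  obtain ⟨c, hc⟩ := Submodule.mem_span_singleton.mp this
  exact ⟨c, hc.symm⟩

/-! ## Elements of `SL(4, ℂ)` that induce the adjacent transpositions -/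

/-- The number `1 / √2`. -/
noncomputable def invSqrtTwo : ℂ := ((Real.sqrt 2 : ℝ) : ℂ)⁻¹

theorem invSqrtTwo_mul_self : invSqrtTwo * invSqrtTwo = 1 / 2 := by
  rw [invSqrtTwo, ← mul_inv, ← Complex.ofReal_mul, Real.mul_self_sqrt (by norm_num)]
  norm_num

theorem coe_diagOne : (diagOne : Matrix (Fin 4) (Fin 4) ℂ) =
    !![1,0,0,0; 0,1,0,0; 0,0,-1,0; 0,0,0,-1] := rfl

theorem coe_diagTwo : (diagTwo : Matrix (Fin 4) (Fin 4) ℂ) =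
    !![1,0,0,0; 0,-1,0,0; 0,0,1,0; 0,0,0,-1] := rfl

theorem coe_permOne : (permOne : Matrix (Fin 4) (Fin 4) ℂ) =
    !![0,1,0,0; 1,0,0,0; 0,0,0,1; 0,0,1,0] := rfl

theorem coe_permTwo : (permTwo : Matrix (Fin 4) (Fin 4) ℂ) =
    !![0,0,1,0; 0,0,0,1; 1,0,0,0; 0,1,0,0] := rfl

theorem coe_scalarI : (scalarI : Matrix (Fin 4) (Fin 4) ℂ) =
    Complex.I • (1 : Matrix (Fin 4) (Fin 4) ℂ) := rfl

/-- Elements `n` of `N` with `n ^ 2 = -1`. -/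
noncomputable def rootN : Fin 5 → SL4 :=
  ![scalarI * diagOne, diagTwo * permOne * permTwo, scalarI * diagTwo, diagTwo * permOne,
    scalarI * diagOne * diagTwo]

/-- The matrices `1 + n`. -/
noncomputable def genMatrix : Fin 5 → Matrix (Fin 4) (Fin 4) ℂ :=
  ![!![1 + Complex.I, 0, 0, 0; 0, 1 + Complex.I, 0, 0; 0, 0, 1 - Complex.I, 0;
      0, 0, 0, 1 - Complex.I],
    !![1, 0, 0, 1; 0, 1, -1, 0; 0, 1, 1, 0; -1, 0, 0, 1],
    !![1 + Complex.I, 0, 0, 0; 0, 1 - Complex.I, 0, 0; 0, 0, 1 + Complex.I, 0;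
      0, 0, 0, 1 - Complex.I],
    !![1, 1, 0, 0; -1, 1, 0, 0; 0, 0, 1, 1; 0, 0, -1, 1],
    !![1 + Complex.I, 0, 0, 0; 0, 1 - Complex.I, 0, 0; 0, 0, 1 - Complex.I, 0;
      0, 0, 0, 1 + Complex.I]]

theorem det_genMatrix (k : Fin 5) : (genMatrix k).det = 4 := by
  fin_cases k <;>
    simp [genMatrix, Matrix.det_succ_row_zero, Fin.sum_univ_succ, Fin.succAbove] <;>
    ring_nf <;> simp [Complex.I_sq, Complex.I_pow_four] <;> norm_num

/-- The elements `(1 + n) / √2` of `SL(4, ℂ)`. -/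
noncomputable def gen (k : Fin 5) : SL4 := ⟨invSqrtTwo • genMatrix k, by
  rw [Matrix.det_smul, det_genMatrix, Fintype.card_fin]
  linear_combination 4 * (invSqrtTwo ^ 2 + 1 / 2) * invSqrtTwo_mul_self⟩

/-- Since `n ^ 2 = -1`, one has `(1 + n) ^ 2 = 2 * n`. Facts about `N` thereby follow from facts
about `gen`. -/
theorem gen_mul_self (k : Fin 5) : gen k * gen k = rootN k := by
  refine Subtype.ext ?_
  have h : (gen k * gen k).1 = (1 / 2 : ℂ) • (genMatrix k * genMatrix k) := by
    rw [Matrix.SpecialLinearGroup.coe_mul]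
    change (invSqrtTwo • genMatrix k) * (invSqrtTwo • genMatrix k) = _
    rw [Matrix.smul_mul, Matrix.mul_smul, smul_smul, invSqrtTwo_mul_self]
  rw [h]
  fin_cases k <;> ext i j <;> fin_cases i <;> fin_cases j <;>
    simp [genMatrix, rootN, coe_scalarI, coe_diagOne, coe_diagTwo, coe_permOne, coe_permTwo,
      Matrix.mul_apply, Fin.sum_univ_four, Matrix.one_apply, Matrix.SpecialLinearGroup.coe_mul] <;>
    ring_nf <;> simp [Complex.I_sq] <;> norm_num <;> ring

/-- The coefficients of the action of `gen k` on the vectors `w i`. -/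
noncomputable def genCoeff : Fin 5 → Fin 6 → ℂ :=
  ![![Complex.I, Complex.I, 1, 1, 1, 1], ![1, 1, -1, 1, 1, 1],
    ![1, 1, Complex.I, Complex.I, 1, 1], ![1, 1, 1, -1, 1, 1],
    ![1, 1, 1, 1, Complex.I, Complex.I]]

theorem plucker_gen (m : Fin 5) (k l i j : Fin 4) :
    plucker k l (wedgeAction (gen m) (wedge i j)) =
      (genMatrix m k i * genMatrix m l j - genMatrix m l i * genMatrix m k j) / 2 := by
  rw [plucker_wedgeAction]
  change (invSqrtTwo * genMatrix m k i) * (invSqrtTwo * genMatrix m l j) -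
    (invSqrtTwo * genMatrix m l i) * (invSqrtTwo * genMatrix m k j) = _
  linear_combination (genMatrix m k i * genMatrix m l j - genMatrix m l i * genMatrix m k j) *
    invSqrtTwo_mul_self

theorem genCoeff_ne_zero (k : Fin 5) (i : Fin 6) : genCoeff k i ≠ 0 := by
  fin_cases k <;> fin_cases i <;> simp [genCoeff]

set_option maxHeartbeats 1000000 in
theorem wedgeAction_gen (k : Fin 5) (i : Fin 6) :
    wedgeAction (gen k) (w i) = genCoeff k i • w (adjacentSwap k i) := by
  apply pluckerVec_injective
  fin_cases k <;> fin_cases i <;> ext j <;> fin_cases j <;>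
    simp [adjacentSwap, genCoeff, w, pluckerVec, plucker_gen, plucker_wedge, genMatrix,
      Equiv.swap_apply_def] <;> ring_nf <;> simp <;> norm_num <;> ring

theorem permutes_gen (k : Fin 5) : Permutes (gen k) (adjacentSwap k) := fun i =>
  map_W_of_apply_w (genCoeff_ne_zero k i) (wedgeAction_gen k i)

/-- The eigenvalue of `rootN k` on `w i`. -/
def rootSign (k : Fin 5) (i : Fin 6) : ℤ := if i = k.castSucc ∨ i = k.succ then -1 else 1

theorem rootSign_mul_self (k : Fin 5) (i : Fin 6) : rootSign k i * rootSign k i = 1 := by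
  revert k i; decide

theorem exists_rootSign_ne {i j : Fin 6} (h : i ≠ j) : ∃ k, rootSign k i ≠ rootSign k j := by
  revert i j; decide

theorem wedgeAction_rootN (k : Fin 5) (i : Fin 6) :
    wedgeAction (rootN k) (w i) = (rootSign k i : ℂ) • w i := by
  rw [← gen_mul_self, wedgeAction_mul_apply, wedgeAction_gen, map_smul, wedgeAction_gen, smul_smul,
    show adjacentSwap k (adjacentSwap k i) = i from Equiv.swap_apply_self _ _ _]
  congr 1
  fin_cases k <;> fin_cases i <;> simp [genCoeff, adjacentSwap, rootSign, Equiv.swap_apply_def]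

theorem rootN_mem_N (k : Fin 5) : rootN k ∈ N := by
  have h1 := diagOne_mem_N
  have h2 := diagTwo_mem_N
  have h3 := permOne_mem_N
  have h4 := permTwo_mem_N
  have h5 := scalarI_mem_N
  fin_cases k
  · exact mul_mem h5 h1
  · exact mul_mem (mul_mem h2 h3) h4
  · exact mul_mem h5 h2
  · exact mul_mem h2 h3
  · exact mul_mem (mul_mem h5 h1) h2

theorem scalarI_mul_comm (g : SL4) : scalarI * g = g * scalarI := by
  refine Subtype.ext ?_
  rw [Matrix.SpecialLinearGroup.coe_mul, Matrix.SpecialLinearGroup.coe_mul, coe_scalarI,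
    Matrix.smul_mul, Matrix.mul_smul, Matrix.one_mul, Matrix.mul_one]

theorem N_le_of_rootN_mem {H : Subgroup SL4} (h : ∀ k, rootN k ∈ H) : N ≤ H := by
  have h0 : scalarI * diagOne ∈ H := h 0
  have h1 : diagTwo * permOne * permTwo ∈ H := h 1
  have h2 : scalarI * diagTwo ∈ H := h 2
  have h3 : diagTwo * permOne ∈ H := h 3
  have h4 : scalarI * diagOne * diagTwo ∈ H := h 4
  -- With `d₁ = diagOne` and `d₂ = diagTwo`, the product `(i d₁)(i d₂)` is `i` times `i d₁ d₂`.
  have hs : scalarI ∈ H := by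
    have : scalarI = scalarI * diagOne * (scalarI * diagTwo) *
        (scalarI * diagOne * diagTwo)⁻¹ := by
      rw [eq_mul_inv_iff_mul_eq, mul_assoc scalarI diagOne (scalarI * diagTwo),
        ← mul_assoc diagOne scalarI, ← scalarI_mul_comm diagOne]
    rw [this]
    exact mul_mem (mul_mem h0 h2) (inv_mem h4)
  have hd2 : diagTwo ∈ H := (H.mul_mem_cancel_left hs).mp h2
  exact N_le_of_mem ((H.mul_mem_cancel_left hs).mp h0) hd2 ((H.mul_mem_cancel_left hd2).mp h3)
    ((H.mul_mem_cancel_left h3).mp h1) hs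

/-- `g` multiplies each of the vectors `w i` by a sign `c i`. -/
def HasSigns (g : SL4) (c : Fin 6 → ℂ) : Prop :=
  ∀ i, (c i = 1 ∨ c i = -1) ∧ wedgeAction g (w i) = c i • w i

theorem HasSigns.mul {g h : SL4} {c d : Fin 6 → ℂ} (hg : HasSigns g c) (hh : HasSigns h d) :
    HasSigns (g * h) (c * d) := fun i => by
  refine ⟨?_, ?_⟩
  · rcases (hg i).1 with h1 | h1 <;> rcases (hh i).1 with h2 | h2 <;> simp [h1, h2]
  · rw [wedgeAction_mul_apply, (hh i).2, map_smul, (hg i).2, smul_smul, Pi.mul_apply, mul_comm]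

theorem hasSigns_rootN (k : Fin 5) : HasSigns (rootN k) (fun i => (rootSign k i : ℂ)) := fun i => by
  refine ⟨?_, wedgeAction_rootN k i⟩
  rcases mul_self_eq_one_iff.mp (rootSign_mul_self k i) with h | h <;> simp [h]

theorem exists_hasSigns_of_mem_N {n : SL4} (hn : n ∈ N) : ∃ c, HasSigns n c := by
  let H : Subgroup SL4 :=
    { carrier := {g | ∃ c, HasSigns g c}
      mul_mem' := fun ⟨_, h⟩ ⟨_, h'⟩ => ⟨_, h.mul h'⟩
      one_mem' := ⟨1, fun i => ⟨Or.inl rfl, by rw [wedgeAction_one]; simp⟩⟩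
      inv_mem' := fun {g} ⟨c, h⟩ => ⟨c, fun i => ⟨(h i).1, by
        have hc : c i * c i = 1 := mul_self_eq_one_iff.mpr (h i).1
        have h2 : wedgeAction (g⁻¹ * g) (w i) = w i := by
          rw [inv_mul_cancel, wedgeAction_one]; rfl
        rw [wedgeAction_mul_apply, (h i).2, map_smul] at h2
        rw [← h2, smul_smul, hc, one_smul, h2]⟩⟩ }
  exact N_le_of_rootN_mem (H := H) (fun k => ⟨_, hasSigns_rootN k⟩) hn

theorem permutes_one_of_mem_N {n : SL4} (hn : n ∈ N) : Permutes n 1 := by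
  obtain ⟨c, hc⟩ := exists_hasSigns_of_mem_N hn
  refine fun i => map_W_of_apply_w (c := c i) ?_ (hc i).2
  rcases (hc i).1 with h | h <;> rw [h] <;> simp

/-! ### The normalizer of `N` on the six lines, and the kernel of this action -/

theorem repr_wedgeAction_rootN (k : Fin 5) (x : ⋀[ℂ]^2 (Fin 4 → ℂ)) (j : Fin 6) :
    wBasis.repr (wedgeAction (rootN k) x) j = rootSign k j * wBasis.repr x j := by
  conv_lhs => rw [← wBasis.sum_repr x]
  simp only [map_sum, map_smul, wBasis_apply, wedgeAction_rootN]
  simp only [← wBasis_apply, Module.Basis.repr_self]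
  simp [Finsupp.single_apply]
  ring

theorem wedgeAction_injective (g : SL4) : Function.Injective (wedgeAction g) := by
  intro x y h
  have h2 := congrArg (wedgeAction g⁻¹) h
  rwa [← wedgeAction_mul_apply, ← wedgeAction_mul_apply, inv_mul_cancel, wedgeAction_one] at h2

/-- An element that normalizes `N` permutes the six lines. -/
theorem exists_permutes {g : SL4} (hg : ∀ n ∈ N, g⁻¹ * n * g ∈ N) : ∃ σ, Permutes g σ := by
  have key : ∀ i, ∃ j, (W i).map (wedgeAction g) = W j := by
    intro i
    set x := wedgeAction g (w i) with hx
    have hx0 : x ≠ 0 := by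
      intro h0
      have : w i = 0 := wedgeAction_injective g (by rw [← hx, h0, map_zero])
      exact linearIndependent_w.ne_zero i this
    -- Moving `rootN k` past `g` turns it into a conjugate, which is again in `N` and acts on `w i`
    -- by a sign. Hence `x` is a common eigenvector of all `rootN k`.
    have heig : ∀ k, ∃ c : ℂ, ∀ j, rootSign k j * wBasis.repr x j = c * wBasis.repr x j := by
      intro k
      obtain ⟨c, hc⟩ := exists_hasSigns_of_mem_N (hg _ (rootN_mem_N k))
      refine ⟨c i, fun j => ?_⟩
      rw [← repr_wedgeAction_rootN, hx, ← wedgeAction_mul_apply,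
        show rootN k * g = g * (g⁻¹ * rootN k * g) by group, wedgeAction_mul_apply, (hc i).2,
        map_smul, map_smul]
      rfl
    obtain ⟨j, hj⟩ : ∃ j, wBasis.repr x j ≠ 0 := by
      by_contra! h
      exact hx0 (wBasis.repr.map_eq_zero_iff.mp (Finsupp.ext h))
    have hl : ∀ l, l ≠ j → wBasis.repr x l = 0 := by
      intro l hlj
      by_contra h0
      -- Two non-zero coordinates would have equal eigenvalues for every `rootN k`, but some `rootN
      -- k` separates the two lines.
      obtain ⟨k, hk⟩ := exists_rootSign_ne hlj
      obtain ⟨c, hc⟩ := heig k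
      have e1 := mul_right_cancel₀ h0 (hc l)
      have e2 := mul_right_cancel₀ hj (hc j)
      exact hk (Int.cast_injective (α := ℂ) (e1.trans e2.symm))
    refine ⟨j, map_W_of_apply_w hj ?_⟩
    rw [← hx, ← wBasis_apply]
    conv_lhs => rw [← wBasis.sum_repr x]
    rw [Finset.sum_eq_single j]
    · intro l _ hlj; rw [hl l hlj, zero_smul]
    · simp
  choose f hf using key
  have hinj : Function.Injective f := by
    intro i j hij
    apply W_injective
    apply Submodule.map_injective_of_injective (wedgeAction_injective g)
    rw [hf, hf, hij]
  exact ⟨Equiv.ofBijective f hinj.bijective_of_finite, hf⟩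

/-- The minor of `A` with rows `k, l` and columns `i, j`. -/
def minor (A : Matrix (Fin 4) (Fin 4) ℂ) (k l i j : Fin 4) : ℂ := A k i * A l j - A l i * A k j

/-- The wedge of two columns is decomposable, so its Plücker coordinates satisfy the Plücker
relation. -/
theorem minor_plucker (A : Matrix (Fin 4) (Fin 4) ℂ) (i j : Fin 4) :
    minor A 0 1 i j * minor A 2 3 i j - minor A 0 2 i j * minor A 1 3 i j +
      minor A 0 3 i j * minor A 1 2 i j = 0 := by
  simp only [minor]; ring

/-- Laplace expansion along two complementary pairs of columns; the next two lemmas treat the other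
two splittings. Together they encode the invariance of the pairing `⋀² × ⋀² → ⋀⁴`. -/
theorem det_eq_laplace (A : Matrix (Fin 4) (Fin 4) ℂ) :
    A.det = minor A 0 1 0 1 * minor A 2 3 2 3 - minor A 0 2 0 1 * minor A 1 3 2 3 +
      minor A 0 3 0 1 * minor A 1 2 2 3 + minor A 1 2 0 1 * minor A 0 3 2 3 -
      minor A 1 3 0 1 * minor A 0 2 2 3 + minor A 2 3 0 1 * minor A 0 1 2 3 := by
  simp [Matrix.det_succ_row_zero, Fin.sum_univ_succ, Fin.succAbove, minor]
  ring

theorem det_eq_laplace' (A : Matrix (Fin 4) (Fin 4) ℂ) :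
    A.det = -(minor A 0 1 0 2 * minor A 2 3 1 3 - minor A 0 2 0 2 * minor A 1 3 1 3 +
      minor A 0 3 0 2 * minor A 1 2 1 3 + minor A 1 2 0 2 * minor A 0 3 1 3 -
      minor A 1 3 0 2 * minor A 0 2 1 3 + minor A 2 3 0 2 * minor A 0 1 1 3) := by
  simp [Matrix.det_succ_row_zero, Fin.sum_univ_succ, Fin.succAbove, minor]
  ring

theorem det_eq_laplace'' (A : Matrix (Fin 4) (Fin 4) ℂ) :
    A.det = minor A 0 1 0 3 * minor A 2 3 1 2 - minor A 0 2 0 3 * minor A 1 3 1 2 +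
      minor A 0 3 0 3 * minor A 1 2 1 2 + minor A 1 2 0 3 * minor A 0 3 1 2 -
      minor A 1 3 0 3 * minor A 0 2 1 2 + minor A 2 3 0 3 * minor A 0 1 1 2 := by
  simp [Matrix.det_succ_row_zero, Fin.sum_univ_succ, Fin.succAbove, minor]
  ring

theorem minor_eq {g : SL4} {c : Fin 6 → ℂ} (h : ∀ i, wedgeAction g (w i) = c i • w i)
    (k l : Fin 4) :
    minor g.1 k l 0 1 = (c 0 + c 1) / 2 * plucker k l (wedge 0 1) +
      (c 0 - c 1) / 2 * plucker k l (wedge 2 3) ∧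
    minor g.1 k l 2 3 = (c 0 - c 1) / 2 * plucker k l (wedge 0 1) +
      (c 0 + c 1) / 2 * plucker k l (wedge 2 3) ∧
    minor g.1 k l 0 2 = (c 2 + c 3) / 2 * plucker k l (wedge 0 2) +
      (c 2 - c 3) / 2 * plucker k l (wedge 1 3) ∧
    minor g.1 k l 1 3 = (c 2 - c 3) / 2 * plucker k l (wedge 0 2) +
      (c 2 + c 3) / 2 * plucker k l (wedge 1 3) ∧
    minor g.1 k l 0 3 = (c 4 + c 5) / 2 * plucker k l (wedge 0 3) +
      (c 4 - c 5) / 2 * plucker k l (wedge 1 2) ∧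
    minor g.1 k l 1 2 = (c 4 - c 5) / 2 * plucker k l (wedge 0 3) +
      (c 4 + c 5) / 2 * plucker k l (wedge 1 2) := by
  have e : ∀ i, plucker k l (wedgeAction g (w i)) = c i * plucker k l (w i) := fun i => by
    rw [h i, map_smul, smul_eq_mul]
  have e0 := e 0
  have e1 := e 1
  have e2 := e 2
  have e3 := e 3
  have e4 := e 4
  have e5 := e 5
  have hw : w 0 = wedge 0 1 + wedge 2 3 ∧ w 1 = wedge 0 1 - wedge 2 3 ∧
      w 2 = wedge 0 2 + wedge 1 3 ∧ w 3 = wedge 0 2 - wedge 1 3 ∧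
      w 4 = wedge 0 3 + wedge 1 2 ∧ w 5 = wedge 0 3 - wedge 1 2 :=
    ⟨rfl, rfl, rfl, rfl, rfl, rfl⟩
  obtain ⟨h0, h1, h2, h3, h4, h5⟩ := hw
  rw [h0, map_add, map_add, map_add, plucker_wedgeAction, plucker_wedgeAction] at e0
  rw [h1, map_sub, map_sub, map_sub, plucker_wedgeAction, plucker_wedgeAction] at e1
  rw [h2, map_add, map_add, map_add, plucker_wedgeAction, plucker_wedgeAction] at e2
  rw [h3, map_sub, map_sub, map_sub, plucker_wedgeAction, plucker_wedgeAction] at e3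
  rw [h4, map_add, map_add, map_add, plucker_wedgeAction, plucker_wedgeAction] at e4
  rw [h5, map_sub, map_sub, map_sub, plucker_wedgeAction, plucker_wedgeAction] at e5
  simp only [minor]
  refine ⟨?_, ?_, ?_, ?_, ?_, ?_⟩
  · linear_combination (e0 + e1) / 2
  · linear_combination (e0 - e1) / 2
  · linear_combination (e2 + e3) / 2
  · linear_combination (e2 - e3) / 2
  · linear_combination (e4 + e5) / 2
  · linear_combination (e4 - e5) / 2

/-- A matrix of determinant one preserves the wedge pairing on `⋀²`, for which each `w i` is
non-isotropic, so its eigenvalue `c i` has square one. In coordinates, for the two vectors of a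
pair, the Plücker relation gives equality of the squares and the Laplace expansion shows that their
mean is one. -/
theorem exists_hasSigns_of_permutes_one {g : SL4} (hg : Permutes g 1) :
    ∃ c, HasSigns g c := by
  choose c hc using fun i => exists_smul_of_map_W (hg i)
  refine ⟨c, fun i => ⟨?_, hc i⟩⟩
  have hc' : ∀ i, wedgeAction g (w i) = c i • w i := hc
  have hm := fun k l => minor_eq hc' k l
  have hdet := g.2
  have key : ∀ x y : ℂ, (x + y) / 2 * ((x - y) / 2) = 0 →
      (x + y) / 2 * ((x + y) / 2) + (x - y) / 2 * ((x - y) / 2) = 1 →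
      (x = 1 ∨ x = -1) ∧ (y = 1 ∨ y = -1) := fun x y h1 h2 =>
    ⟨mul_self_eq_one_iff.mp (by linear_combination h2 + 2 * h1),
      mul_self_eq_one_iff.mp (by linear_combination h2 - 2 * h1)⟩
  have e01 := hm 0 1
  have e02 := hm 0 2
  have e03 := hm 0 3
  have e12 := hm 1 2
  have e13 := hm 1 3
  have e23 := hm 2 3
  simp only [plucker_wedge, Fin.reduceEq, if_true, if_false, mul_zero, mul_one, sub_zero, add_zero,
    zero_add] at e01 e02 e03 e12 e13 e23
  obtain ⟨a1, a2, a3, a4, a5, a6⟩ := e01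
  obtain ⟨b1, b2, b3, b4, b5, b6⟩ := e02
  obtain ⟨d1, d2, d3, d4, d5, d6⟩ := e03
  obtain ⟨f1, f2, f3, f4, f5, f6⟩ := e12
  obtain ⟨g1, g2, g3, g4, g5, g6⟩ := e13
  obtain ⟨j1, j2, j3, j4, j5, j6⟩ := e23
  have k0 := key (c 0) (c 1)
    (by have := minor_plucker g.1 0 1; rw [a1, j1, b1, d1] at this; linear_combination this)
    (by rw [det_eq_laplace, a1, a2, b1, d1, f1, g1, j1, j2] at hdet; linear_combination hdet)
  have k2 := key (c 2) (c 3)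
    (by have := minor_plucker g.1 0 2; rw [a3, b3, g3, d3] at this; linear_combination -this)
    (by rw [det_eq_laplace', a3, b3, b4, d3, f3, g3, g4, j3] at hdet; linear_combination hdet)
  have k4 := key (c 4) (c 5)
    (by have := minor_plucker g.1 0 3; rw [a5, b5, d5, f5] at this; linear_combination this)
    (by rw [det_eq_laplace'', a5, b5, d5, d6, f5, f6, g5, j5] at hdet; linear_combination hdet)
  fin_cases i
  · exact k0.1
  · exact k0.2
  · exact k2.1
  · exact k2.2
  · exact k4.1
  · exact k4.2

/-- An element that preserves each of the six lines lies in `N`. -/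
theorem mem_N_of_permutes_one {g : SL4} (hg : Permutes g 1) : g ∈ N := by
  obtain ⟨c, hc⟩ := exists_hasSigns_of_permutes_one hg
  -- Multiplication by `rootN k` changes exactly the signs at `k` and `k + 1`, so the signs at `0,
  -- …, 4` can be made positive one after another.
  have step : ∀ (k : Fin 5) (g : SL4) (c : Fin 6 → ℂ), HasSigns g c → ∃ g' c', HasSigns g' c' ∧
      (g' ∈ N → g ∈ N) ∧ c' k.castSucc = 1 ∧ ∀ i < k.castSucc, c' i = c i := by
    intro k g c hc
    rcases (hc k.castSucc).1 with h | h
    · exact ⟨g, c, hc, id, h, fun _ _ => rfl⟩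
    · refine ⟨rootN k * g, _, (hasSigns_rootN k).mul hc,
        (N.mul_mem_cancel_left (rootN_mem_N k)).mp, ?_, fun i hi => ?_⟩
      · simp [rootSign, h]
      · have h2 : ¬ (i = k.castSucc ∨ i = k.succ) := by
          rintro (rfl | rfl)
          · exact lt_irrefl _ hi
          · exact absurd hi (by simp [Fin.lt_def])
        simp [rootSign, h2]
  obtain ⟨g₀, c₀, hc₀, hg₀, h₀, -⟩ := step 0 g c hc
  obtain ⟨g₁, c₁, hc₁, hg₁, h₁, e₁⟩ := step 1 g₀ c₀ hc₀
  obtain ⟨g₂, c₂, hc₂, hg₂, h₂, e₂⟩ := step 2 g₁ c₁ hc₁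
  obtain ⟨g₃, c₃, hc₃, hg₃, h₃, e₃⟩ := step 3 g₂ c₂ hc₂
  obtain ⟨g₄, c₄, hc₄, hg₄, h₄, e₄⟩ := step 4 g₃ c₃ hc₃
  have s0 : c₃ 0 = 1 := by rw [e₃ 0 (by decide), e₂ 0 (by decide), e₁ 0 (by decide)]; exact h₀
  have s1 : c₃ 1 = 1 := by rw [e₃ 1 (by decide), e₂ 1 (by decide)]; exact h₁
  have s2 : c₃ 2 = 1 := by rw [e₃ 2 (by decide)]; exact h₂
  have s3 : c₃ 3 = 1 := h₃
  have s4 : c₄ 4 = 1 := h₄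
  rw [← e₄ 0 (by decide)] at s0
  rw [← e₄ 1 (by decide)] at s1
  rw [← e₄ 2 (by decide)] at s2
  rw [← e₄ 3 (by decide)] at s3
  refine hg₀ (hg₁ (hg₂ (hg₃ (hg₄ ?_))))
  have hm := fun k l => minor_eq (fun i => (hc₄ i).2) k l
  rw [s0, s1, s2, s3, s4] at hm
  have e01 := hm 0 1
  have e02 := hm 0 2
  have e03 := hm 0 3
  have e12 := hm 1 2
  have e13 := hm 1 3
  have e23 := hm 2 3
  simp only [plucker_wedge, Fin.reduceEq, if_true, if_false, mul_zero, mul_one, sub_zero, add_zero,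
    zero_add, sub_self, zero_div, one_add_one_eq_two, div_self (two_ne_zero (α := ℂ)), minor]
    at e01 e02 e03 e12 e13 e23
  obtain ⟨a1, a2, a3, a4, a5, a6⟩ := e01
  obtain ⟨b1, b2, b3, b4, b5, b6⟩ := e02
  obtain ⟨d1, d2, d3, d4, d5, d6⟩ := e03
  obtain ⟨f1, f2, f3, f4, f5, f6⟩ := e12
  obtain ⟨p1, p2, p3, p4, p5, p6⟩ := e13
  obtain ⟨j1, j2, j3, j4, j5, j6⟩ := e23
  obtain ⟨A, hA⟩ : ∃ A, (g₄ : Matrix (Fin 4) (Fin 4) ℂ) = A := ⟨_, rfl⟩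
  simp only [hA] at a1 a3 b1 b3 d1 d3 d5 d6 f1 f3 p1 p4 j3 a4 d4 j2 b2 d2 f4 j4 f2 p2
  -- Each off-diagonal entry comes from expanding a `3 × 3` determinant with a repeated column: in
  -- the expansion one minor is `1` and the other two are `0`.
  have x20 : A 2 0 = 0 := by linear_combination (-A 2 0) * a1 + A 1 0 * b1 - A 0 0 * f1
  have x30 : A 3 0 = 0 := by linear_combination (-A 3 0) * a1 + A 1 0 * d1 - A 0 0 * p1
  have x10 : A 1 0 = 0 := by linear_combination (-A 1 0) * b3 + A 2 0 * a3 + A 0 0 * f3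
  have x21 : A 2 1 = 0 := by linear_combination (-A 2 1) * a1 + A 1 1 * b1 - A 0 1 * f1
  have x31 : A 3 1 = 0 := by linear_combination (-A 3 1) * a1 + A 1 1 * d1 - A 0 1 * p1
  have x01 : A 0 1 = 0 := by linear_combination (-A 0 1) * p4 + A 1 1 * d4 - A 3 1 * a4
  have x12 : A 1 2 = 0 := by linear_combination (-A 1 2) * b3 + A 2 2 * a3 + A 0 2 * f3
  have x32 : A 3 2 = 0 := by linear_combination (-A 3 2) * b3 + A 2 2 * d3 - A 0 2 * j3
  have x02 : A 0 2 = 0 := by linear_combination (-A 0 2) * j2 - A 3 2 * b2 + A 2 2 * d2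
  have x03 : A 0 3 = 0 := by linear_combination (-A 0 3) * p4 - A 3 3 * a4 + A 1 3 * d4
  have x23 : A 2 3 = 0 := by linear_combination (-A 2 3) * p4 + A 3 3 * f4 + A 1 3 * j4
  have x13 : A 1 3 = 0 := by linear_combination (-A 1 3) * j2 - A 3 3 * f2 + A 2 3 * p2
  have hA1 : A = A 1 1 • (1 : Matrix (Fin 4) (Fin 4) ℂ) ∧ A 1 1 * A 1 1 = 1 := by
    rw [x01, x10, mul_zero, sub_zero] at a1
    rw [x02, x20, mul_zero, sub_zero] at b3
    rw [x03, x30, mul_zero, sub_zero] at d5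
    rw [x01, x31, zero_mul, zero_mul, sub_zero] at d6
    rw [x13, x31, mul_zero, sub_zero] at p4
    -- The last sign is not adjustable, but it is forced: the minor in `d6` equals `(1 - c₄ 5) / 2`
    -- and vanishes.
    have h5 : c₄ 5 = 1 := by linear_combination 2 * d6
    rw [h5] at d5
    have hA00 : A 0 0 ≠ 0 := left_ne_zero_of_mul_eq_one a1
    have e2 : A 2 2 = A 1 1 := mul_left_cancel₀ hA00 (by rw [a1, b3])
    have e3 : A 3 3 = A 1 1 := mul_left_cancel₀ hA00 (by rw [a1, d5]; norm_num)
    rw [e3] at p4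
    have e0 : A 0 0 = A 1 1 := mul_right_cancel₀ (right_ne_zero_of_mul_eq_one a1) (by rw [a1, p4])
    refine ⟨?_, p4⟩
    ext i j
    fin_cases i <;> fin_cases j <;>
      simp [x20, x30, x10, x21, x31, x01, x12, x32, x02, x03, x23, x13, e0, e2, e3]
  rcases mul_self_eq_one_iff.mp hA1.2 with h | h
  · have : g₄ = 1 := Subtype.ext (by rw [hA, hA1.1, h, one_smul]; rfl)
    rw [this]; exact one_mem N
  · have : g₄ = scalarI * scalarI := Subtype.ext (by
      rw [Matrix.SpecialLinearGroup.coe_mul, coe_scalarI, Matrix.smul_mul, Matrix.one_mul,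
        smul_smul, Complex.I_mul_I, hA, hA1.1, h])
    rw [this]; exact mul_mem scalarI_mem_N scalarI_mem_N

/-! ## Six invariant quartic forms -/

section Theta

variable {R : Type*} [CommRing R]

/-- Six quartic forms with sum zero that are invariant under `N`. -/
def thetaForm (x : Fin 4 → R) : Fin 6 → R :=
  let q₀ := x 0 ^ 4 + x 1 ^ 4 + x 2 ^ 4 + x 3 ^ 4
  let q₁ := x 0 ^ 2 * x 1 ^ 2 + x 2 ^ 2 * x 3 ^ 2
  let q₂ := x 0 ^ 2 * x 2 ^ 2 + x 1 ^ 2 * x 3 ^ 2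
  let q₃ := x 0 ^ 2 * x 3 ^ 2 + x 1 ^ 2 * x 2 ^ 2
  let e := x 0 * x 1 * x 2 * x 3
  ![q₀ - 6 * (q₁ + q₂ + q₃), q₀ - 6 * (q₁ - q₂ - q₃), q₀ - 6 * (q₂ - q₁ - q₃),
    q₀ - 6 * (q₃ - q₁ - q₂), -2 * q₀ + 24 * e, -2 * q₀ - 24 * e]

theorem map_thetaForm {S F : Type*} [CommRing S] [FunLike F R S] [RingHomClass F R S] (f : F)
    (x : Fin 4 → R) (i : Fin 6) : f (thetaForm x i) = thetaForm (fun j => f (x j)) i := by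
  fin_cases i <;> simp [thetaForm, map_ofNat f]

theorem thetaForm_mul (c : R) (x : Fin 4 → R) (i : Fin 6) :
    thetaForm (fun j => c * x j) i = c ^ 4 * thetaForm x i := by
  fin_cases i <;> simp [thetaForm] <;> ring

theorem sum_thetaForm (x : Fin 4 → R) : ∑ i, thetaForm x i = 0 := by
  simp [Fin.sum_univ_six, thetaForm]; ring

/-- With `sum_thetaForm`, these are the equations of the Igusa quartic in `ℙ⁵`. -/
theorem sum_thetaForm_pow_four (x : Fin 4 → R) :
    4 * ∑ i, thetaForm x i ^ 4 = (∑ i, thetaForm x i ^ 2) ^ 2 := by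
  simp [Fin.sum_univ_six, thetaForm]; ring

/-- `J` plays the role of `√-1`, and the matrix is the unnormalised `genMatrix 0`. The factor `-4 =
(1 ± J) ^ 4` becomes `-1` after division by `√2 ^ 4`; the same factor occurs for the other four
matrices. -/
theorem thetaForm_gen_zero {J : R} (hJ : J ^ 2 = -1) (x : Fin 4 → R) (i : Fin 6) :
    thetaForm ![(1 + J) * x 0, (1 + J) * x 1, (1 - J) * x 2, (1 - J) * x 3] i =
      -4 * thetaForm x (synthemeSwap 0 i) := by
  have h3 : J ^ 3 = -J := by rw [pow_succ, hJ]; ring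
  have h4 : J ^ 4 = 1 := by rw [pow_succ, h3]; linear_combination -hJ
  fin_cases i <;> simp [thetaForm, synthemeSwap, Equiv.swap_apply_def] <;> ring_nf <;>
    simp only [hJ, h3, h4] <;> ring

theorem thetaForm_gen_one (x : Fin 4 → R) (i : Fin 6) :
    thetaForm ![x 0 + x 3, x 1 - x 2, x 1 + x 2, -x 0 + x 3] i =
      -4 * thetaForm x (synthemeSwap 1 i) := by
  fin_cases i <;> simp [thetaForm, synthemeSwap, Equiv.swap_apply_def] <;> ring

theorem thetaForm_gen_two {J : R} (hJ : J ^ 2 = -1) (x : Fin 4 → R) (i : Fin 6) :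
    thetaForm ![(1 + J) * x 0, (1 - J) * x 1, (1 + J) * x 2, (1 - J) * x 3] i =
      -4 * thetaForm x (synthemeSwap 2 i) := by
  have h3 : J ^ 3 = -J := by rw [pow_succ, hJ]; ring
  have h4 : J ^ 4 = 1 := by rw [pow_succ, h3]; linear_combination -hJ
  fin_cases i <;> simp [thetaForm, synthemeSwap, Equiv.swap_apply_def] <;> ring_nf <;>
    simp only [hJ, h3, h4] <;> ring

theorem thetaForm_gen_three (x : Fin 4 → R) (i : Fin 6) :
    thetaForm ![x 0 + x 1, -x 0 + x 1, x 2 + x 3, -x 2 + x 3] i =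
      -4 * thetaForm x (synthemeSwap 3 i) := by
  fin_cases i <;> simp [thetaForm, synthemeSwap, Equiv.swap_apply_def] <;> ring

theorem thetaForm_gen_four {J : R} (hJ : J ^ 2 = -1) (x : Fin 4 → R) (i : Fin 6) :
    thetaForm ![(1 + J) * x 0, (1 - J) * x 1, (1 - J) * x 2, (1 + J) * x 3] i =
      -4 * thetaForm x (synthemeSwap 4 i) := by
  have h3 : J ^ 3 = -J := by rw [pow_succ, hJ]; ring
  have h4 : J ^ 4 = 1 := by rw [pow_succ, h3]; linear_combination -hJ
  fin_cases i <;> simp [thetaForm, synthemeSwap, Equiv.swap_apply_def] <;> ring_nf <;>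
    simp only [hJ, h3, h4] <;> ring

end Theta

/-! ### The action of linear maps on the six quartic forms -/

theorem substEquiv_inv_X (g : SL4) (i : Fin 4) :
    substEquiv g⁻¹ (X i) = ∑ j, C (g.1 i j) * X j := by
  rw [substEquiv_apply, inv_inv, bind₁_X_right, Matrix.toMvPolynomial]
  exact Finset.sum_congr rfl fun j _ => by rw [C_mul_X_eq_monomial]

/-- The six invariant quartic forms as polynomials. -/
noncomputable def theta : Fin 6 → MvPolynomial (Fin 4) ℂ := thetaForm X

theorem map_theta {S F : Type*} [CommRing S] [FunLike F (MvPolynomial (Fin 4) ℂ) S]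
    [RingHomClass F (MvPolynomial (Fin 4) ℂ) S] (f : F) (i : Fin 6) :
    f (theta i) = thetaForm (fun j => f (X j)) i := map_thetaForm f X i

theorem thetaForm_genMatrix (k : Fin 5) (i : Fin 6) :
    thetaForm (fun a => ∑ b, C (genMatrix k a b) * X b : Fin 4 → MvPolynomial (Fin 4) ℂ) i =
      -4 * theta (synthemeSwap k i) := by
  have hJ : (C Complex.I : MvPolynomial (Fin 4) ℂ) ^ 2 = -1 := by
    rw [← C_pow, Complex.I_sq, C_neg, C_1]
  fin_cases k
  · refine Eq.trans (congrArg (thetaForm · i) ?_) (thetaForm_gen_zero hJ X i)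
    funext a; fin_cases a <;> simp [genMatrix, Fin.sum_univ_four]
  · refine Eq.trans (congrArg (thetaForm · i) ?_) (thetaForm_gen_one X i)
    funext a; fin_cases a <;> simp [genMatrix, Fin.sum_univ_four, sub_eq_add_neg]
  · refine Eq.trans (congrArg (thetaForm · i) ?_) (thetaForm_gen_two hJ X i)
    funext a; fin_cases a <;> simp [genMatrix, Fin.sum_univ_four]
  · refine Eq.trans (congrArg (thetaForm · i) ?_) (thetaForm_gen_three X i)
    funext a; fin_cases a <;> simp [genMatrix, Fin.sum_univ_four]
  · refine Eq.trans (congrArg (thetaForm · i) ?_) (thetaForm_gen_four hJ X i)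
    funext a; fin_cases a <;> simp [genMatrix, Fin.sum_univ_four]

theorem substEquiv_gen_inv_theta (k : Fin 5) (i : Fin 6) :
    substEquiv (gen k)⁻¹ (theta i) = -theta (synthemeSwap k i) := by
  refine (map_theta (substEquiv (gen k)⁻¹) i).trans ?_
  have h1 : (fun a => substEquiv (gen k)⁻¹ (X a)) =
      fun a => C invSqrtTwo * ∑ b, C (genMatrix k a b) * X b := by
    funext a
    refine (substEquiv_inv_X (gen k) a).trans ?_
    rw [Finset.mul_sum]
    refine Finset.sum_congr rfl fun b _ => ?_
    rw [← mul_assoc, ← C_mul]; rfl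
  rw [h1, thetaForm_mul, thetaForm_genMatrix]
  have h2 : (C invSqrtTwo : MvPolynomial (Fin 4) ℂ) ^ 4 * 4 = 1 := by
    rw [← C_pow, show (4 : MvPolynomial (Fin 4) ℂ) = C 4 from (map_ofNat C 4).symm, ← C_mul, ← C_1]
    congr 1
    linear_combination 4 * (invSqrtTwo ^ 2 + 1 / 2) * invSqrtTwo_mul_self
  linear_combination -theta (synthemeSwap k i) * h2

theorem substEquiv_one : substEquiv 1 = 1 := by
  have h1 := substEquiv_mul 1 1
  rw [mul_one] at h1
  exact (left_eq_mul.mp h1)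

theorem substEquiv_mul_apply (g h : SL4) (f : MvPolynomial (Fin 4) ℂ) :
    substEquiv (g * h) f = substEquiv g (substEquiv h f) := by rw [substEquiv_mul]; rfl

theorem synthemeSwap_synthemeSwap (k : Fin 5) (i : Fin 6) :
    synthemeSwap k (synthemeSwap k i) = i := by
  revert k i; decide

/-- A test point at which the six values have distinct absolute values. It separates the forms up to
sign and also witnesses the later non-vanishing statements. -/
theorem eval_theta (i : Fin 6) : eval ![1, 2, 3, 5] (theta i) =
    (![-1671, 369, 1809, 2385, -726, -2166] i : ℂ) := by
  rw [map_theta]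
  fin_cases i <;> simp [thetaForm] <;> norm_num

theorem theta_injective_up_to_sign {i j : Fin 6} {ε : ℂ} (hε : ε = 1 ∨ ε = -1)
    (h : theta i = C ε * theta j) : i = j := by
  have h2 := congrArg (eval ![1, 2, 3, 5]) h
  rw [map_mul, eval_C, eval_theta, eval_theta] at h2
  rcases hε with rfl | rfl <;> fin_cases i <;> fin_cases j <;> first | rfl | (norm_num at h2)

/-- `g` permutes the forms `theta i` up to a common sign. -/
def ActsOnTheta (g : SL4) (ρ : Equiv.Perm (Fin 6)) : Prop :=
  ∃ ε : ℂ, (ε = 1 ∨ ε = -1) ∧ ∀ i, substEquiv g (theta i) = C ε * theta (ρ i)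

theorem ActsOnTheta.one : ActsOnTheta 1 1 := ⟨1, Or.inl rfl, fun i => by simp [substEquiv_one]⟩

theorem ActsOnTheta.mul {g h : SL4} {ρ τ : Equiv.Perm (Fin 6)} :
    ActsOnTheta g ρ → ActsOnTheta h τ → ActsOnTheta (g * h) (ρ * τ) := by
  rintro ⟨ε, hε, h1⟩ ⟨δ, hδ, h2⟩
  refine ⟨δ * ε, ?_, fun i => ?_⟩
  · rcases hε with rfl | rfl <;> rcases hδ with rfl | rfl <;> simp
  · rw [substEquiv_mul_apply, h2, map_mul, h1, ← mul_assoc, C_mul]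
    congr 2
    exact (substEquiv g).commutes δ

theorem ActsOnTheta.unique {g : SL4} {ρ τ : Equiv.Perm (Fin 6)} :
    ActsOnTheta g ρ → ActsOnTheta g τ → ρ = τ := by
  rintro ⟨ε, hε, h1⟩ ⟨δ, hδ, h2⟩
  refine Equiv.ext fun i => theta_injective_up_to_sign (ε := ε * δ) ?_ ?_
  · rcases hε with rfl | rfl <;> rcases hδ with rfl | rfl <;> simp
  · rw [C_mul, mul_assoc, ← h2, h1, ← mul_assoc, ← C_mul]
    rcases hε with rfl | rfl <;> simp

theorem substEquiv_gen_theta (k : Fin 5) (i : Fin 6) :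
    substEquiv (gen k) (theta i) = -theta (synthemeSwap k i) := by
  have h := congrArg (substEquiv (gen k)) (substEquiv_gen_inv_theta k (synthemeSwap k i))
  rw [← substEquiv_mul_apply, mul_inv_cancel, substEquiv_one, synthemeSwap_synthemeSwap,
    map_neg] at h
  rw [← neg_eq_iff_eq_neg]; exact h.symm

theorem actsOnTheta_gen (k : Fin 5) : ActsOnTheta (gen k) (synthemeSwap k) :=
  ⟨-1, Or.inr rfl, fun i => by simp [substEquiv_gen_theta]⟩

/-- The forms `theta i` are invariant under `N`. -/
theorem substEquiv_theta_of_mem_N {n : SL4} (hn : n ∈ N) (i : Fin 6) :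
    substEquiv n (theta i) = theta i := by
  let H : Subgroup SL4 :=
    { carrier := {g | substEquiv g (theta i) = theta i}
      mul_mem' := fun {g h} h1 h2 => by
        change substEquiv (g * h) (theta i) = theta i
        rw [substEquiv_mul_apply, h2, h1]
      one_mem' := by change substEquiv 1 (theta i) = theta i; rw [substEquiv_one]; rfl
      inv_mem' := fun {g} h => by
        change substEquiv g⁻¹ (theta i) = theta i
        nth_rewrite 1 [← show substEquiv g (theta i) = theta i from h]
        rw [← substEquiv_mul_apply, inv_mul_cancel, substEquiv_one]; rfl }
  refine N_le_of_rootN_mem (H := H) (fun k => ?_) hn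
  change substEquiv (rootN k) (theta i) = theta i
  -- `gen k` acts by an involution of the forms times `-1`, so its square `rootN k` acts trivially.
  rw [← gen_mul_self, substEquiv_mul_apply, substEquiv_gen_theta, map_neg, substEquiv_gen_theta,
    synthemeSwap_synthemeSwap, neg_neg]

theorem actsOnTheta_of_mem_N {n : SL4} (hn : n ∈ N) : ActsOnTheta n 1 :=
  ⟨1, Or.inl rfl, fun i => by simp [substEquiv_theta_of_mem_N hn]⟩

/-- The permutations realised by some `g` that also permutes the forms up to sign make up a
subgroup, and it contains the adjacent transpositions by `gen`. -/
theorem exists_permutes_actsOnTheta (σ : Equiv.Perm (Fin 6)) :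
    ∃ g ρ, Permutes g σ ∧ ActsOnTheta g ρ := by
  have hσ : σ ∈ Subgroup.closure (Set.range adjacentSwap) := by
    rw [closure_adjacentSwap]; trivial
  induction hσ using Subgroup.closure_induction with
  | mem x hx =>
    obtain ⟨k, rfl⟩ := hx
    exact ⟨_, _, permutes_gen k, actsOnTheta_gen k⟩
  | one => exact ⟨1, 1, .one, .one⟩
  | mul x y _ _ hx hy =>
    obtain ⟨g, ρ, h1, h2⟩ := hx
    obtain ⟨h, τ, h3, h4⟩ := hy
    exact ⟨_, _, h1.mul h3, h2.mul h4⟩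
  | inv x _ hx =>
    obtain ⟨g, ρ, h1, ε, hε, h2⟩ := hx
    refine ⟨g⁻¹, ρ⁻¹, h1.inv, ε, hε, fun i => ?_⟩
    have h := congrArg (substEquiv g⁻¹) (h2 (ρ⁻¹ i))
    rw [← substEquiv_mul_apply, inv_mul_cancel, substEquiv_one, map_mul,
      show ρ (ρ⁻¹ i) = i from ρ.apply_symm_apply i,
      show substEquiv g⁻¹ (C ε) = C ε from (substEquiv g⁻¹).commutes ε] at h
    rw [show theta (ρ⁻¹ i) = C ε * substEquiv g⁻¹ (theta i) from h, ← mul_assoc, ← C_mul]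
    rcases hε with rfl | rfl <;> simp

/-- A permutation of the six lines determines a permutation of the six forms. -/
theorem actsOnTheta_of_permutes {g h : SL4} {σ ρ : Equiv.Perm (Fin 6)} (hg : Permutes g σ)
    (hh : Permutes h σ) (hρ : ActsOnTheta g ρ) : ActsOnTheta h ρ := by
  have hn : g⁻¹ * h ∈ N := mem_N_of_permutes_one (by simpa using hg.inv.mul hh)
  simpa using hρ.mul (actsOnTheta_of_mem_N hn)

/-- There is an outer automorphism of `𝔖₆` that relates the action of a linear map on the six
lines to its action on the six forms. -/
theorem exists_isOuter_actsOnTheta : ∃ lam : MulAut (Equiv.Perm (Fin 6)), IsOuter lam ∧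
    ∀ (g : SL4) σ, Permutes g σ → ActsOnTheta g (lam σ) := by
  choose g ρ h1 h2 using exists_permutes_actsOnTheta
  -- The chosen `g σ` need not be multiplicative, but `ρ σ` depends only on `σ`, since `N` fixes the
  -- forms. This makes `ρ` a homomorphism.
  let f : Equiv.Perm (Fin 6) →* Equiv.Perm (Fin 6) := MonoidHom.mk' ρ fun σ τ =>
    (actsOnTheta_of_permutes (h1 _) ((h1 σ).mul (h1 τ)) (h2 _)).unique ((h2 σ).mul (h2 τ))
  obtain ⟨lam, hlam, hout⟩ := exists_isOuter_of_map_adjacentSwap f fun k =>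
    (actsOnTheta_of_permutes (h1 _) (permutes_gen k) (h2 _)).unique (actsOnTheta_gen k)
  refine ⟨lam, hout, fun a σ ha => ?_⟩
  rw [hlam]
  exact actsOnTheta_of_permutes (h1 σ) ha (h2 σ)

/-! ## The ring of invariants of `N` -/

/-- The subalgebra generated by the six invariant quartic forms. -/
noncomputable def thetaAlgebra : Subalgebra ℂ (MvPolynomial (Fin 4) ℂ) := (aeval theta).range

theorem theta_mem (i : Fin 6) : theta i ∈ thetaAlgebra := ⟨X i, aeval_X _ _⟩

/-- Four quadratic forms that are eigenvectors of `permOne` and `permTwo`. -/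
noncomputable def ellForm : Fin 4 → MvPolynomial (Fin 4) ℂ :=
  ![X 0 ^ 2 + X 1 ^ 2 + X 2 ^ 2 + X 3 ^ 2, X 0 ^ 2 + X 1 ^ 2 - X 2 ^ 2 - X 3 ^ 2,
    X 0 ^ 2 - X 1 ^ 2 + X 2 ^ 2 - X 3 ^ 2, X 0 ^ 2 - X 1 ^ 2 - X 2 ^ 2 + X 3 ^ 2]

theorem eq_inv_smul_ofNat_mul {A : Type*} [CommRing A] [Algebra ℂ A] (n : ℕ) [n.AtLeastTwo]
    (a : A) : a = ((n : ℂ)⁻¹) • ((OfNat.ofNat n : A) * a) := by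
  rw [← map_ofNat (algebraMap ℂ A), ← Algebra.smul_def, smul_smul]
  have : (n : ℂ) ≠ 0 := Nat.cast_ne_zero.mpr (NeZero.ne n)
  rw [show (OfNat.ofNat n : ℂ) = (n : ℂ) from rfl, inv_mul_cancel₀ this, one_smul]

theorem mem_of_ofNat_mul_mem {A : Type*} [CommRing A] [Algebra ℂ A] {B : Subalgebra ℂ A} (n : ℕ)
    [n.AtLeastTwo] {a : A} (h : (OfNat.ofNat n : A) * a ∈ B) : a ∈ B := by
  rw [eq_inv_smul_ofNat_mul n a]
  exact B.smul_mem h _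

theorem prod_X_mem : (X 0 * X 1 * X 2 * X 3 : MvPolynomial (Fin 4) ℂ) ∈ thetaAlgebra := by
  refine mem_of_ofNat_mul_mem 48 ?_
  have : (48 * (X 0 * X 1 * X 2 * X 3) : MvPolynomial (Fin 4) ℂ) = theta 4 - theta 5 := by
    simp [theta, thetaForm]; ring
  rw [this]
  exact sub_mem (theta_mem _) (theta_mem _)

theorem ellForm_sq_mem (j : Fin 4) : ellForm j ^ 2 ∈ thetaAlgebra := by
  refine mem_of_ofNat_mul_mem 3 ?_
  have : 3 * ellForm j ^ 2 = -(theta 4 + theta 5 + theta (j.castLE (by norm_num))) := by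
    fin_cases j <;> simp [theta, thetaForm, ellForm] <;> ring
  rw [this]
  exact neg_mem (add_mem (add_mem (theta_mem _) (theta_mem _)) (theta_mem _))

theorem prod_ellForm_mem : ellForm 0 * ellForm 1 * ellForm 2 * ellForm 3 ∈ thetaAlgebra := by
  set e : MvPolynomial (Fin 4) ℂ := X 0 * X 1 * X 2 * X 3 with he
  let q : MvPolynomial (Fin 4) ℂ := X 0 ^ 4 + X 1 ^ 4 + X 2 ^ 4 + X 3 ^ 4
  have hq : q ∈ thetaAlgebra := by
    refine mem_of_ofNat_mul_mem 4 ?_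
    have : 4 * q = -(theta 4 + theta 5) := by simp [q, theta, thetaForm]; ring
    rw [this]; exact neg_mem (add_mem (theta_mem _) (theta_mem _))
  let r : MvPolynomial (Fin 4) ℂ := X 0 ^ 2 * X 1 ^ 2 + X 2 ^ 2 * X 3 ^ 2
  let s : MvPolynomial (Fin 4) ℂ := X 0 ^ 2 * X 2 ^ 2 + X 1 ^ 2 * X 3 ^ 2
  let t : MvPolynomial (Fin 4) ℂ := X 0 ^ 2 * X 3 ^ 2 + X 1 ^ 2 * X 2 ^ 2
  have hr : r ∈ thetaAlgebra := by
    refine mem_of_ofNat_mul_mem 12 ?_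
    have : 12 * r = 2 * q - theta 0 - theta 1 := by simp [q, r, theta, thetaForm]; ring
    rw [this, two_mul]; exact sub_mem (sub_mem (add_mem hq hq) (theta_mem _)) (theta_mem _)
  have hs : s ∈ thetaAlgebra := by
    refine mem_of_ofNat_mul_mem 12 ?_
    have : 12 * s = 2 * q - theta 0 - theta 2 := by simp [q, s, theta, thetaForm]; ring
    rw [this, two_mul]; exact sub_mem (sub_mem (add_mem hq hq) (theta_mem _)) (theta_mem _)
  have ht : t ∈ thetaAlgebra := by
    refine mem_of_ofNat_mul_mem 12 ?_
    have : 12 * t = 2 * q - theta 0 - theta 3 := by simp [q, t, theta, thetaForm]; ring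
    rw [this, two_mul]; exact sub_mem (sub_mem (add_mem hq hq) (theta_mem _)) (theta_mem _)
  have : ellForm 0 * ellForm 1 * ellForm 2 * ellForm 3 =
      q ^ 2 - 4 * (r ^ 2 + s ^ 2 + t ^ 2) + 32 * e ^ 2 := by
    simp [ellForm, q, r, s, t, e]; ring
  rw [this]
  exact add_mem (sub_mem (pow_mem hq 2) (mul_mem (ofNat_mem _ 4)
    (add_mem (add_mem (pow_mem hr 2) (pow_mem hs 2)) (pow_mem ht 2))))
    (mul_mem (ofNat_mem _ 32) (pow_mem prod_X_mem 2))

theorem prod_pow_mem {A : Type*} [CommRing A] [Algebra ℂ A] {B : Subalgebra ℂ A} {y : Fin 4 → A}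
    (h2 : ∀ j, y j ^ 2 ∈ B) (h4 : y 0 * y 1 * y 2 * y 3 ∈ B) {c : Fin 4 → ℕ}
    (hc : ∃ d : Fin 4 → ℕ, ∃ ε, ∀ j, c j = 2 * d j + ε) : ∏ j, y j ^ c j ∈ B := by
  obtain ⟨d, ε, hd⟩ := hc
  have : ∏ j, y j ^ c j = (∏ j, (y j ^ 2) ^ d j) * (y 0 * y 1 * y 2 * y 3) ^ ε := by
    simp only [hd, Fin.prod_univ_four, pow_add, pow_mul, mul_pow]; ring
  rw [this]
  exact mul_mem (prod_mem fun j _ => pow_mem (h2 j) _) (pow_mem h4 _)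

theorem exists_eq_two_mul_add {c : Fin 4 → ℕ} (h1 : Even (c 2 + c 3)) (h2 : Even (c 1 + c 3))
    (h3 : Even (c 0 + c 1 + c 2 + c 3)) : ∃ d : Fin 4 → ℕ, ∃ ε, ∀ j, c j = 2 * d j + ε := by
  refine ⟨fun j => c j / 2, c 0 % 2, fun j => ?_⟩
  rw [Nat.even_iff] at h1 h2 h3
  fin_cases j <;> simp <;> omega

section Averaging

theorem substEquiv_permOne_X (i : Fin 4) :
    substEquiv permOne⁻¹ (X i) = (![X 1, X 0, X 3, X 2] i : MvPolynomial (Fin 4) ℂ) := by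
  rw [substEquiv_inv_X, coe_permOne]
  fin_cases i <;> simp [Fin.sum_univ_four]

theorem substEquiv_permTwo_X (i : Fin 4) :
    substEquiv permTwo⁻¹ (X i) = (![X 2, X 3, X 0, X 1] i : MvPolynomial (Fin 4) ℂ) := by
  rw [substEquiv_inv_X, coe_permTwo]
  fin_cases i <;> simp [Fin.sum_univ_four]

theorem substEquiv_diagOne_X (i : Fin 4) :
    substEquiv diagOne⁻¹ (X i) = (![1, 1, -1, -1] i : ℂ) • X i := by
  rw [substEquiv_inv_X, coe_diagOne]
  fin_cases i <;> simp [Fin.sum_univ_four]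

theorem substEquiv_diagTwo_X (i : Fin 4) :
    substEquiv diagTwo⁻¹ (X i) = (![1, -1, 1, -1] i : ℂ) • X i := by
  rw [substEquiv_inv_X, coe_diagTwo]
  fin_cases i <;> simp [Fin.sum_univ_four]

theorem substEquiv_scalarI_X (i : Fin 4) :
    substEquiv scalarI⁻¹ (X i) = Complex.I • X i := by
  rw [substEquiv_inv_X, coe_scalarI]
  fin_cases i <;> simp [Fin.sum_univ_four, smul_eq_C_mul]

/-- The sum over the group generated by `permOne` and `permTwo`. -/
noncomputable def permSum : MvPolynomial (Fin 4) ℂ →ₗ[ℂ] MvPolynomial (Fin 4) ℂ :=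
  (1 + (substEquiv permTwo⁻¹).toLinearMap) * (1 + (substEquiv permOne⁻¹).toLinearMap)

theorem permSum_apply (f : MvPolynomial (Fin 4) ℂ) :
    permSum f =
    (f + substEquiv permOne⁻¹ f) + substEquiv permTwo⁻¹ (f + substEquiv permOne⁻¹ f) := rfl

/-- The product is an eigenvector of both permutations with eigenvalues `±1`. A negative eigenvalue
kills the sum; otherwise all exponents have the same parity, and the product is one of squares
`ellForm j ^ 2`, of the full product of the `ellForm j`, and of `x₀x₁x₂x₃`. -/
theorem permSum_mul_prod_ellForm_mem (ε : ℕ) {c : Fin 4 → ℕ} (hc : Even (∑ j, c j)) :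
    permSum ((X 0 * X 1 * X 2 * X 3) ^ ε * ∏ j, ellForm j ^ c j) ∈ thetaAlgebra := by
  set f : MvPolynomial (Fin 4) ℂ := (X 0 * X 1 * X 2 * X 3) ^ ε * ∏ j, ellForm j ^ c j with hf
  have hell1 : ∀ j, substEquiv permOne⁻¹ (ellForm j) =
      (![1, 1, -1, -1] j : MvPolynomial (Fin 4) ℂ) * ellForm j := by
    intro j
    fin_cases j <;> simp [ellForm, substEquiv_permOne_X] <;> ring
  have hell2 : ∀ j, substEquiv permTwo⁻¹ (ellForm j) =
      (![1, -1, 1, -1] j : MvPolynomial (Fin 4) ℂ) * ellForm j := by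
    intro j
    fin_cases j <;> simp [ellForm, substEquiv_permTwo_X] <;> ring
  have h1 : substEquiv permOne⁻¹ f = (-1) ^ (c 2 + c 3) * f := by
    simp only [hf, map_mul, map_pow, hell1, substEquiv_permOne_X, Fin.prod_univ_four,
      mul_pow]
    simp; ring
  have h2 : substEquiv permTwo⁻¹ f = (-1) ^ (c 1 + c 3) * f := by
    simp only [hf, map_mul, map_pow, hell2, substEquiv_permTwo_X, Fin.prod_univ_four,
      mul_pow]
    simp; ring
  rw [permSum_apply, h1]
  rcases Nat.even_or_odd (c 2 + c 3) with h23 | h23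
  · rcases Nat.even_or_odd (c 1 + c 3) with h13 | h13
    · have hfm : f ∈ thetaAlgebra := by
        refine mul_mem (pow_mem prod_X_mem _) (prod_pow_mem ellForm_sq_mem prod_ellForm_mem
          (exists_eq_two_mul_add h23 h13 ?_))
        rwa [Fin.sum_univ_four] at hc
      rw [h23.neg_one_pow, one_mul, map_add, h2, h13.neg_one_pow, one_mul]
      exact add_mem (add_mem hfm hfm) (add_mem hfm hfm)
    · rw [h23.neg_one_pow, one_mul, map_add, h2, h13.neg_one_pow]
      convert zero_mem thetaAlgebra; ring
  · rw [h23.neg_one_pow]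
    convert zero_mem thetaAlgebra; simp

theorem permSum_mul_aeval_ellForm_mem (ε : ℕ) {n : ℕ} (hn : Even n) {Q : MvPolynomial (Fin 4) ℂ}
    (hQ : Q.IsHomogeneous n) :
    permSum ((X 0 * X 1 * X 2 * X 3) ^ ε * aeval ellForm Q) ∈ thetaAlgebra := by
  rw [Q.as_sum, map_sum, Finset.mul_sum, map_sum]
  refine sum_mem fun c hc => ?_
  rw [aeval_monomial, ← Algebra.smul_def, mul_smul_comm, map_smul, Finsupp.prod_fintype _ _ (by simp)]
  refine Subalgebra.smul_mem _ (permSum_mul_prod_ellForm_mem ε ?_) _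
  have := hQ (mem_support_iff.mp hc)
  rw [Finsupp.weight_apply, Finsupp.sum_fintype _ _ (by simp)] at this
  simp only [Pi.one_apply, smul_eq_mul, mul_one] at this
  rwa [this]

/-- The exponents all have the same parity `ε`, so the monomial is `(x₀x₁x₂x₃) ^ ε` times a monomial
in the squares. As `4 * x_j ^ 2` is a signed sum of the `ellForm`s, the second factor is a form in
them, of even degree because `4` divides the total degree. -/
theorem permSum_prod_X_mem {m : Fin 4 → ℕ} (h1 : Even (m 2 + m 3)) (h2 : Even (m 1 + m 3))
    (h3 : 4 ∣ ∑ j, m j) : permSum (∏ j, X j ^ m j) ∈ thetaAlgebra := by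
  have h3' : Even (m 0 + m 1 + m 2 + m 3) := by
    rw [← Fin.sum_univ_four]; exact even_iff_two_dvd.mpr (dvd_trans (by norm_num) h3)
  obtain ⟨b, ε, hb⟩ := exists_eq_two_mul_add h1 h2 h3'
  let L : Fin 4 → MvPolynomial (Fin 4) ℂ := ![X 0 + X 1 + X 2 + X 3, X 0 + X 1 - X 2 - X 3,
    X 0 - X 1 + X 2 - X 3, X 0 - X 1 - X 2 + X 3]
  have hL : ∀ j, (L j).IsHomogeneous 1 := by
    intro j
    have hX := fun i : Fin 4 => isHomogeneous_X ℂ i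
    fin_cases j
    · exact (((hX 0).add (hX 1)).add (hX 2)).add (hX 3)
    · exact (((hX 0).add (hX 1)).sub (hX 2)).sub (hX 3)
    · exact (((hX 0).sub (hX 1)).add (hX 2)).sub (hX 3)
    · exact (((hX 0).sub (hX 1)).sub (hX 2)).add (hX 3)
  have haL : ∀ j, aeval ellForm (L j) = 4 * X j ^ 2 := by
    intro j
    fin_cases j <;> simp [L, ellForm] <;> ring
  have hQ : (∏ j, L j ^ b j).IsHomogeneous (∑ j, b j) := by
    have := IsHomogeneous.prod Finset.univ (fun j => L j ^ b j) (fun j => 1 * b j)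
      (fun j _ => (hL j).pow (b j))
    simpa using this
  have hbe : Even (∑ j, b j) := by
    rw [Fin.sum_univ_four] at h3 ⊢
    rw [hb 0, hb 1, hb 2, hb 3] at h3
    rw [Nat.even_iff]; omega
  have key := permSum_mul_aeval_ellForm_mem ε hbe hQ
  have hn : ((4 : ℂ) ^ (∑ j, b j)) ≠ 0 := pow_ne_zero _ (by norm_num)
  have : ∏ j, X j ^ m j = ((4 : ℂ) ^ (∑ j, b j))⁻¹ •
      ((X 0 * X 1 * X 2 * X 3) ^ ε * aeval ellForm (∏ j, L j ^ b j)) := by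
    rw [eq_inv_smul_iff₀ hn, smul_eq_C_mul, C_pow, map_ofNat C 4]
    simp only [map_mul, map_pow, haL, Fin.prod_univ_four, Fin.sum_univ_four, hb]
    ring
  rw [this, map_smul]
  exact Subalgebra.smul_mem _ key _

/-- Averaging: `Φ` sums over 64 products of generators of `N`, hence is multiplication by `64` on
invariants. On a monomial the diagonal factors of `Φ` act by a scalar, which vanishes unless the
monomial satisfies the hypotheses of `permSum_prod_X_mem`. -/
theorem mem_thetaAlgebra_of_invariant {f : MvPolynomial (Fin 4) ℂ}
    (hf : ∀ n ∈ N, substEquiv n f = f) : f ∈ thetaAlgebra := by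
  let D₁ := substEquiv diagOne⁻¹
  let D₂ := substEquiv diagTwo⁻¹
  let s := substEquiv scalarI⁻¹
  let Φ : MvPolynomial (Fin 4) ℂ →ₗ[ℂ] MvPolynomial (Fin 4) ℂ := permSum *
    (1 + D₂.toLinearMap) * (1 + D₁.toLinearMap) * (1 + s.toLinearMap + s.toLinearMap ^ 2 +
      s.toLinearMap ^ 3)
  have hΦ : ∀ p, Φ p ∈ thetaAlgebra := by
    intro p
    rw [p.as_sum, map_sum]
    refine sum_mem fun m _ => ?_
    rw [monomial_eq, ← smul_eq_C_mul, map_smul, Finsupp.prod_fintype _ _ (by simp)]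
    refine Subalgebra.smul_mem _ ?_ _
    have hD₁ : D₁ (∏ j, X j ^ m j) = ((-1 : ℂ) ^ (m 2 + m 3)) • ∏ j, X j ^ m j := by
      simp only [D₁, map_mul, map_pow, substEquiv_diagOne_X, Fin.prod_univ_four, smul_pow]
      simp [pow_add, smul_smul, mul_comm]
    have hD₂ : D₂ (∏ j, X j ^ m j) = ((-1 : ℂ) ^ (m 1 + m 3)) • ∏ j, X j ^ m j := by
      simp only [D₂, map_mul, map_pow, substEquiv_diagTwo_X, Fin.prod_univ_four, smul_pow]
      simp [pow_add, smul_smul, mul_comm]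
    have hs : s (∏ j, X j ^ m j) = (Complex.I ^ ∑ j, m j) • ∏ j, X j ^ m j := by
      simp only [s, map_prod, map_pow, substEquiv_scalarI_X, smul_pow, Finset.prod_smul,
        Finset.prod_pow_eq_pow_sum]
    set c := Complex.I ^ ∑ j, m j with hc
    set M := ∏ j, (X j : MvPolynomial (Fin 4) ℂ) ^ m j
    have hval : Φ M = ((1 + c + c ^ 2 + c ^ 3) * (1 + (-1) ^ (m 2 + m 3)) *
        (1 + (-1) ^ (m 1 + m 3))) • permSum M := by
      have e1 : (1 + s.toLinearMap + s.toLinearMap ^ 2 + s.toLinearMap ^ 3 :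
          MvPolynomial (Fin 4) ℂ →ₗ[ℂ] MvPolynomial (Fin 4) ℂ) M = (1 + c + c ^ 2 + c ^ 3) • M := by
        change M + s M + s (s M) + s (s (s M)) = _
        simp only [hs, map_smul, smul_smul, add_smul, one_smul, pow_succ, pow_zero, one_mul]
      have e2 : (1 + D₁.toLinearMap :
          MvPolynomial (Fin 4) ℂ →ₗ[ℂ] MvPolynomial (Fin 4) ℂ) M = (1 + (-1 : ℂ) ^ (m 2 + m 3)) • M := by
        change M + D₁ M = _
        rw [hD₁, add_smul, one_smul]
      have e3 : (1 + D₂.toLinearMap :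
          MvPolynomial (Fin 4) ℂ →ₗ[ℂ] MvPolynomial (Fin 4) ℂ) M = (1 + (-1 : ℂ) ^ (m 1 + m 3)) • M := by
        change M + D₂ M = _
        rw [hD₂, add_smul, one_smul]
      simp only [Φ, Module.End.mul_apply, e1, map_smul, e2, e3, smul_smul, mul_assoc]
    rw [hval]
    rcases Nat.even_or_odd (m 2 + m 3) with h23 | h23
    swap
    · rw [h23.neg_one_pow]; simp
    rcases Nat.even_or_odd (m 1 + m 3) with h13 | h13
    swap
    · rw [h13.neg_one_pow]; simp
    by_cases h4 : 4 ∣ ∑ j, m j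
    · exact Subalgebra.smul_mem _ (permSum_prod_X_mem h23 h13 h4) _
    · have : 1 + c + c ^ 2 + c ^ 3 = 0 := by
        have hlt := Nat.mod_lt (∑ j, m j) (show 0 < 4 by norm_num)
        have hc' : c = Complex.I ^ ((∑ j, m j) % 4) := by
          rw [hc]
          conv_lhs => rw [← Nat.div_add_mod (∑ j, m j) 4, pow_add, pow_mul, Complex.I_pow_four,
            one_pow, one_mul]
        have hne : (∑ j, m j) % 4 ≠ 0 := fun h => h4 (Nat.dvd_of_mod_eq_zero h)
        rw [hc']
        generalize (∑ j, m j) % 4 = r at hlt hne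
        have hI := Complex.I_sq
        interval_cases r
        · exact absurd rfl hne
        · linear_combination (1 + Complex.I) * hI
        · linear_combination (1 + Complex.I ^ 4) * hI
        · linear_combination (1 + Complex.I + (Complex.I ^ 4 - Complex.I ^ 2 + 1) *
            (1 + Complex.I ^ 3) - Complex.I - 1) * hI
      rw [this]; simp
  have hinv : ∀ g ∈ N, substEquiv g⁻¹ f = f := fun g hg => hf _ (inv_mem hg)
  have hfin : Φ f = 64 * f := by
    have a1 := hinv _ scalarI_mem_N
    have a2 := hinv _ diagOne_mem_N
    have a3 := hinv _ diagTwo_mem_N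
    have a4 := hinv _ permOne_mem_N
    have a5 := hinv _ permTwo_mem_N
    have e1 : (1 + s.toLinearMap + s.toLinearMap ^ 2 + s.toLinearMap ^ 3 :
        MvPolynomial (Fin 4) ℂ →ₗ[ℂ] MvPolynomial (Fin 4) ℂ) f = (4 : ℂ) • f := by
      change f + s f + s (s f) + s (s (s f)) = _
      simp only [s, a1]; rw [smul_eq_C_mul, map_ofNat C 4]; ring
    have e2 : (1 + D₁.toLinearMap :
        MvPolynomial (Fin 4) ℂ →ₗ[ℂ] MvPolynomial (Fin 4) ℂ) f = (2 : ℂ) • f := by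
      change f + D₁ f = _
      simp only [D₁, a2]; rw [two_smul]
    have e3 : (1 + D₂.toLinearMap :
        MvPolynomial (Fin 4) ℂ →ₗ[ℂ] MvPolynomial (Fin 4) ℂ) f = (2 : ℂ) • f := by
      change f + D₂ f = _
      simp only [D₂, a3]; rw [two_smul]
    simp only [Φ, Module.End.mul_apply, e1, map_smul, e2, e3, smul_smul, mul_assoc]
    rw [permSum_apply, a4, map_add, a5, smul_eq_C_mul]
    rw [show (C (4 * (2 * 2)) : MvPolynomial (Fin 4) ℂ) = 16 by norm_num [map_ofNat C 16]]
    ring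
  exact mem_of_ofNat_mul_mem 64 (hfin ▸ hΦ f)

end Averaging

theorem isHomogeneous_theta (i : Fin 6) : (theta i).IsHomogeneous 4 := by
  let q (a b c d : Fin 4) : MvPolynomial (Fin 4) ℂ := X a * X b * X c * X d
  have hq : ∀ a b c d, q a b c d ∈ homogeneousSubmodule (Fin 4) ℂ 4 := fun a b c d =>
    (((isHomogeneous_X ℂ a).mul (isHomogeneous_X ℂ b)).mul (isHomogeneous_X ℂ c)).mul
      (isHomogeneous_X ℂ d)
  have key (a b c d f : ℂ) : a • (q 0 0 0 0 + q 1 1 1 1 + q 2 2 2 2 + q 3 3 3 3) +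
      b • (q 0 0 1 1 + q 2 2 3 3) + c • (q 0 0 2 2 + q 1 1 3 3) + d • (q 0 0 3 3 + q 1 1 2 2) +
      f • q 0 1 2 3 ∈ homogeneousSubmodule (Fin 4) ℂ 4 := by
    repeat' first | apply Submodule.add_mem | apply Submodule.smul_mem | apply hq
  let t : Fin 6 → Fin 5 → ℂ := ![![1, -6, -6, -6, 0], ![1, -6, 6, 6, 0], ![1, 6, -6, 6, 0],
    ![1, 6, 6, -6, 0], ![-2, 0, 0, 0, 24], ![-2, 0, 0, 0, -24]]
  have ht : theta i = t i 0 • (q 0 0 0 0 + q 1 1 1 1 + q 2 2 2 2 + q 3 3 3 3) +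
      t i 1 • (q 0 0 1 1 + q 2 2 3 3) + t i 2 • (q 0 0 2 2 + q 1 1 3 3) +
      t i 3 • (q 0 0 3 3 + q 1 1 2 2) + t i 4 • q 0 1 2 3 := by
    fin_cases i <;> simp [theta, thetaForm, t, q, smul_eq_C_mul, map_ofNat C] <;> ring
  rw [ht]
  exact key ..

/-- A homogeneous invariant of `N` is a homogeneous polynomial in the six quartic forms. -/
theorem exists_isHomogeneous_aeval_theta {f : MvPolynomial (Fin 4) ℂ}
    (hf : ∀ n ∈ N, substEquiv n f = f) {d : ℕ} (hd : f.IsHomogeneous (4 * d)) :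
    ∃ P : MvPolynomial (Fin 6) ℂ, P.IsHomogeneous d ∧ aeval theta P = f := by
  obtain ⟨P, rfl⟩ := mem_thetaAlgebra_of_invariant hf
  refine ⟨homogeneousComponent d P, homogeneousComponent_isHomogeneous d P, ?_⟩
  have h1 := homogeneousComponent_of_mem (m := 4 * d) hd
  rw [if_pos rfl] at h1
  change homogeneousComponent (4 * d) (aeval theta P) = aeval theta P at h1
  refine Eq.trans ?_ h1
  conv_rhs => rw [← sum_homogeneousComponent P, map_sum, map_sum]
  -- The forms have degree four, so only the component of `P` of degree `d` contributes in degree `4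
  -- * d`.
  have h2 : ∀ i, homogeneousComponent (4 * d) (aeval theta (homogeneousComponent i P)) =
      if i = d then aeval theta (homogeneousComponent d P) else 0 := by
    intro i
    rw [homogeneousComponent_of_mem
      ((homogeneousComponent_isHomogeneous i P).aeval theta isHomogeneous_theta)]
    by_cases hi : i = d
    · simp [hi]
    · rw [if_neg (by omega), if_neg hi]
  simp only [h2]
  rw [Finset.sum_ite_eq']
  split_ifs with h
  · rfl
  · rw [homogeneousComponent_eq_zero _ _ (by simpa using h), map_zero]

/-! ## From six forms with `p₁ = 0` and `4 p₄ = p₂ ^ 2` to the Segre cubic -/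

section PowerSums

variable {A : Type*} [CommRing A]

/-- The power sum of degree `n`. -/
def powerSum (n : ℕ) (t : Fin 6 → A) : A := ∑ i, t i ^ n

/-- The six cubic expressions in `t` that satisfy the equations of the Segre cubic. -/
def segreForm (t : Fin 6 → A) (i : Fin 6) : A :=
  12 * t i ^ 3 - 3 * powerSum 2 t * t i - 2 * powerSum 3 t

/-- The slope of the linear relation between `t i` and the square of `segreForm t i`. -/
def segreSlope (t : Fin 6 → A) : A := 48 * powerSum 5 t - 20 * powerSum 2 t * powerSum 3 t

/-- Newton's identities for six variables, and the sextic equation of the variables. -/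
theorem exists_esymm (t : Fin 6 → A) : ∃ e₁ e₂ e₃ e₄ e₅ e₆ : A,
    powerSum 1 t = e₁ ∧ powerSum 2 t = e₁ ^ 2 - 2 * e₂ ∧
    powerSum 3 t = e₁ ^ 3 - 3 * e₁ * e₂ + 3 * e₃ ∧
    powerSum 4 t = e₁ ^ 4 - 4 * e₁ ^ 2 * e₂ + 2 * e₂ ^ 2 + 4 * e₁ * e₃ - 4 * e₄ ∧
    powerSum 5 t = e₁ ^ 5 - 5 * e₁ ^ 3 * e₂ + 5 * e₁ * e₂ ^ 2 + 5 * e₁ ^ 2 * e₃ - 5 * e₂ * e₃ -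
      5 * e₁ * e₄ + 5 * e₅ ∧
    ∀ i, t i ^ 6 - e₁ * t i ^ 5 + e₂ * t i ^ 4 - e₃ * t i ^ 3 + e₄ * t i ^ 2 - e₅ * t i + e₆ = 0 := by
  obtain ⟨a, ha⟩ : ∃ a, t 0 = a := ⟨_, rfl⟩
  obtain ⟨b, hb⟩ : ∃ a, t 1 = a := ⟨_, rfl⟩
  obtain ⟨c, hc⟩ : ∃ a, t 2 = a := ⟨_, rfl⟩
  obtain ⟨d, hd⟩ : ∃ a, t 3 = a := ⟨_, rfl⟩
  obtain ⟨e, he⟩ : ∃ a, t 4 = a := ⟨_, rfl⟩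
  obtain ⟨f, hf⟩ : ∃ a, t 5 = a := ⟨_, rfl⟩
  simp only [powerSum, Fin.sum_univ_six, ha, hb, hc, hd, he, hf]
  refine ⟨a + b + c + d + e + f,
    a*b + a*c + a*d + a*e + a*f + b*c + b*d + b*e + b*f + c*d + c*e + c*f + d*e + d*f + e*f,
    a*b*c + a*b*d + a*b*e + a*b*f + a*c*d + a*c*e + a*c*f + a*d*e + a*d*f + a*e*f +
      b*c*d + b*c*e + b*c*f + b*d*e + b*d*f + b*e*f + c*d*e + c*d*f + c*e*f + d*e*f,
    a*b*c*d + a*b*c*e + a*b*c*f + a*b*d*e + a*b*d*f + a*b*e*f + a*c*d*e + a*c*d*f + a*c*e*f +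
      a*d*e*f + b*c*d*e + b*c*d*f + b*c*e*f + b*d*e*f + c*d*e*f,
    a*b*c*d*e + a*b*c*d*f + a*b*c*e*f + a*b*d*e*f + a*c*d*e*f + b*c*d*e*f,
    a*b*c*d*e*f, by ring, by ring, by ring, by ring, by ring, fun i => ?_⟩
  fin_cases i
  · change t 0 ^ 6 - _ * t 0 ^ 5 + _ * t 0 ^ 4 - _ * t 0 ^ 3 + _ * t 0 ^ 2 - _ * t 0 + _ = 0
    rw [ha]; ring
  · change t 1 ^ 6 - _ * t 1 ^ 5 + _ * t 1 ^ 4 - _ * t 1 ^ 3 + _ * t 1 ^ 2 - _ * t 1 + _ = 0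
    rw [hb]; ring
  · change t 2 ^ 6 - _ * t 2 ^ 5 + _ * t 2 ^ 4 - _ * t 2 ^ 3 + _ * t 2 ^ 2 - _ * t 2 + _ = 0
    rw [hc]; ring
  · change t 3 ^ 6 - _ * t 3 ^ 5 + _ * t 3 ^ 4 - _ * t 3 ^ 3 + _ * t 3 ^ 2 - _ * t 3 + _ = 0
    rw [hd]; ring
  · change t 4 ^ 6 - _ * t 4 ^ 5 + _ * t 4 ^ 4 - _ * t 4 ^ 3 + _ * t 4 ^ 2 - _ * t 4 + _ = 0
    rw [he]; ring
  · change t 5 ^ 6 - _ * t 5 ^ 5 + _ * t 5 ^ 4 - _ * t 5 ^ 3 + _ * t 5 ^ 2 - _ * t 5 + _ = 0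
    rw [hf]; ring

theorem sum_pow_mul_segreForm (t : Fin 6 → A) (n : ℕ) : ∑ i, t i ^ n * segreForm t i =
    12 * powerSum (n + 3) t - 3 * powerSum 2 t * powerSum (n + 1) t -
      2 * powerSum 3 t * powerSum n t := by
  simp only [segreForm]
  generalize powerSum 2 t = a
  generalize powerSum 3 t = b
  simp only [powerSum, Finset.mul_sum, ← Finset.sum_sub_distrib]
  exact Finset.sum_congr rfl fun i _ => by ring

variable {t : Fin 6 → A}

theorem sum_segreForm (h₁ : powerSum 1 t = 0) : ∑ i, segreForm t i = 0 := by
  have h := sum_pow_mul_segreForm t 0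
  rw [show powerSum 0 t = 6 by simp [powerSum], zero_add, zero_add, h₁] at h
  simp only [pow_zero, one_mul] at h
  rw [h]; ring

theorem sum_sq_mul_segreForm : 4 * ∑ i, t i ^ 2 * segreForm t i = segreSlope t := by
  rw [sum_pow_mul_segreForm, segreSlope]; ring

theorem sum_mul_segreForm (h₁ : powerSum 1 t = 0) (h₄ : 4 * powerSum 4 t = powerSum 2 t ^ 2) :
    ∑ i, t i * segreForm t i = 0 := by
  have h := sum_pow_mul_segreForm t 1
  simp only [pow_one] at h
  rw [h, h₁]; linear_combination 3 * h₄

/-- When `e₁ = 0`, the quartic relation reads `4 e₄ = e₂ ^ 2`. Completing the square in the sextic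
with roots `t i` then gives `(t³ + e₂ t / 2 - e₃ / 2)² = (e₅ - e₂ e₃ / 2) t + e₃² / 4 - e₆`; here
`segreForm` is `12` times the cubic on the left, and `segreSlope` is `240` times the coefficient of
`t`. -/
theorem exists_segreForm_sq (h₁ : powerSum 1 t = 0) (h₄ : 4 * powerSum 4 t = powerSum 2 t ^ 2) :
    ∃ c, ∀ i, 5 * segreForm t i ^ 2 = 3 * segreSlope t * t i + c := by
  obtain ⟨e₁, e₂, e₃, e₄, e₅, e₆, r₁, r₂, r₃, r₄, r₅, r⟩ := exists_esymm t
  obtain rfl : e₁ = 0 := r₁.symm.trans h₁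
  refine ⟨180 * (e₃ ^ 2 - 4 * e₆), fun i => ?_⟩
  have h := r i
  rw [r₄, r₂] at h₄
  rw [segreSlope, segreForm, r₂, r₃, r₅]
  linear_combination 720 * h + 45 * t i ^ 2 * h₄

/-- Writing the cube as `segreForm` times its square, an affine function of `t i`, reduces the sum
to the vanishing sums of `segreForm` and `t * segreForm`. -/
theorem sum_segreForm_pow_three (h₁ : powerSum 1 t = 0)
    (h₄ : 4 * powerSum 4 t = powerSum 2 t ^ 2) : 5 * ∑ i, segreForm t i ^ 3 = 0 := by
  obtain ⟨c, hc⟩ := exists_segreForm_sq h₁ h₄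
  have : 5 * ∑ i, segreForm t i ^ 3 =
      3 * segreSlope t * ∑ i, t i * segreForm t i + c * ∑ i, segreForm t i := by
    simp only [Finset.mul_sum, ← Finset.sum_add_distrib]
    exact Finset.sum_congr rfl fun i _ => by linear_combination segreForm t i * hc i
  rw [this, sum_segreForm h₁, sum_mul_segreForm h₁ h₄]; ring

/-- The fifth power is `segreForm` times the square of an affine function of `t i`, and only the
term `t ^ 2 * segreForm` has a non-zero sum. The quintic thus recovers the slope up to a root. -/
theorem sum_segreForm_pow_five (h₁ : powerSum 1 t = 0)
    (h₄ : 4 * powerSum 4 t = powerSum 2 t ^ 2) :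
    100 * ∑ i, segreForm t i ^ 5 = 9 * segreSlope t ^ 3 := by
  obtain ⟨c, hc⟩ := exists_segreForm_sq h₁ h₄
  have : 100 * ∑ i, segreForm t i ^ 5 = 9 * segreSlope t ^ 2 * (4 * ∑ i, t i ^ 2 * segreForm t i) +
      24 * c * segreSlope t * ∑ i, t i * segreForm t i + 4 * c ^ 2 * ∑ i, segreForm t i := by
    simp only [Finset.mul_sum, ← Finset.sum_add_distrib]
    exact Finset.sum_congr rfl fun i _ => by
      linear_combination 4 * segreForm t i *
        (5 * segreForm t i ^ 2 + (3 * segreSlope t * t i + c)) * hc i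
  rw [this, sum_segreForm h₁, sum_mul_segreForm h₁ h₄, sum_sq_mul_segreForm]; ring

/-- Subtracting the mean eliminates the unknown constant `c`, as the `t j` have sum zero. This is
the inverse map by quadrics. -/
theorem sq_segreForm_sub_sum (h₁ : powerSum 1 t = 0)
    (h₄ : 4 * powerSum 4 t = powerSum 2 t ^ 2) (i : Fin 6) :
    30 * segreForm t i ^ 2 - 5 * ∑ j, segreForm t j ^ 2 = 18 * segreSlope t * t i := by
  obtain ⟨c, hc⟩ := exists_segreForm_sq h₁ h₄
  have : 5 * ∑ j, segreForm t j ^ 2 = 3 * segreSlope t * ∑ j, t j + 6 * c := by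
    simp only [Finset.mul_sum, hc, Finset.sum_add_distrib]
    simp
  have h : ∑ j, t j = 0 := by simpa [powerSum] using h₁
  rw [this, h]
  linear_combination 6 * hc i

theorem powerSum_perm (n : ℕ) (t : Fin 6 → A) (s : Equiv.Perm (Fin 6)) :
    powerSum n (fun i => t (s i)) = powerSum n t := Equiv.sum_comp s (fun i => t i ^ n)

theorem powerSum_mul (n : ℕ) (a : A) (t : Fin 6 → A) :
    powerSum n (fun i => a * t i) = a ^ n * powerSum n t := by
  simp only [powerSum, Finset.mul_sum, mul_pow]

theorem map_powerSum {B F : Type*} [CommRing B] [FunLike F A B] [RingHomClass F A B] (f : F)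
    (n : ℕ) (t : Fin 6 → A) : f (powerSum n t) = powerSum n (fun i => f (t i)) := by
  simp [powerSum]

theorem map_segreForm {B F : Type*} [CommRing B] [FunLike F A B] [RingHomClass F A B] (f : F)
    (t : Fin 6 → A) (i : Fin 6) : f (segreForm t i) = segreForm (fun i => f (t i)) i := by
  simp [segreForm, map_powerSum, map_ofNat f]

theorem map_segreSlope {B F : Type*} [CommRing B] [FunLike F A B] [RingHomClass F A B] (f : F)
    (t : Fin 6 → A) : f (segreSlope t) = segreSlope (fun i => f (t i)) := by
  simp [segreSlope, map_powerSum, map_ofNat f]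

/-- `segreForm` has odd degree three in `t` and `segreSlope` has odd degree five; their product is
even, so a common sign of the forms disappears. -/
theorem segreSlope_mul_segreForm_smul_perm {a : A} (ha : a ^ 2 = 1) (t : Fin 6 → A)
    (s : Equiv.Perm (Fin 6)) (i : Fin 6) :
    segreSlope (fun i => a * t (s i)) * segreForm (fun i => a * t (s i)) i =
      segreSlope t * segreForm t (s i) := by
  have h (n : ℕ) : powerSum n (fun i => a * t (s i)) = a ^ n * powerSum n t :=
    (powerSum_mul n a fun i => t (s i)).trans (by rw [powerSum_perm])
  simp only [segreSlope, segreForm, h]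
  linear_combination (a ^ 6 + a ^ 4 + a ^ 2 + 1) * (48 * powerSum 5 t - 20 * powerSum 2 t * powerSum 3 t) *
    (12 * t (s i) ^ 3 - 3 * powerSum 2 t * t (s i) - 2 * powerSum 3 t) * ha

end PowerSums

/-! ## The homomorphism from the coordinate ring of the Segre cubic -/

theorem powerSum_one_theta : powerSum 1 theta = 0 := by
  simp only [powerSum, pow_one]
  exact sum_thetaForm X

theorem powerSum_four_theta : 4 * powerSum 4 theta = powerSum 2 theta ^ 2 :=
  sum_thetaForm_pow_four X

/-- The homomorphism of coordinate rings that defines the rational map from `ℙ³ / N` to the Segre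
cubic. -/
noncomputable def segreHom : SegreRing →ₐ[ℂ] MvPolynomial (Fin 4) ℂ :=
  Ideal.Quotient.liftₐ segreIdeal.toIdeal (aeval fun i => segreSlope theta * segreForm theta i) (by
    have h : segreIdeal.toIdeal ≤
        RingHom.ker (aeval (R := ℂ) fun i => segreSlope theta * segreForm theta i) := by
      refine Ideal.span_le.mpr ?_
      rintro f (rfl | rfl)
      · simp [RingHom.mem_ker, ← Finset.mul_sum, sum_segreForm powerSum_one_theta]
      · have h := sum_segreForm_pow_three powerSum_one_theta powerSum_four_theta
        have h5 : (5 : MvPolynomial (Fin 4) ℂ) ≠ 0 := by norm_num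
        simp [RingHom.mem_ker, mul_pow, ← Finset.mul_sum, (mul_eq_zero.mp h).resolve_left h5]
    exact fun a ha => h ha)

/-- The coordinate functions on the Segre cubic. -/
noncomputable def segreX (i : Fin 6) : SegreRing := Ideal.Quotient.mk _ (X i)

theorem segreHom_segreX (i : Fin 6) :
    segreHom (segreX i) = segreSlope theta * segreForm theta i := by
  refine (Ideal.Quotient.lift_mk ..).trans ?_
  exact aeval_X ..

theorem sum_segreX : ∑ i, segreX i = 0 := by
  have h : (∑ i, X i : MvPolynomial (Fin 6) ℂ) ∈ segreIdeal.toIdeal :=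
    Ideal.subset_span (Set.mem_insert _ _)
  exact (map_sum (Ideal.Quotient.mk segreIdeal.toIdeal) _ _).symm.trans
    (Ideal.Quotient.eq_zero_iff_mem.mpr h)

theorem sum_segreX_pow_three : ∑ i, segreX i ^ 3 = 0 := by
  have h : (∑ i, X i ^ 3 : MvPolynomial (Fin 6) ℂ) ∈ segreIdeal.toIdeal :=
    Ideal.subset_span (Set.mem_insert_of_mem _ (Set.mem_singleton _))
  exact (map_sum (Ideal.Quotient.mk segreIdeal.toIdeal) _ _).symm.trans
    (Ideal.Quotient.eq_zero_iff_mem.mpr h)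

theorem segreHom_quintic : 100 * segreHom (∑ i, segreX i ^ 5) = 9 * segreSlope theta ^ 8 := by
  simp only [map_sum, map_pow, segreHom_segreX, mul_pow, ← Finset.mul_sum]
  linear_combination segreSlope theta ^ 5 *
    sum_segreForm_pow_five powerSum_one_theta powerSum_four_theta

/-- The quadratic functions on the Segre cubic that correspond to the six forms `theta i`. -/
noncomputable def segreQuadric (i : Fin 6) : SegreRing := 30 * segreX i ^ 2 - 5 * ∑ j, segreX j ^ 2

theorem segreHom_segreQuadric (i : Fin 6) :
    segreHom (segreQuadric i) = 18 * segreSlope theta ^ 3 * theta i := by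
  simp only [segreQuadric, map_sub, map_mul, map_sum, map_pow, segreHom_segreX, mul_pow,
    ← Finset.mul_sum, map_ofNat segreHom]
  linear_combination segreSlope theta ^ 2 *
    sq_segreForm_sub_sum powerSum_one_theta powerSum_four_theta i

theorem substEquiv_segreHom_segreX {g : SL4} {ρ : Equiv.Perm (Fin 6)} (h : ActsOnTheta g ρ)
    (i : Fin 6) : substEquiv g (segreHom (segreX i)) = segreHom (segreX (ρ i)) := by
  obtain ⟨ε, hε, h⟩ := h
  have h2 : (C ε : MvPolynomial (Fin 4) ℂ) ^ 2 = 1 := by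
    rcases hε with rfl | rfl <;> simp
  rw [segreHom_segreX, segreHom_segreX, map_mul, map_segreForm, map_segreSlope]
  simp only [h]
  exact segreSlope_mul_segreForm_smul_perm h2 theta ρ i

theorem SegreRing.algHom_ext {A : Type*} [CommRing A] [Algebra ℂ A] {f g : SegreRing →ₐ[ℂ] A}
    (h : ∀ i, f (segreX i) = g (segreX i)) : f = g :=
  Ideal.Quotient.algHom_ext _ (MvPolynomial.algHom_ext h)

theorem permEquiv_segreX (s : Equiv.Perm (Fin 6)) (i : Fin 6) :
    permEquiv s (segreX i) = segreX (s i) :=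
  (permEquiv_mk s _).trans (congrArg _ (rename_X _ _))

/-- The homomorphism `segreHom` is equivariant. -/
theorem substEquiv_segreHom {g : SL4} {ρ : Equiv.Perm (Fin 6)} (h : ActsOnTheta g ρ)
    (b : SegreRing) : substEquiv g (segreHom b) = segreHom (permEquiv ρ b) := by
  have : ((substEquiv g : MvPolynomial (Fin 4) ℂ →ₐ[ℂ] MvPolynomial (Fin 4) ℂ).comp segreHom) =
      segreHom.comp (permEquiv ρ : SegreRing →ₐ[ℂ] SegreRing) :=
    SegreRing.algHom_ext fun i => by
      simpa [permEquiv_segreX] using substEquiv_segreHom_segreX h i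
  exact congrArg (fun f => f b) this

theorem isHomogeneous_powerSum_theta (n : ℕ) : (powerSum n theta).IsHomogeneous (4 * n) :=
  IsHomogeneous.sum _ _ _ fun i _ => (isHomogeneous_theta i).pow n

theorem isHomogeneous_segreHom_segreX (i : Fin 6) : (segreHom (segreX i)).IsHomogeneous 32 := by
  have hn : ∀ (c : ℂ) {n : ℕ} {p : MvPolynomial (Fin 4) ℂ}, p.IsHomogeneous n →
      (C c * p).IsHomogeneous n := fun c n p hp => by simpa using (isHomogeneous_C (Fin 4) c).mul hp
  have hp := isHomogeneous_powerSum_theta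
  have ht := isHomogeneous_theta i
  have h1 : (segreSlope theta).IsHomogeneous 20 := by
    have := (hn 48 (hp 5)).sub (hn 20 ((hp 2).mul (hp 3)))
    simpa [segreSlope, map_ofNat C, mul_assoc] using this
  have h2 : (segreForm theta i).IsHomogeneous 12 := by
    have := ((hn 12 (ht.pow 3)).sub (hn 3 ((hp 2).mul ht))).sub (hn 2 (hp 3))
    simpa [segreForm, map_ofNat C, mul_assoc] using this
  rw [segreHom_segreX]
  exact h1.mul h2

theorem isHomogeneous_segreHom {n : ℕ} {b : SegreRing} (hb : b ∈ quotientGrading segreIdeal n) :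
    (segreHom b).IsHomogeneous (32 * n) := by
  obtain ⟨f, hf, rfl⟩ := hb
  have h : segreHom.comp (Ideal.Quotient.mkₐ ℂ segreIdeal.toIdeal) =
      aeval fun i => segreHom (segreX i) :=
    MvPolynomial.algHom_ext fun i => by simp [segreX]
  have h2 := congrArg (fun φ => φ f) h
  refine Eq.mp (congrArg (IsHomogeneous · _) h2.symm) ?_
  exact IsHomogeneous.aeval hf _ isHomogeneous_segreHom_segreX

theorem eval_segreSlope_theta : eval ![1, 2, 3, 5] (segreSlope theta) ≠ 0 := by
  rw [map_segreSlope]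
  simp [eval_theta, segreSlope, powerSum, Fin.sum_univ_six]
  norm_num

theorem segreSlope_theta_ne_zero : segreSlope theta ≠ 0 := fun h =>
  eval_segreSlope_theta (by rw [h, map_zero])

/-! ## The coordinate ring of the Segre cubic as a hypersurface that is linear in one variable -/

/-- The linear forms `u, v, w, u', v', w'` on the Segre cubic, which satisfy
`u * v * w + u' * v' * w' = 0`. -/
noncomputable def segreU : Fin 6 → SegreRing :=
  ![segreX 0 + segreX 1, segreX 1 + segreX 2, segreX 3 + segreX 4, segreX 4 + segreX 5,
    segreX 0 + segreX 2, segreX 3 + segreX 5]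

theorem sum_segreU : segreU 0 + segreU 1 + segreU 2 + segreU 3 + segreU 4 + segreU 5 = 0 := by
  have h := sum_segreX
  rw [Fin.sum_univ_six] at h
  simp only [segreU]
  simp
  linear_combination 2 * h

theorem segreU_relation :
    segreU 0 * segreU 1 * segreU 4 + segreU 2 * segreU 3 * segreU 5 = 0 := by
  have h := sum_segreX
  have h3 := sum_segreX_pow_three
  rw [Fin.sum_univ_six] at h h3
  -- This is `(a + b + c)³ - a³ - b³ - c³ = 3 (a + b)(b + c)(c + a)` for both triples of
  -- coordinates, whose sums are opposite.
  have key : 3 * (segreU 0 * segreU 1 * segreU 4 + segreU 2 * segreU 3 * segreU 5) = 0 := by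
    simp only [segreU]
    simp
    generalize segreX 0 = a at *
    generalize segreX 1 = b at *
    generalize segreX 2 = c at *
    generalize segreX 3 = d at *
    generalize segreX 4 = e at *
    generalize segreX 5 = f at *
    linear_combination ((a + b + c) ^ 2 - (a + b + c) * (d + e + f) + (d + e + f) ^ 2) * h - h3
  rw [eq_inv_smul_ofNat_mul 3 (_ + _), key, smul_zero]

/-- Twice the coordinate functions, in terms of `u, v, w, u', v', w'`. -/
theorem two_mul_segreX : (fun i => 2 * segreX i) = ![segreU 0 - segreU 1 + segreU 4,
    segreU 0 + segreU 1 - segreU 4, segreU 1 + segreU 4 - segreU 0,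
    segreU 2 - segreU 3 + segreU 5, segreU 2 + segreU 3 - segreU 5,
    segreU 3 + segreU 5 - segreU 2] := by
  funext i
  fin_cases i <;> simp [segreU] <;> ring

section LinearHypersurface

variable {R : Type*} [CommRing R]

/-- Pseudo-division by a linear polynomial: modulo `a * X + b`, every `a * X` may be replaced by
`-b`. -/
theorem exists_pow_mul_sub_C_mem (a b : R) (p : Polynomial R) :
    ∃ n : ℕ, ∃ c : R, (Polynomial.C a * Polynomial.X + Polynomial.C b) ∣
      Polynomial.C a ^ n * p - Polynomial.C c := by
  induction p using Polynomial.induction_on' with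
  | add p q hp hq =>
    obtain ⟨n, c, hp⟩ := hp
    obtain ⟨m, d, hq⟩ := hq
    refine ⟨n + m, a ^ m * c + a ^ n * d, ?_⟩
    convert dvd_add (hp.mul_left (Polynomial.C a ^ m)) (hq.mul_left (Polynomial.C a ^ n)) using 1
    simp only [map_add, map_mul, map_pow]
    ring
  | monomial k r =>
    refine ⟨k, r * (-b) ^ k, ?_⟩
    rw [← Polynomial.C_mul_X_pow_eq_monomial]
    have h := sub_dvd_pow_sub_pow (Polynomial.C a * Polynomial.X) (-Polynomial.C b) k
    rw [sub_neg_eq_add] at h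
    convert h.mul_left (Polynomial.C r) using 1
    simp only [map_mul, map_pow, map_neg, mul_pow]
    ring

/-- If the kernel of `φ` contains `a * X + b`, with `a` and `b` coprime, but no non-zero constants,
then it is generated by `a * X + b`. -/
theorem dvd_of_map_eq_zero [IsDomain R] [UniqueFactorizationMonoid R] {A : Type*} [CommRing A]
    (φ : Polynomial R →+* A) {a b : R} (ha : a ≠ 0)
    (hab : IsRelPrime a b) (h0 : φ (Polynomial.C a * Polynomial.X + Polynomial.C b) = 0)
    (hinj : ∀ c, φ (Polynomial.C c) = 0 → c = 0) {p : Polynomial R} (hp : φ p = 0) :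
    (Polynomial.C a * Polynomial.X + Polynomial.C b) ∣ p := by
  set F := Polynomial.C a * Polynomial.X + Polynomial.C b with hF
  have hirr : Irreducible F := Polynomial.irreducible_C_mul_X_add_C ha hab
  obtain ⟨n, c, q, hq⟩ := exists_pow_mul_sub_C_mem a b p
  rw [← hF] at hq
  have hc : c = 0 := hinj c (by
    have := congrArg φ hq
    simpa [hp, h0] using this)
  rw [hc, map_zero, sub_zero] at hq
  have hprime : Prime F := hirr.prime
  -- The prime `F` divides `a ^ n * p`, and it has degree one, so it cannot divide the constant `a`.
  rcases hprime.dvd_or_dvd (Dvd.intro q hq.symm) with h | h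
  · exfalso
    have h2 := Polynomial.degree_le_of_dvd (hprime.dvd_of_dvd_pow h) (Polynomial.C_ne_zero.mpr ha)
    rw [Polynomial.degree_C ha, hF, Polynomial.degree_linear ha] at h2
    exact absurd h2 (by decide)
  · exact h

end LinearHypersurface

/-- The leading coefficient of the equation of the Segre cubic. -/
noncomputable def segreLead : MvPolynomial (Fin 4) ℂ := X 1 * X 0 + -(X 2 * X 3)

/-- The constant coefficient of the equation of the Segre cubic. -/
noncomputable def segreConst : MvPolynomial (Fin 4) ℂ := -(X 2 * X 3 * (X 0 + X 1 + X 2 + X 3))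

theorem irreducible_segreLead : Irreducible segreLead := by
  refine irreducible_mul_X_add _ _ 0 (X_ne_zero _) ?_ ?_ ?_
  · simp
  · rw [vars_neg]
    intro h
    have := vars_mul _ _ h
    simp at this
  · refine (((X_prime (R := ℂ) (i := (1 : Fin 4))).irreducible.isRelPrime_iff_not_dvd).mpr ?_)
    rw [dvd_neg]
    intro h
    rcases X_prime.dvd_or_dvd h with h | h
    · exact absurd (X_dvd_X.mp h) (by decide)
    · exact absurd (X_dvd_X.mp h) (by decide)

theorem isRelPrime_segreLead_segreConst : IsRelPrime segreLead segreConst := by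
  refine (irreducible_segreLead.isRelPrime_iff_not_dvd).mpr ?_
  intro h
  -- At `(1, 1, 1, 1)` the leading coefficient vanishes, while the constant one equals `-4`.
  have := map_dvd (eval (fun _ => (1 : ℂ))) h
  simp [segreLead, segreConst] at this
  norm_num at this

/-- The presentation of the coordinate ring of the Segre cubic. -/
noncomputable def segrePresentation : Polynomial (MvPolynomial (Fin 4) ℂ) →+* SegreRing :=
  Polynomial.eval₂RingHom (aeval fun i => segreU (i.castLE (by norm_num)) :
    MvPolynomial (Fin 4) ℂ →ₐ[ℂ] SegreRing).toRingHom (segreU 4)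

theorem segrePresentation_C (p : MvPolynomial (Fin 4) ℂ) : segrePresentation (Polynomial.C p) =
    aeval (fun i => segreU (i.castLE (by norm_num))) p := Polynomial.eval₂_C ..

theorem segrePresentation_X : segrePresentation Polynomial.X = segreU 4 := Polynomial.eval₂_X ..

/-- Eliminating `segreU 5` by the linear relation leaves a cubic equation that is linear in `segreU
4`. -/
theorem segrePresentation_equation : segrePresentation
    (Polynomial.C segreLead * Polynomial.X + Polynomial.C segreConst) = 0 := by
  rw [map_add, map_mul, segrePresentation_C, segrePresentation_C, segrePresentation_X]
  simp only [segreLead, segreConst, map_add, map_mul, map_neg, aeval_X]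
  have h := segreU_relation
  have h2 := sum_segreU
  change (segreU 1 * segreU 0 + -(segreU 2 * segreU 3)) * segreU 4 +
    -(segreU 2 * segreU 3 * (segreU 0 + segreU 1 + segreU 2 + segreU 3)) = 0
  linear_combination h - segreU 2 * segreU 3 * h2

theorem segrePresentation_surjective : Function.Surjective segrePresentation := by
  have hU : ∀ i, segreU i ∈ segrePresentation.range := by
    have h4 : ∀ i : Fin 4, segreU (i.castLE (by norm_num)) ∈ segrePresentation.range := fun i =>
      ⟨Polynomial.C (X i), (segrePresentation_C _).trans (aeval_X ..)⟩
    have h5 : segreU 4 ∈ segrePresentation.range := ⟨_, segrePresentation_X⟩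
    have h6 : segreU 5 ∈ segrePresentation.range := by
      have : segreU 5 = -(segreU 0 + segreU 1 + segreU 2 + segreU 3 + segreU 4) := by
        linear_combination sum_segreU
      rw [this]
      exact neg_mem (add_mem (add_mem (add_mem (add_mem (h4 0) (h4 1)) (h4 2)) (h4 3)) h5)
    intro i
    fin_cases i
    exacts [h4 0, h4 1, h4 2, h4 3, h5, h6]
  have hc : ∀ c : ℂ, algebraMap ℂ SegreRing c ∈ segrePresentation.range := fun c =>
    ⟨Polynomial.C (C c), (segrePresentation_C _).trans (aeval_C ..)⟩
  have hX : ∀ i, segreX i ∈ segrePresentation.range := by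
    intro i
    rw [eq_inv_smul_ofNat_mul 2 (segreX i), Algebra.smul_def, congrFun two_mul_segreX i]
    refine mul_mem (hc _) ?_
    fin_cases i
    exacts [add_mem (sub_mem (hU 0) (hU 1)) (hU 4), sub_mem (add_mem (hU 0) (hU 1)) (hU 4),
      sub_mem (add_mem (hU 1) (hU 4)) (hU 0), add_mem (sub_mem (hU 2) (hU 3)) (hU 5),
      sub_mem (add_mem (hU 2) (hU 3)) (hU 5), sub_mem (add_mem (hU 3) (hU 5)) (hU 2)]
  intro b
  obtain ⟨f, rfl⟩ := Ideal.Quotient.mk_surjective b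
  change _ ∈ segrePresentation.range
  induction f using MvPolynomial.induction_on with
  | C a => exact hc a
  | add p q hp hq => rw [map_add]; exact add_mem hp hq
  | mul_X p i hp => rw [map_mul]; exact mul_mem hp (hX i)

/-! ### Algebraic independence and injectivity of `segreHom` -/

theorem segreHom_segreLead_ne_zero :
    segreHom (segreU 1 * segreU 0 + -(segreU 2 * segreU 3)) ≠ 0 := by
  intro h
  have h2 := congrArg (eval ![1, 2, 3, 5]) h
  have : segreHom (segreU 1 * segreU 0 + -(segreU 2 * segreU 3)) = segreSlope theta ^ 2 *
      ((segreForm theta 1 + segreForm theta 2) * (segreForm theta 0 + segreForm theta 1) -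
        (segreForm theta 3 + segreForm theta 4) * (segreForm theta 4 + segreForm theta 5)) := by
    simp [segreU, segreHom_segreX]; ring
  rw [this, map_mul, map_pow, map_zero, mul_eq_zero] at h2
  rcases h2 with h2 | h2
  · exact eval_segreSlope_theta (pow_eq_zero_iff (two_ne_zero) |>.mp h2)
  · simp only [map_sub, map_mul, map_add, map_segreForm] at h2
    simp [eval_theta, segreForm, powerSum, Fin.sum_univ_six] at h2
    norm_num at h2

/-- The images of `u, v, u', v'` in the ring of polynomials in four variables are algebraically
independent. -/
theorem algebraicIndependent_segreHom_segreU : AlgebraicIndependent ℂ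
    (fun i : Fin 4 => segreHom (segreU (i.castLE (by norm_num)))) := by
  set v : Fin 4 → MvPolynomial (Fin 4) ℂ := fun i => segreHom (segreU (i.castLE (by norm_num)))
    with hv
  let R := Algebra.adjoin ℂ (Set.range v)
  -- `E` consists of the elements algebraic over the subalgebra generated by the four images. Once
  -- it contains every variable, four elements suffice for transcendence degree four, so they are
  -- independent.
  let E := (Subalgebra.algebraicClosure R (MvPolynomial (Fin 4) ℂ)).restrictScalars ℂ
  have hR : ∀ x ∈ R, x ∈ E := fun x hx => isAlgebraic_algebraMap (⟨x, hx⟩ : R)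
  have hmul : ∀ {x y}, x ≠ 0 → x ∈ E → x * y ∈ E → y ∈ E := fun hx h h' =>
    IsAlgebraic.of_mul (mem_nonZeroDivisors_of_ne_zero hx) h h'
  have hpow : ∀ {x} {n : ℕ}, 0 < n → x ^ n ∈ E → x ∈ E := fun hn h => IsAlgebraic.of_pow hn h
  have hU4 : ∀ i : Fin 4, segreHom (segreU (i.castLE (by norm_num))) ∈ E := fun i =>
    hR _ (Algebra.subset_adjoin ⟨i, rfl⟩)
  have h0 := hU4 0
  have h1 := hU4 1
  have h2 := hU4 2
  have h3 := hU4 3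
  change segreHom (segreU 0) ∈ E at h0
  change segreHom (segreU 1) ∈ E at h1
  change segreHom (segreU 2) ∈ E at h2
  change segreHom (segreU 3) ∈ E at h3
  have h4 : segreHom (segreU 4) ∈ E := by
    refine hmul segreHom_segreLead_ne_zero ?_ ?_
    · simp only [map_add, map_mul, map_neg]
      exact add_mem (mul_mem h1 h0) (neg_mem (mul_mem h2 h3))
    · rw [← map_mul, show (segreU 1 * segreU 0 + -(segreU 2 * segreU 3)) * segreU 4 =
        segreU 2 * segreU 3 * (segreU 0 + segreU 1 + segreU 2 + segreU 3) by
          linear_combination segreU_relation - segreU 2 * segreU 3 * sum_segreU]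
      simp only [map_add, map_mul]
      exact mul_mem (mul_mem h2 h3) (add_mem (add_mem (add_mem h0 h1) h2) h3)
  have h5 : segreHom (segreU 5) ∈ E := by
    have : segreU 5 = -(segreU 0 + segreU 1 + segreU 2 + segreU 3 + segreU 4) := by
      linear_combination sum_segreU
    rw [this]
    simp only [map_add, map_neg]
    exact neg_mem (add_mem (add_mem (add_mem (add_mem h0 h1) h2) h3) h4)
  have hX : ∀ i, segreHom (segreX i) ∈ E := by
    intro i
    refine mem_of_ofNat_mul_mem 2 ?_
    rw [← map_ofNat segreHom 2, ← map_mul, congrFun two_mul_segreX i]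
    fin_cases i
    · exact (map_add segreHom _ _).symm ▸ add_mem ((map_sub segreHom _ _).symm ▸ sub_mem h0 h1) h4
    · exact (map_sub segreHom _ _).symm ▸ sub_mem ((map_add segreHom _ _).symm ▸ add_mem h0 h1) h4
    · exact (map_sub segreHom _ _).symm ▸ sub_mem ((map_add segreHom _ _).symm ▸ add_mem h1 h4) h0
    · exact (map_add segreHom _ _).symm ▸ add_mem ((map_sub segreHom _ _).symm ▸ sub_mem h2 h3) h5
    · exact (map_sub segreHom _ _).symm ▸ sub_mem ((map_add segreHom _ _).symm ▸ add_mem h2 h3) h5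
    · exact (map_sub segreHom _ _).symm ▸ sub_mem ((map_add segreHom _ _).symm ▸ add_mem h3 h5) h2
  -- The image of the quintic is a multiple of the eighth power of the slope; dividing the images of
  -- the quadrics by the cube of the slope then yields the forms `theta i`.
  have hS : segreSlope theta ∈ E := by
    refine hpow (n := 8) (by norm_num) (mem_of_ofNat_mul_mem 9 ?_)
    rw [← segreHom_quintic, map_sum]
    refine mul_mem (ofNat_mem _ _) (sum_mem fun i _ => ?_)
    rw [map_pow]
    exact pow_mem (hX i) 5
  have htheta : ∀ i, theta i ∈ E := by
    intro i
    refine mem_of_ofNat_mul_mem 18 (hmul (pow_ne_zero 3 segreSlope_theta_ne_zero)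
      (pow_mem hS 3) ?_)
    rw [show segreSlope theta ^ 3 * (18 * theta i) = 18 * segreSlope theta ^ 3 * theta i by ring,
      ← segreHom_segreQuadric, segreQuadric]
    simp only [map_sub, map_mul, map_sum, map_pow, map_ofNat segreHom]
    exact sub_mem (mul_mem (ofNat_mem _ _) (pow_mem (hX i) 2))
      (mul_mem (ofNat_mem _ _) (sum_mem fun j _ => pow_mem (hX j) 2))
  have hell : ∀ j, ellForm j ∈ E := fun j => hpow (n := 2) (by norm_num) (by
    have hle : thetaAlgebra ≤ E := by
      rw [thetaAlgebra, ← Algebra.adjoin_range_eq_range_aeval, Algebra.adjoin_le_iff]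
      rintro _ ⟨i, rfl⟩
      exact htheta i
    exact hle (ellForm_sq_mem j))
  have hx : ∀ j, (X j : MvPolynomial (Fin 4) ℂ) ∈ E := by
    intro j
    refine hpow (n := 2) (by norm_num) (mem_of_ofNat_mul_mem 4 ?_)
    have e : (fun j => (4 * X j ^ 2 : MvPolynomial (Fin 4) ℂ)) =
        ![ellForm 0 + ellForm 1 + ellForm 2 + ellForm 3,
          ellForm 0 + ellForm 1 - ellForm 2 - ellForm 3,
          ellForm 0 - ellForm 1 + ellForm 2 - ellForm 3,
          ellForm 0 - ellForm 1 - ellForm 2 + ellForm 3] := by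
      funext j
      fin_cases j <;> simp [ellForm] <;> ring
    rw [congrFun e j]
    fin_cases j
    · exact add_mem (add_mem (add_mem (hell 0) (hell 1)) (hell 2)) (hell 3)
    · exact sub_mem (sub_mem (add_mem (hell 0) (hell 1)) (hell 2)) (hell 3)
    · exact sub_mem (add_mem (sub_mem (hell 0) (hell 1)) (hell 2)) (hell 3)
    · exact add_mem (sub_mem (sub_mem (hell 0) (hell 1)) (hell 2)) (hell 3)
  have : Algebra.IsAlgebraic R (MvPolynomial (Fin 4) ℂ) := ⟨fun p => by
    change p ∈ E
    have htop : (⊤ : Subalgebra ℂ (MvPolynomial (Fin 4) ℂ)) ≤ E := by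
      rw [← adjoin_range_X, Algebra.adjoin_le_iff]
      rintro _ ⟨j, rfl⟩
      exact hx j
    exact htop Algebra.mem_top⟩
  exact (Algebra.IsAlgebraic.isTranscendenceBasis_of_le_trdeg_of_finite ℂ v (by simp)).1

/-- Composed with the presentation, `segreHom` kills no non-zero polynomial in the four independent
elements, so the kernel of the composite is generated by the equation of the cubic, which is already
zero in `SegreRing`. -/
theorem segreHom_injective : Function.Injective segreHom := by
  rw [injective_iff_map_eq_zero]
  intro b hb
  obtain ⟨p, rfl⟩ := segrePresentation_surjective b
  have h := dvd_of_map_eq_zero (segreHom.toRingHom.comp segrePresentation)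
    irreducible_segreLead.ne_zero isRelPrime_segreLead_segreConst
    (by rw [RingHom.comp_apply, segrePresentation_equation, map_zero]) ?_ hb
  · obtain ⟨q, rfl⟩ := h
    rw [map_mul, segrePresentation_equation, zero_mul]
  · intro c hc
    refine algebraicIndependent_segreHom_segreU.eq_zero_of_aeval_eq_zero c (Eq.trans ?_ hc)
    rw [RingHom.comp_apply, segrePresentation_C]
    exact (comp_aeval_apply _ segreHom _).symm

/-! ## The birational map -/

instance SegreRing.isDomain : IsDomain SegreRing := segreHom_injective.isDomain segreHom.toRingHom

theorem sum_segreX_pow_mem (n : ℕ) : ∑ i, segreX i ^ n ∈ quotientGrading segreIdeal n := by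
  refine ⟨∑ i, X i ^ n, IsHomogeneous.sum _ _ _ fun i _ => isHomogeneous_X_pow i n, ?_⟩
  exact map_sum (Ideal.Quotient.mkₐ ℂ segreIdeal.toIdeal) _ _

theorem permEquiv_sum_segreX_pow (s : Equiv.Perm (Fin 6)) (n : ℕ) :
    permEquiv s (∑ i, segreX i ^ n) = ∑ i, segreX i ^ n := by
  simp only [map_sum, map_pow, permEquiv_segreX]
  exact Equiv.sum_comp s (fun i => segreX i ^ n)

theorem sum_segreX_pow_five_ne_zero : ∑ i, segreX i ^ 5 ≠ 0 := by
  intro h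
  have h2 := segreHom_quintic
  rw [h, map_zero, mul_zero] at h2
  exact mul_ne_zero (by norm_num) (pow_ne_zero 8 segreSlope_theta_ne_zero) h2.symm

theorem aeval_segreQuadric_mem {P : MvPolynomial (Fin 6) ℂ} {d : ℕ} (hP : P.IsHomogeneous d) :
    aeval segreQuadric P ∈ quotientGrading segreIdeal (2 * d) := by
  let T : Fin 6 → MvPolynomial (Fin 6) ℂ := fun i => C 30 * X i ^ 2 - C 5 * ∑ j, X j ^ 2
  have hT : ∀ i, (T i).IsHomogeneous 2 := fun i => by
    have h1 := (isHomogeneous_C (Fin 6) (30 : ℂ)).mul (isHomogeneous_X_pow (R := ℂ) i 2)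
    have h2 := (isHomogeneous_C (Fin 6) (5 : ℂ)).mul (IsHomogeneous.sum Finset.univ _ _
      fun j _ => isHomogeneous_X_pow (R := ℂ) (j : Fin 6) 2)
    rw [zero_add] at h1 h2
    exact h1.sub h2
  refine ⟨aeval T P, hP.aeval T hT, ?_⟩
  refine (comp_aeval_apply T (Ideal.Quotient.mkₐ ℂ segreIdeal.toIdeal) P).trans ?_
  congr 2

theorem segreHom_aeval_segreQuadric {P : MvPolynomial (Fin 6) ℂ} {d : ℕ} (hP : P.IsHomogeneous d) :
    segreHom (aeval segreQuadric P) = (18 * segreSlope theta ^ 3) ^ d * aeval theta P := by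
  rw [comp_aeval_apply]
  simp only [segreHom_segreQuadric]
  rw [P.as_sum, map_sum, map_sum, Finset.mul_sum]
  refine Finset.sum_congr rfl fun m hm => ?_
  have hd := hP (mem_support_iff.mp hm)
  rw [Finsupp.weight_apply, Finsupp.sum_fintype _ _ (by simp)] at hd
  simp only [Pi.one_apply, smul_eq_mul, mul_one] at hd
  rw [aeval_monomial, aeval_monomial, Finsupp.prod_fintype _ _ (by simp),
    Finsupp.prod_fintype _ _ (by simp)]
  simp only [mul_pow (_ * _) (theta _), Finset.prod_mul_distrib, Finset.prod_pow_eq_pow_sum, hd]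
  ring

theorem permEquiv_one : permEquiv 1 = 1 := by
  have h1 := permEquiv_mul 1 1
  rw [mul_one] at h1
  exact (left_eq_mul.mp h1)

theorem permEquiv_mul_apply (s t : Equiv.Perm (Fin 6)) (b : SegreRing) :
    permEquiv (s * t) b = permEquiv s (permEquiv t b) := by rw [permEquiv_mul]; rfl

theorem mul_pow_rearrange {A : Type*} [CommRing A] (x y s a : A) (m n : ℕ) :
    x ^ m * y ^ n * ((18 * s ^ 3) ^ n * a) = (y * 18) ^ n * (a * (x ^ m * (s ^ 3) ^ n)) := by
  rw [mul_pow, mul_pow]; ring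

/-- The quotient of `ℙ³` by a group `G ⊇ N` is birational to a quotient of the Segre cubic, if the
actions of `G` on the six quartic forms and on the Segre cubic are conjugate. -/
theorem birationalOver_of_actsOnTheta {G : Subgroup SL4} (hNG : N ≤ G) {Γ : Type} [Group Γ]
    (q : G → Γ) (hq : Function.Surjective q) (ψ : Γ →* Equiv.Perm (Fin 6)) (c : Equiv.Perm (Fin 6))
    (h : ∀ g : G, ActsOnTheta g.1 (c⁻¹ * ψ (q g) * c)) :
    Scheme.BirationalOver (projectiveSpaceQuotient G) (segreCubicQuotient ψ) := by
  -- Renumbering the coordinates by `c⁻¹` turns `segreHom` into a map equivariant for `ψ` itself.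
  let Ψ : SegreRing →ₐ[ℂ] MvPolynomial (Fin 4) ℂ :=
    segreHom.comp (permEquiv c⁻¹ : SegreRing →ₐ[ℂ] SegreRing)
  have hΨ : ∀ b, Ψ b = segreHom (permEquiv c⁻¹ b) := fun b => rfl
  have hinj : Function.Injective Ψ := segreHom_injective.comp (permEquiv c⁻¹).injective
  have hequiv : ∀ (g : G) b, substEquiv g.1 (Ψ b) = Ψ (permEquiv (ψ (q g)) b) := fun g b => by
    rw [hΨ, hΨ, substEquiv_segreHom (h g), ← permEquiv_mul_apply, ← permEquiv_mul_apply]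
    group
  let φ : invariants (permAction.comp ψ) →ₐ[ℂ] invariants (linearAction.comp G.subtype) :=
    (Ψ.comp (Subalgebra.val _)).codRestrict _ fun b g => (hequiv g b.1).trans (congrArg Ψ (b.2 (q g)))
  have hφ : ∀ b, (φ b).1 = Ψ b.1 := fun b => rfl
  -- The symmetric quintic is invariant, and inverting it inverts the slope, because its image is `9
  -- / 100` times `segreSlope theta ^ 8`.
  let z : invariants (permAction.comp ψ) := ⟨∑ i, segreX i ^ 5, fun γ =>
    permEquiv_sum_segreX_pow (ψ γ) 5⟩
  have hz : 100 * Ψ z.1 = 9 * segreSlope theta ^ 8 := by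
    rw [hΨ, permEquiv_sum_segreX_pow, segreHom_quintic]
  refine birationalOver_of_injective (invariantsGrading (linearAction.comp G.subtype))
    (invariantsGrading (permAction.comp ψ)) φ (fun a b hab => Subtype.ext (hinj ?_))
    (k := 32) (by norm_num) (fun i b hb => ?_) (h := z) (m := 5) (by norm_num)
    (sum_segreX_pow_mem 5) (fun h0 => sum_segreX_pow_five_ne_zero (congrArg Subtype.val h0))
    (fun n a ha => ?_)
  · exact congrArg Subtype.val hab
  · exact isHomogeneous_segreHom (permEquiv_homogeneous _ _ _ hb)
  · have ha' : a.1.IsHomogeneous (4 * (40 * n)) := by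
      rw [show 4 * (40 * n) = n * (32 * 5) by ring]; exact ha
    obtain ⟨P, hP, haP⟩ := exists_isHomogeneous_aeval_theta
      (fun g hg => a.2 ⟨g, hNG hg⟩) ha'
    -- Substituting the quadrics into `P`, of degree `40 * n`, multiplies `a` by `(18 s³) ^ (40 n)`,
    -- where `s` is the slope, and `s ^ (120 n)` is, up to a constant, the image of `z ^ (15 n)`.
    -- Hence `l = 15 * n`, and `r` corrects the constants.
    let r : ℂ := (9 / 100) ^ (15 * n) * (1 / 18) ^ (40 * n)
    let b : SegreRing := r • permEquiv c (aeval segreQuadric P)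
    have hb : Ψ b = a.1 * Ψ z.1 ^ (15 * n) := by
      have hz' : Ψ z.1 = C (9 / 100) * segreSlope theta ^ 8 := by
        have h100 : (100 : MvPolynomial (Fin 4) ℂ) ≠ 0 := by norm_num
        refine mul_left_cancel₀ h100 (hz.trans ?_)
        rw [← mul_assoc, ← map_ofNat C 100, ← map_ofNat C 9, ← C_mul]
        norm_num
      have h18 : (C (1 / 18) : MvPolynomial (Fin 4) ℂ) * 18 = 1 := by
        rw [← map_ofNat C 18, ← C_mul]; norm_num
      rw [map_smul, hΨ, ← permEquiv_mul_apply, inv_mul_cancel, permEquiv_one, AlgEquiv.one_apply,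
        segreHom_aeval_segreQuadric hP, haP, hz', smul_eq_C_mul, C_mul, C_pow, C_pow]
      refine (mul_pow_rearrange (C (9 / 100)) (C (1 / 18)) _ _ (15 * n) (40 * n)).trans ?_
      rw [h18, one_pow, one_mul, mul_pow (C _), ← pow_mul, ← pow_mul,
        show 3 * (40 * n) = 8 * (15 * n) by ring]
    refine ⟨15 * n, ⟨b, fun γ => hinj ?_⟩, ?_, Subtype.ext hb⟩
    -- Invariance of `b` is checked after the injective map `Ψ`, where its image is a product of
    -- invariants.
    · obtain ⟨g, rfl⟩ := hq γ
      refine (hequiv g b).symm.trans ?_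
      rw [hb, map_mul, map_pow, hequiv, permEquiv_sum_segreX_pow]
      exact congrArg (· * _) (a.2 g)
    · have hmem : b ∈ quotientGrading segreIdeal (2 * (40 * n)) := Submodule.smul_mem _ _
        (permEquiv_homogeneous c _ _ (aeval_segreQuadric_mem hP))
      rw [show 2 * (40 * n) = (n + 15 * n) * 5 by ring] at hmem
      exact hmem

/-- The permutation of the six lines by the elements of a group in which `N` is normal. -/
theorem exists_permutationHom (G : Subgroup SL4) (hNG : N ≤ G) [hN : (N.subgroupOf G).Normal] :
    ∃ π : (G ⧸ N.subgroupOf G) →* Equiv.Perm (Fin 6), Function.Injective π ∧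
      ∀ g : G, Permutes g.1 (π (QuotientGroup.mk g)) := by
  have key : ∀ g : G, ∃ σ, Permutes g.1 σ := fun g => exists_permutes fun n hn => by
    have := hN.conj_mem ⟨n, hNG hn⟩ hn g⁻¹
    simpa [Subgroup.mem_subgroupOf] using this
  choose σ hσ using key
  let f : G →* Equiv.Perm (Fin 6) := MonoidHom.mk' σ fun g h =>
    (hσ (g * h)).unique ((hσ g).mul (hσ h))
  have hf : ∀ g, f g = 1 ↔ g ∈ N.subgroupOf G := fun g => by
    rw [Subgroup.mem_subgroupOf]
    constructor
    · intro h
      have h2 := hσ g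
      rw [show σ g = 1 from h] at h2
      exact mem_N_of_permutes_one h2
    · exact fun h => (hσ g).unique (permutes_one_of_mem_N h)
  refine ⟨QuotientGroup.lift _ f fun g hg => (hf g).mpr hg, ?_, hσ⟩
  rw [injective_iff_map_eq_one]
  intro x hx
  obtain ⟨g, rfl⟩ := QuotientGroup.mk_surjective x
  exact (QuotientGroup.eq_one_iff g).mpr ((hf g).mp hx)

end SegreQuotient

theorem mainTheorem3 (G : Subgroup SegreQuotient.SL4) [Finite G]
    (hNG : SegreQuotient.N ≤ G) [hN : (SegreQuotient.N.subgroupOf G).Normal] :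
    ∃ π : (G ⧸ SegreQuotient.N.subgroupOf G) →* Equiv.Perm (Fin 6),
      Function.Injective π ∧
      (∀ (g : G) (i : Fin 6), (SegreQuotient.W i).map (SegreQuotient.wedgeAction g.1) =
        SegreQuotient.W (π (QuotientGroup.mk g) i)) ∧
      (∃ lam : MulAut (Equiv.Perm (Fin 6)), SegreQuotient.IsOuter lam) ∧
      ∀ lam : MulAut (Equiv.Perm (Fin 6)), SegreQuotient.IsOuter lam →
        AlgebraicGeometry.Scheme.BirationalOver
          (SegreQuotient.projectiveSpaceQuotient G)
          (SegreQuotient.segreCubicQuotient (lam.toMonoidHom.comp π)) := by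
  obtain ⟨π, hπ, hperm⟩ := SegreQuotient.exists_permutationHom G hNG
  obtain ⟨mu, hmu, hact⟩ := SegreQuotient.exists_isOuter_actsOnTheta
  refine ⟨π, hπ, hperm, ⟨mu, hmu⟩, fun lam hlam => ?_⟩
  obtain ⟨c, hc⟩ := hlam.exists_eq_conj_mul hmu
  refine SegreQuotient.birationalOver_of_actsOnTheta hNG QuotientGroup.mk
    QuotientGroup.mk_surjective _ c fun g => ?_
  -- The given `lam` is `mu` followed by conjugation by `c`, and `mu` describes the action on the
  -- forms.
  have h : c⁻¹ * lam (π (QuotientGroup.mk g)) * c = mu (π (QuotientGroup.mk g)) := by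
    rw [hc]; group
  exact h.symm ▸ hact _ _ (hperm g)
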